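/- For non-integer $\nu>1/2$ let $I_\mu(x)=\sum_{k\ge0}\frac{(x/2)^{2k+\mu}}{k!\,\Gamma(\mu+k+1)}$, $K_\nu(x)=\frac{\pi}{2\sin\pi\nu}\{I_{-\nu}(x)-I_\nu(x)\}$ and $${\cal K}_n=\int_0^\infty\Big(\frac{2e^x}{\Gamma(\nu)}(x/2)^\nu K_\nu(x)\Big)^{-n}dx ,\qquad \psi(x)=x+\log\frac{2(x/2)^\nu K_\nu(x)}{\Gamma(\nu)}\quad(x>0),$$ where $n$ is real. Let $\nu\in\{2/3,\,6/5,\,4/3\}$, write $\nu=p/q$ in lowest terms, and let $0=e_0<e_1<e_2<\cdots$ be the elements of $\{a+b(2\nu-1):a,b\in\mathbb Z_{\ge0}\}$ in increasing order. (i) The integral ${\cal K}_n$ converges for all sufficiently large $n$. The function $\psi$ is a strictly increasing bijection of $(0,\infty)$ onto itself; let $\tau\mapsto x(\tau)$ be its inverse. For small $x>0$, $\psi(x)$ is the sum of the convergent series in powers of $x^{1/q}$ obtained by adding $x$ to the formal logarithm of $$\sum_{k\ge0}\frac{x^{2k}}{4^kk!(1-\nu)_k}+\Big(\frac x2\Big)^{2\nu}\frac{\Gamma(-\nu)}{\Gamma(\nu)}\sum_{k\ge0}\frac{x^{2k}}{4^kk!(1+\nu)_k}.$$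 (ii) The generalized series $\tau=\psi(x)$ has a unique formal reversion: there is exactly one formal power series $x^{1/q}=T(\tau^{1/q})=\tau^{1/q}+\cdots$ satisfying it. Only the powers $\tau^{e_k}$ occur in the term-by-term derivative of $x=T(\tau^{1/q})^q$ with respect to $\tau$; let $B_k(\nu)$ be the coefficient of $\tau^{e_k}$ there. For all small $\tau>0$, $\frac{dx}{d\tau}=\sum_{k\ge0}B_k(\nu)\tau^{e_k}$, with a convergent series. (iii) As $n\to\infty$ through real values, $${\cal K}_n\sim\sum_{k\ge0}\frac{B_k(\nu)\,\Gamma(e_k+1)}{n^{e_k+1}},$$ that is, for every $N\ge0$ the difference between ${\cal K}_n$ and the sum of the terms with $k<N$ is $O(n^{-e_N-1})$. Explicitly, ${\cal K}_n\sim\sum_{k\ge0}B_k(\tfrac23)\,\Gamma(\tfrac k3+1)\,n^{-k/3-1}$ for $\nu=\tfrac23$; for $\nu=\tfrac65$, with $B_k=B_k(\tfrac65)$, $${\cal K}_n=\frac1n\Big\{1+\frac{B_1}{n}+\frac{B_2\Gamma(\frac{12}5)}{n^{7/5}}+\frac{2B_3}{n^2}+\frac{B_4\Gamma(\frac{17}5)}{n^{12/5}}+\frac{B_5\Gamma(\frac{19}5)}{n^{14/5}}+\frac{6B_6}{n^3}\Big\}+O(n^{-22/5});$$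 for $\nu=\tfrac43$, with $B_k=B_k(\tfrac43)$, $${\cal K}_n=\frac1n\Big\{1+\frac{B_1}{n}+\frac{B_2\Gamma(\frac83)}{n^{5/3}}+\frac{2B_3}{n^2}+\frac{B_4\Gamma(\frac{11}3)}{n^{8/3}}+\frac{6B_5}{n^3}+\frac{B_6\Gamma(\frac{13}3)}{n^{10/3}}\Big\}+O(n^{-14/3}).$$ (iv) $B_0(\nu)=1$ in all three cases, and, correctly rounded (error at most half a unit in the last digit shown), $$\begin{array}{c|r|r|r}k&\nu=2/3&\nu=6/5&\nu=4/3\\\hline 1&1.570228753470&2.5000000000&1.5000000000\\ 2&3.082022922779&-2.4023937306&-1.4329122397\\ 3&5.033299366471&9.3750000000&3.3750000000\\ 4&7.536861569983&-18.7186511511&-6.8958901536\\ 5&10.658049516385&9.1382014252&10.1250000000\\ 6&14.372332247788&42.9687500000&3.3365109159\end{array}$$ -/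

import Mathlib

open Set Filter Topology MeasureTheory Asymptotics
open scoped PowerSeries

noncomputable section

namespace BallK

/-- The modified Bessel function of the first kind,
`I_ν(x) = ∑ₖ (x/2)^(2k+ν) / (k! Γ(ν+k+1))`, for `x > 0`. -/
def besselI (ν x : ℝ) : ℝ :=
  ∑' k : ℕ, (x / 2) ^ (2 * (k : ℝ) + ν) / ((k.factorial : ℝ) * Real.Gamma (ν + k + 1))

/-- The modified Bessel function of the second kind of non-integer order `ν`, for `x > 0`. -/
def besselK (ν x : ℝ) : ℝ :=
  Real.pi / (2 * Real.sin (Real.pi * ν)) * (besselI (-ν) x - besselI ν x)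

/-- The quantity `(2 e^x / Γ(ν)) (x/2)^ν K_ν(x)`. -/
def bracket (ν x : ℝ) : ℝ :=
  2 * Real.exp x / Real.Gamma ν * (x / 2) ^ ν * besselK ν x

/-- The integral `𝒦_n`, as a function of the order `ν` and of the real parameter `n`. -/
def calK (ν n : ℝ) : ℝ :=
  ∫ x in Ioi (0 : ℝ), bracket ν x ^ (-n)

/-- The phase `ψ(x) = x + log (2 (x/2)^ν K_ν(x) / Γ(ν))`. -/
def phase (ν x : ℝ) : ℝ :=
  x + Real.log (2 * (x / 2) ^ ν * besselK ν x / Real.Gamma ν)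

/-- The inverse function `τ ↦ x(τ)` of the phase, for `τ > 0`. -/
def invPhase (ν : ℝ) : ℝ → ℝ :=
  Function.invFunOn (phase ν) (Ioi 0)

/-- `1 / (4^k k! (1+μ)_k)`: the coefficient of `x^(2k)` in `Γ(1+μ) (x/2)^(-μ) I_μ(x)`. -/
def hypCoeff (μ : ℝ) (k : ℕ) : ℝ :=
  1 / (4 ^ k * (k.factorial : ℝ) * (ascPochhammer ℝ k).eval (1 + μ))

/-- For `ν = p/q`, the generalized (fractional-power) series of `(2/Γ(ν)) (x/2)^ν K_ν(x)`,
`∑ₖ x^(2k)/(4^k k! (1-ν)_k) + (x/2)^(2ν) (Γ(-ν)/Γ(ν)) ∑ₖ x^(2k)/(4^k k! (1+ν)_k)`,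
as a formal power series in `t = x^(1/q)`. -/
def bracketSeries (p q : ℕ) : ℝ⟦X⟧ :=
  PowerSeries.mk fun m =>
    (if 2 * q ∣ m then hypCoeff (-((p : ℝ) / q)) (m / (2 * q)) else 0) +
    (if 2 * p ≤ m ∧ 2 * q ∣ m - 2 * p then
      (1 / 2 : ℝ) ^ (2 * ((p : ℝ) / q)) * (Real.Gamma (-((p : ℝ) / q)) / Real.Gamma ((p : ℝ) / q)) *
        hypCoeff ((p : ℝ) / q) ((m - 2 * p) / (2 * q))
     else 0)

/-- For `ν = p/q`, the generalized series of `ψ(x)`, as a formal power series in `t = x^(1/q)`. -/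
def phaseSeries (p q : ℕ) : ℝ⟦X⟧ :=
  PowerSeries.X ^ q + PowerSeries.logOf (bracketSeries p q)

/-- `T`, a formal power series in `s = τ^(1/q)`, is the expansion of `x^(1/q)` that reverts
the generalized series `τ = ψ(x)`: `T = s + ⋯` and `ψ(T^q) = s^q` formally. -/
def IsReversion (p q : ℕ) (T : ℝ⟦X⟧) : Prop :=
  PowerSeries.constantCoeff T = 0 ∧ PowerSeries.coeff 1 T = 1 ∧
    (phaseSeries p q).subst T = (PowerSeries.X : ℝ⟦X⟧) ^ q

/-- The series `x^(1/q) = T(s)` obtained by reversion. -/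
def reversion (p q : ℕ) : ℝ⟦X⟧ :=
  Classical.epsilon (IsReversion p q)

/-- The coefficient of `τ^(m/q)` in the term-by-term derivative with respect to `τ` of
`x = T(s)^q`, where `s = τ^(1/q)`. -/
def derivCoeff (p q m : ℕ) : ℝ :=
  ((m : ℝ) / q + 1) * PowerSeries.coeff (m + q) (reversion p q ^ q)

/-- The `k`-th element (`k = 0, 1, 2, …`) in increasing order of the set of the integers
`a q + b (2p - q)` with `a, b ∈ ℕ`. -/
def expIndex (p q k : ℕ) : ℕ :=
  Nat.nth (fun m => ∃ a b : ℕ, m = a * q + b * (2 * p - q)) k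

/-- For `ν = p/q`, the exponent `e_k`: the `k`-th element in increasing order of
`{a + b (2ν - 1) : a, b ∈ ℕ}`. -/
def expo (p q k : ℕ) : ℝ := (expIndex p q k : ℝ) / q

/-- For `ν = p/q`, the coefficient `B_k(ν)` of `τ^(e_k)` in `dx/dτ`. -/
def B (p q k : ℕ) : ℝ := derivCoeff p q (expIndex p q k)

end BallK

end

/-! Write y = (x/2)². The function 2(x/2)^ν K_ν(x) equals M_ν(y) = ∫₀^∞ e^(-t-y/t) t^(ν-1) dt
(`two_mul_besselK_eq`). The integral makes positivity, monotonicity and growth accessible, while the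
Bessel series gives the behaviour at 0. The two descriptions are matched in `macdonald_mul_sin`: M_ν
and the two series solve the same second order equation, and their pairwise Wronskians are constants
that can be read off as y → 0.

Since `bracket` is e^ψ, the substitution τ = ψ(x) turns 𝒦_n into a Laplace integral of e^(-nτ)
dx/dτ. It is legitimate because ψ' = 1 - (x/2) M_(ν-1)/M_ν > 0, which for ν > 1/2 follows by
symmetrizing the integral under t ↦ z²/t (`mul_macdonald_sub_one_lt`). A saddle point estimate gives
e^ψ ≥ c x^(ν-1/2) for large x, hence surjectivity of ψ and convergence for large n.

Near 0, put t = x^(1/q). Then ψ(t^q) is the restriction to t > 0 of an analytic function. Its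
leading term is t^q, because the first correction has order min(2p, 2q) > q; this is again ν > 1/2.
So the series is (tH(t))^q with H(0) = 1, and reversion amounts to inverting tH(t)
(`exists_reversion`), which yields existence, uniqueness and convergence together. The predicate
`Represents` carries identities between analytic germs and formal series in both directions.

Lagrange inversion gives the coefficient of τ^(m/q) in dx/dτ as [t^m] H^(-(m+q))
(`exists_derivCoeff_eq`). A logarithmic-derivative recurrence then shows that only exponents aq +
b(2p-q) occur, and it also computes the coefficients. Watson's lemma converts the series of dx/dτ
into the asymptotic expansion (`calK_expansion`).

The coefficients found this way are polynomials in one transcendental number, the coefficient c of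
x^(2ν), that is, in Γ(2/3)/Γ(1/3) or Γ(4/5)/Γ(1/5) up to elementary factors. These ratios are
enclosed by rational numbers through Euler's limit for Γ, accelerated so that the approximating
sequences become monotone. -/

noncomputable section

namespace BallK

/-! ### The entire factor of the Bessel function I -/

/-- The entire function `∑ₖ y^k / (k! Γ(μ+k+1))`, so that `I_μ(x) = (x/2)^μ E_μ(x²/4)`. -/
def besselE (μ y : ℝ) : ℝ :=
  ∑' k : ℕ, y ^ k / ((k.factorial : ℝ) * Real.Gamma (μ + k + 1))

/-- Γ ≥ 1 on [2, ∞), so all but finitely many reciprocals are at most 1. At a pole the convention Γ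
= 0 gives reciprocal 0, which is the correct value of 1/Γ. -/
lemma exists_abs_inv_Gamma_le (μ : ℝ) :
    ∃ C : ℝ, 0 ≤ C ∧ ∀ k : ℕ, |(Real.Gamma (μ + k + 1))⁻¹| ≤ C := by
  have h : ∀ᶠ k : ℕ in atTop, |(Real.Gamma (μ + k + 1))⁻¹| ≤ 1 := by
    have : Tendsto (fun k : ℕ => μ + k + 1) atTop atTop :=
      tendsto_atTop_add_const_right _ _ (tendsto_atTop_add_const_left _ _ tendsto_natCast_atTop_atTop)
    filter_upwards [this.eventually_ge_atTop 2] with k hk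
    have h1 : 1 ≤ Real.Gamma (μ + k + 1) := by
      have := Real.Gamma_strictMonoOn_Ici.monotoneOn (by simp) hk hk
      rwa [Real.Gamma_two] at this
    rw [abs_of_nonneg (by positivity)]
    exact inv_le_one_of_one_le₀ h1
  obtain ⟨C, hC⟩ := (isBoundedUnder_of_eventually_le h).bddAbove_range
  exact ⟨C, (abs_nonneg _).trans (hC ⟨0, rfl⟩), fun k => hC ⟨k, rfl⟩⟩

lemma summable_besselE (μ y : ℝ) :
    Summable fun k : ℕ => y ^ k / ((k.factorial : ℝ) * Real.Gamma (μ + k + 1)) := by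
  obtain ⟨C, hC0, hC⟩ := exists_abs_inv_Gamma_le μ
  refine Summable.of_norm_bounded (g := fun k => |y| ^ k / k.factorial * C)
    ((Real.summable_pow_div_factorial |y|).mul_right C) fun k => ?_
  rw [← div_div, div_eq_mul_inv _ (Real.Gamma _), norm_mul, norm_div, norm_pow, Real.norm_eq_abs,
    Real.norm_eq_abs, Real.norm_eq_abs, Nat.abs_cast]
  gcongr
  exact hC k

lemma besselE_zero (μ : ℝ) : besselE μ 0 = (Real.Gamma (μ + 1))⁻¹ := by
  rw [besselE, tsum_eq_single 0]
  · simp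
  · intro k hk
    simp [hk]

/-- Termwise differentiation, dominated on the ball of radius |y| + 1 by an exponential series; the
shift k ↦ k + 1 raises the order by one. -/
lemma hasDerivAt_besselE (μ y : ℝ) : HasDerivAt (besselE μ) (besselE (μ + 1) y) y := by
  obtain ⟨C, hC0, hC⟩ := exists_abs_inv_Gamma_le μ
  set R := |y| + 1 with hR
  have hR0 : 0 < R := by positivity
  have hu : Summable fun k : ℕ => (k : ℝ) * R ^ (k - 1) / k.factorial * C := by
    refine Summable.mul_right C ?_
    rw [← summable_nat_add_iff 1]
    refine (Real.summable_pow_div_factorial R).congr fun k => ?_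
    rw [Nat.add_sub_cancel, Nat.factorial_succ]
    push_cast
    field_simp
  have key := hasDerivAt_tsum_of_isPreconnected
    (g := fun (k : ℕ) (y : ℝ) => y ^ k / ((k.factorial : ℝ) * Real.Gamma (μ + k + 1)))
    (g' := fun (k : ℕ) (y : ℝ) => (k * y ^ (k - 1)) / ((k.factorial : ℝ) * Real.Gamma (μ + k + 1)))
    hu (t := Metric.ball 0 R) (y₀ := 0) (y := y) Metric.isOpen_ball
    (convex_ball _ _).isPreconnected
    (fun k x _ => by simpa using (hasDerivAt_pow k x).div_const _)
    (fun k x hx => by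
      rw [← div_div, div_eq_mul_inv _ (Real.Gamma _), norm_mul, norm_div, norm_mul, norm_pow,
        Real.norm_eq_abs, Real.norm_eq_abs, Real.norm_eq_abs, Real.norm_eq_abs, Nat.abs_cast,
        Nat.abs_cast]
      rw [mem_ball_zero_iff, Real.norm_eq_abs] at hx
      gcongr
      exact hC k)
    (by simpa using hR0) (summable_besselE μ 0) (by simp [hR])
  refine HasDerivAt.congr_deriv (f := besselE μ) key ?_
  have h0 : Summable fun k : ℕ =>
      (k * y ^ (k - 1)) / ((k.factorial : ℝ) * Real.Gamma (μ + k + 1)) := by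
    rw [← summable_nat_add_iff 1]
    refine (summable_besselE (μ + 1) y).congr fun k => ?_
    rw [Nat.add_sub_cancel, Nat.factorial_succ]
    push_cast
    rw [show μ + 1 + k + 1 = μ + (k + 1) + 1 by ring]
    rw [mul_assoc, mul_div_mul_left]
    positivity
  rw [h0.tsum_eq_zero_add, besselE]
  simp only [Nat.cast_zero, zero_mul, zero_div, zero_add]
  refine tsum_congr fun k => ?_
  rw [Nat.add_sub_cancel, Nat.factorial_succ]
  push_cast
  rw [show μ + 1 + k + 1 = μ + (k + 1) + 1 by ring]
  rw [mul_assoc, mul_div_mul_left]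
  positivity

lemma continuous_besselE (μ : ℝ) : Continuous (besselE μ) :=
  continuous_iff_continuousAt.2 fun y => (hasDerivAt_besselE μ y).continuousAt

lemma inv_Gamma_eq (s : ℝ) : (Real.Gamma s)⁻¹ = s * (Real.Gamma (s + 1))⁻¹ := by
  rcases eq_or_ne s 0 with rfl | hs
  · simp
  · rw [Real.Gamma_add_one hs, mul_inv, mul_inv_cancel_left₀ hs]

/-- Termwise this is (μ+k+1)/Γ(μ+k+2) = 1/Γ(μ+k+1), split into the parts k and μ+1. Combined with
the derivative formula it is the differential equation of `besselE`. -/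
lemma besselE_recurrence (μ y : ℝ) :
    besselE μ y = y * besselE (μ + 2) y + (μ + 1) * besselE (μ + 1) y := by
  have h0 : Summable fun k : ℕ =>
      k * (y ^ k / ((k.factorial : ℝ) * Real.Gamma (μ + k + 2))) := by
    rw [← summable_nat_add_iff 1]
    refine ((summable_besselE (μ + 2) y).mul_left y).congr fun k => ?_
    rw [Nat.factorial_succ]
    push_cast
    rw [show μ + 2 + k + 1 = μ + (k + 1) + 2 by ring]
    simp only [div_eq_mul_inv, mul_inv]
    field_simp
    ring
  have h1 : y * besselE (μ + 2) y =
      ∑' k : ℕ, k * (y ^ k / ((k.factorial : ℝ) * Real.Gamma (μ + k + 2))) := by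
    rw [h0.tsum_eq_zero_add, besselE, ← tsum_mul_left]
    simp only [Nat.cast_zero, zero_mul, zero_add]
    refine tsum_congr fun k => ?_
    rw [Nat.factorial_succ]
    push_cast
    rw [show μ + 2 + k + 1 = μ + (k + 1) + 2 by ring]
    simp only [div_eq_mul_inv, mul_inv]
    field_simp
    ring
  rw [h1, besselE, besselE, ← tsum_mul_left, ← h0.tsum_add ((summable_besselE _ y).mul_left _)]
  refine tsum_congr fun k => ?_
  simp only [div_eq_mul_inv, mul_inv]
  rw [inv_Gamma_eq (μ + k + 1), show μ + k + 1 + 1 = μ + k + 2 by ring,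
    show μ + 1 + k + 1 = μ + k + 2 by ring]
  ring

/-! ### The Macdonald integral -/

/-- The integral `∫₀^∞ e^(-t-y/t) t^(ν-1) dt`, which is `2 (x/2)^ν K_ν(x)` for `y = x²/4`. -/
def macdonald (ν y : ℝ) : ℝ :=
  ∫ t in Ioi (0 : ℝ), Real.exp (-t - y / t) * t ^ (ν - 1)

/-- From u^N/N! ≤ e^u at u = y/t: the factor e^(-y/t) buys any number N of powers of t near 0, which
is why the integral converges for every exponent. -/
lemma exp_mul_rpow_le {y t : ℝ} (hy : 0 < y) (ht : 0 < t) (a : ℝ) (N : ℕ) :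
    Real.exp (-t - y / t) * t ^ a ≤ (N.factorial / y ^ N) * (Real.exp (-t) * t ^ (a + N)) := by
  have h1 := Real.pow_div_factorial_le_exp (y / t) (by positivity) N
  have h2 : Real.exp (-(y / t)) ≤ N.factorial / y ^ N * t ^ N := by
    rw [Real.exp_neg]
    refine (inv_anti₀ (by positivity) h1).trans_eq ?_
    rw [div_pow]
    field_simp
  rw [sub_eq_add_neg, Real.exp_add, Real.rpow_add ht, Real.rpow_natCast]
  calc _ ≤ Real.exp (-t) * (N.factorial / y ^ N * t ^ N) * t ^ a := by gcongr
    _ = _ := by ring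

lemma integrableOn_exp_neg_mul_rpow {a : ℝ} (ha : -1 < a) :
    IntegrableOn (fun t : ℝ => Real.exp (-t) * t ^ a) (Ioi 0) := by
  simpa using Real.GammaIntegral_convergent (s := a + 1) (by linarith)

lemma aestronglyMeasurable_macdonald (a y : ℝ) :
    AEStronglyMeasurable (fun t : ℝ => Real.exp (-t - y / t) * t ^ a) (volume.restrict (Ioi 0)) := by
  refine Measurable.aestronglyMeasurable ?_
  fun_prop

lemma integrableOn_macdonald {y : ℝ} (hy : 0 < y) (a : ℝ) :
    IntegrableOn (fun t : ℝ => Real.exp (-t - y / t) * t ^ a) (Ioi 0) := by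
  obtain ⟨N, hN⟩ := exists_nat_gt (-1 - a)
  refine Integrable.mono' ((integrableOn_exp_neg_mul_rpow (a := a + N) (by linarith)).const_mul
    (N.factorial / y ^ N)) (aestronglyMeasurable_macdonald a y) ?_
  filter_upwards [ae_restrict_mem measurableSet_Ioi] with t (ht : 0 < t)
  rw [Real.norm_of_nonneg (by positivity)]
  exact exp_mul_rpow_le hy ht a N

lemma macdonald_pos {y : ℝ} (hy : 0 < y) (ν : ℝ) : 0 < macdonald ν y := by
  refine (integral_pos_iff_support_of_nonneg_ae ?_ (integrableOn_macdonald hy _)).2 ?_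
  · filter_upwards [ae_restrict_mem measurableSet_Ioi] with t (ht : 0 < t)
    simp only [Pi.zero_apply]
    positivity
  · have : Ioi (0 : ℝ) ⊆ Function.support fun t : ℝ => Real.exp (-t - y / t) * t ^ (ν - 1) := by
      intro t (ht : 0 < t)
      exact (by positivity : 0 < Real.exp (-t - y / t) * t ^ (ν - 1)).ne'
    refine lt_of_lt_of_le ?_ (measure_mono this)
    simp

/-- Each y-derivative brings down -1/t, lowering the order by one. The integrand decreases in y, so
its value at y/2 dominates a neighbourhood of y. -/
lemma hasDerivAt_macdonald {y : ℝ} (hy : 0 < y) (ν : ℝ) :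
    HasDerivAt (macdonald ν) (-macdonald (ν - 1) y) y := by
  have key := hasDerivAt_integral_of_dominated_loc_of_deriv_le
    (μ := volume.restrict (Ioi (0 : ℝ)))
    (F := fun (y t : ℝ) => Real.exp (-t - y / t) * t ^ (ν - 1))
    (F' := fun (y t : ℝ) => -(Real.exp (-t - y / t) * t ^ (ν - 1 - 1)))
    (bound := fun t => Real.exp (-t - (y / 2) / t) * t ^ (ν - 1 - 1))
    (x₀ := y) (s := Ioi (y / 2)) (Ioi_mem_nhds (by linarith))
    (Eventually.of_forall fun x => aestronglyMeasurable_macdonald _ _)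
    (integrableOn_macdonald hy _) (aestronglyMeasurable_macdonald _ _).neg
    (by
      filter_upwards [ae_restrict_mem measurableSet_Ioi] with t (ht : 0 < t) x (hx : y / 2 < x)
      rw [norm_neg, Real.norm_of_nonneg (by positivity)]
      gcongr)
    (integrableOn_macdonald (by linarith) _)
    (by
      filter_upwards [ae_restrict_mem measurableSet_Ioi] with t (ht : 0 < t) x _
      have h := ((((hasDerivAt_id x).div_const t).const_sub (-t)).exp).mul_const (t ^ (ν - 1))
      refine h.congr_deriv ?_
      rw [Real.rpow_sub_one ht.ne' (ν - 1)]
      simp only [id]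
      ring)
  refine key.2.congr_deriv ?_
  rw [integral_neg, macdonald]

lemma tendsto_macdonald_integrand_zero {y : ℝ} (hy : 0 < y) (a : ℝ) :
    Tendsto (fun t : ℝ => Real.exp (-t - y / t) * t ^ a) (𝓝[>] 0) (𝓝 0) := by
  obtain ⟨N, hN⟩ := exists_nat_gt (-a)
  have h1 : Tendsto (fun t : ℝ => (N.factorial / y ^ N) * (Real.exp (-t) * t ^ (a + N)))
      (𝓝[>] 0) (𝓝 0) := by
    have : ContinuousAt (fun t : ℝ => (N.factorial / y ^ N) * (Real.exp (-t) * t ^ (a + N))) 0 := by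
      refine continuousAt_const.mul (ContinuousAt.mul (by fun_prop) ?_)
      exact Real.continuousAt_rpow_const _ _ (Or.inr (by linarith))
    have h2 := this.tendsto
    simp only [Real.zero_rpow (show a + N ≠ 0 by linarith), mul_zero] at h2
    exact h2.mono_left nhdsWithin_le_nhds
  refine squeeze_zero' ?_ ?_ h1
  · filter_upwards [self_mem_nhdsWithin] with t (ht : 0 < t)
    positivity
  · filter_upwards [self_mem_nhdsWithin] with t (ht : 0 < t)
    exact exp_mul_rpow_le hy ht a N

lemma tendsto_macdonald_integrand_atTop {y : ℝ} (hy : 0 < y) (a : ℝ) :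
    Tendsto (fun t : ℝ => Real.exp (-t - y / t) * t ^ a) atTop (𝓝 0) := by
  have h1 := tendsto_rpow_mul_exp_neg_mul_atTop_nhds_zero a 1 one_pos
  refine squeeze_zero' ?_ ?_ h1
  · filter_upwards [eventually_gt_atTop 0] with t (ht : 0 < t)
    positivity
  · filter_upwards [eventually_gt_atTop 0] with t (ht : 0 < t)
    rw [mul_comm]
    gcongr
    have : 0 < y / t := by positivity
    linarith

/-- The derivative in t of e^(-t-y/t) t^(ν-1) integrates to 0, since the function vanishes at both
ends. -/
lemma macdonald_recurrence {y : ℝ} (hy : 0 < y) (ν : ℝ) :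
    macdonald ν y = y * macdonald (ν - 2) y + (ν - 1) * macdonald (ν - 1) y := by
  have hderiv : ∀ t ∈ Ioi (0 : ℝ), HasDerivAt (fun t : ℝ => Real.exp (-t - y / t))
      (Real.exp (-t - y / t) * (-1 + y / t ^ 2)) t := by
    intro t (ht : 0 < t)
    have h := (((hasDerivAt_id t).neg.sub ((hasDerivAt_id t).inv ht.ne' |>.const_mul y))).exp
    refine (h.congr_deriv ?_)
    simp only [id, Pi.neg_apply, Pi.sub_apply, Pi.inv_apply]
    simp only [div_eq_mul_inv]
    ring
  have hderiv' : ∀ t ∈ Ioi (0 : ℝ), HasDerivAt (fun t : ℝ => t ^ (ν - 1))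
      ((ν - 1) * t ^ (ν - 1 - 1)) t := fun t (ht : 0 < t) =>
    Real.hasDerivAt_rpow_const (Or.inl ht.ne')
  have heq : EqOn ((fun t : ℝ => Real.exp (-t - y / t) * (-1 + y / t ^ 2)) * (fun t : ℝ => t ^ (ν - 1))
      + (fun t : ℝ => Real.exp (-t - y / t)) * fun t : ℝ => (ν - 1) * t ^ (ν - 1 - 1))
      (fun t => -(Real.exp (-t - y / t) * t ^ (ν - 1)) +
        (y * (Real.exp (-t - y / t) * t ^ (ν - 2 - 1)) +
          (ν - 1) * (Real.exp (-t - y / t) * t ^ (ν - 1 - 1)))) (Ioi 0) := by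
    intro t (ht : 0 < t)
    simp only [Pi.add_apply, Pi.mul_apply]
    rw [show ν - 2 - 1 = ν - 1 - 2 by ring, Real.rpow_sub ht (ν - 1) 2, Real.rpow_two]
    field_simp
    ring
  have i0 := integrableOn_macdonald hy (ν - 1)
  have i1 := integrableOn_macdonald hy (ν - 1 - 1)
  have i2 := integrableOn_macdonald hy (ν - 2 - 1)
  have h := integral_Ioi_deriv_mul_eq_sub hderiv hderiv'
    ((i0.neg.add ((i2.const_mul y).add (i1.const_mul (ν - 1)))).congr_fun heq.symm measurableSet_Ioi)
    (tendsto_macdonald_integrand_zero hy (ν - 1)) (tendsto_macdonald_integrand_atTop hy (ν - 1))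
  have h2 := (setIntegral_congr_fun measurableSet_Ioi heq).symm.trans h
  have e1 := integral_add i0.neg ((i2.const_mul y).add (i1.const_mul (ν - 1)))
  have e2 := integral_add (i2.const_mul y) (i1.const_mul (ν - 1))
  simp only [Pi.add_apply, Pi.neg_apply, integral_neg, integral_const_mul] at e1 e2 h2
  simp only [macdonald]
  linarith

/-- The substitution t ↦ y/t, carried out as an inversion followed by a scaling. -/
lemma macdonald_neg {y : ℝ} (hy : 0 < y) (ν : ℝ) :
    macdonald ν y = y ^ ν * macdonald (-ν) y := by
  have h1 := integral_comp_rpow_Ioi (fun t : ℝ => Real.exp (-t - y / t) * t ^ (ν - 1))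
    (p := -1) (by norm_num)
  have h2 := integral_comp_mul_left_Ioi
    (fun t : ℝ => (|(-1 : ℝ)| * t ^ ((-1 : ℝ) - 1)) • (Real.exp (-t ^ (-1 : ℝ) - y / t ^ (-1 : ℝ)) *
      (t ^ (-1 : ℝ)) ^ (ν - 1))) 0 (b := y⁻¹) (by positivity)
  rw [mul_zero, h1, inv_inv] at h2
  have h3 : EqOn (fun x : ℝ => (|(-1 : ℝ)| * (y⁻¹ * x) ^ ((-1 : ℝ) - 1)) •
      (Real.exp (-(y⁻¹ * x) ^ (-1 : ℝ) - y / (y⁻¹ * x) ^ (-1 : ℝ)) *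
        ((y⁻¹ * x) ^ (-1 : ℝ)) ^ (ν - 1)))
      (fun x => y ^ (ν + 1) * (Real.exp (-x - y / x) * x ^ (-ν - 1))) (Ioi 0) := by
    intro x (hx : 0 < x)
    simp only [smul_eq_mul, abs_neg, abs_one, one_mul]
    rw [← Real.rpow_mul (by positivity), Real.rpow_neg_one, mul_inv, inv_inv]
    rw [show -(y * x⁻¹) - y / (y * x⁻¹) = -x - y / x by field_simp; ring, mul_left_comm,
      ← Real.rpow_add (by positivity), mul_comm y⁻¹ x, ← div_eq_mul_inv,
      Real.div_rpow hx.le hy.le, show (-1 : ℝ) - 1 + -1 * (ν - 1) = -(ν + 1) by ring,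
      Real.rpow_neg hy.le, show -ν - 1 = -(ν + 1) by ring]
    field_simp
  rw [setIntegral_congr_fun measurableSet_Ioi h3, integral_const_mul, smul_eq_mul,
    Real.rpow_add_one hy.ne', mul_right_comm, mul_comm _ y, mul_right_inj' hy.ne'] at h2
  exact h2.symm

lemma tendsto_macdonald_zero {ν : ℝ} (hν : 0 < ν) :
    Tendsto (macdonald ν) (𝓝[>] 0) (𝓝 (Real.Gamma ν)) := by
  rw [Real.Gamma_eq_integral hν]
  refine tendsto_integral_filter_of_dominated_convergence
    (fun t => Real.exp (-t) * t ^ (ν - 1))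
    (Eventually.of_forall fun y => aestronglyMeasurable_macdonald _ _) ?_
    (Real.GammaIntegral_convergent hν) ?_
  · filter_upwards [self_mem_nhdsWithin] with y (hy : 0 < y)
    filter_upwards [ae_restrict_mem measurableSet_Ioi] with t (ht : 0 < t)
    rw [Real.norm_of_nonneg (by positivity)]
    gcongr
    have : 0 < y / t := by positivity
    linarith
  · filter_upwards [ae_restrict_mem measurableSet_Ioi] with t (ht : 0 < t)
    have : Continuous fun y : ℝ => Real.exp (-t - y / t) * t ^ (ν - 1) := by fun_prop
    have h := (this.tendsto 0).mono_left (nhdsWithin_le_nhds (s := Ioi 0))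
    simpa using h

/-- Dominated convergence: (y/t) e^(-y/t) ≤ 1 bounds the integrand by that of Γ(ν). This disposes of
a term in a Wronskian at 0 for all ν > 0, although M_(ν-1) itself may blow up. -/
lemma tendsto_mul_macdonald_sub_one_zero {ν : ℝ} (hν : 0 < ν) :
    Tendsto (fun y => y * macdonald (ν - 1) y) (𝓝[>] 0) (𝓝 0) := by
  have h1 : Tendsto (fun y => ∫ t in Ioi (0 : ℝ), y * (Real.exp (-t - y / t) * t ^ (ν - 1 - 1)))
      (𝓝[>] 0) (𝓝 (∫ t in Ioi (0 : ℝ), 0)) := by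
    refine tendsto_integral_filter_of_dominated_convergence
      (fun t => Real.exp (-t) * t ^ (ν - 1))
      (Eventually.of_forall fun y => (aestronglyMeasurable_macdonald _ _).const_mul _) ?_
      (Real.GammaIntegral_convergent hν) ?_
    · filter_upwards [self_mem_nhdsWithin] with y (hy : 0 < y)
      filter_upwards [ae_restrict_mem measurableSet_Ioi] with t (ht : 0 < t)
      rw [Real.norm_of_nonneg (by positivity)]
      have := exp_mul_rpow_le hy ht (ν - 1 - 1) 1
      calc y * (Real.exp (-t - y / t) * t ^ (ν - 1 - 1))
          ≤ y * (((1 : ℕ).factorial / y ^ 1) * (Real.exp (-t) * t ^ (ν - 1 - 1 + (1 : ℕ)))) := by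
            gcongr
        _ = _ := by
          simp
          field_simp
    · filter_upwards [ae_restrict_mem measurableSet_Ioi] with t (ht : 0 < t)
      have : Continuous fun y : ℝ => y * (Real.exp (-t - y / t) * t ^ (ν - 1 - 1)) := by fun_prop
      have h := (this.tendsto 0).mono_left (nhdsWithin_le_nhds (s := Ioi 0))
      simpa using h
  simp only [integral_const_mul, integral_zero] at h1
  exact h1

/-! ### Wronskians and the connection formula -/

lemma hasDerivAt_rpow_mul_besselE {y : ℝ} (hy : 0 < y) (ν : ℝ) :
    HasDerivAt (fun y => y ^ ν * besselE ν y) (y ^ (ν - 1) * besselE (ν - 1) y) y := by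
  refine ((Real.hasDerivAt_rpow_const (Or.inl hy.ne')).mul (hasDerivAt_besselE ν y)).congr_deriv ?_
  rw [besselE_recurrence (ν - 1), show ν - 1 + 2 = ν + 1 by ring, sub_add_cancel,
    Real.rpow_sub_one hy.ne']
  field_simp
  ring

/-- If two solutions of `y f'' = (ν - 1) f' + f` have a Wronskian that tends to `c` at `0`, after
multiplication by `y^(1-ν)`, then it is equal to `c`. -/
lemma wronskian_eq {ν c : ℝ} {f f' g g' : ℝ → ℝ}
    (hf : ∀ y, 0 < y → HasDerivAt f (f' y) y)
    (hf' : ∀ y, 0 < y → HasDerivAt f' (((ν - 1) * f' y + f y) / y) y)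
    (hg : ∀ y, 0 < y → HasDerivAt g (g' y) y)
    (hg' : ∀ y, 0 < y → HasDerivAt g' (((ν - 1) * g' y + g y) / y) y)
    (hc : Tendsto (fun y => y ^ (1 - ν) * (f y * g' y - f' y * g y)) (𝓝[>] 0) (𝓝 c))
    {y : ℝ} (hy : 0 < y) : y ^ (1 - ν) * (f y * g' y - f' y * g y) = c := by
  set W := fun y => y ^ (1 - ν) * (f y * g' y - f' y * g y) with hW
  -- Abel's identity: f g' - f' g has logarithmic derivative (ν-1)/y, which the factor y^(1-ν)
  -- cancels.
  have hd : ∀ x, 0 < x → HasDerivAt W 0 x := by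
    intro x hx
    have h := (Real.hasDerivAt_rpow_const (p := 1 - ν) (Or.inl hx.ne')).mul
      (((hf x hx).mul (hg' x hx)).sub ((hf' x hx).mul (hg x hx)))
    refine h.congr_deriv ?_
    rw [Real.rpow_sub_one hx.ne']
    simp only [Pi.sub_apply, Pi.mul_apply]
    field_simp
    ring
  have hconst : ∀ x, 0 < x → W x = W y := fun x hx =>
    isOpen_Ioi.is_const_of_deriv_eq_zero (convex_Ioi (0 : ℝ)).isPreconnected
      (fun z hz => (hd z hz).differentiableAt.differentiableWithinAt)
      (fun z hz => (hd z hz).deriv) (mem_Ioi.2 hx) (mem_Ioi.2 hy)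
  refine tendsto_nhds_unique (tendsto_const_nhds.congr' ?_) hc
  filter_upwards [self_mem_nhdsWithin] with x hx
  exact (hconst x hx).symm

lemma tendsto_besselE_zero (μ : ℝ) :
    Tendsto (besselE μ) (𝓝[>] 0) (𝓝 (Real.Gamma (μ + 1))⁻¹) := by
  have h := ((continuous_besselE μ).tendsto 0).mono_left (nhdsWithin_le_nhds (s := Ioi 0))
  rwa [besselE_zero] at h

lemma tendsto_id_nhdsGT_zero : Tendsto (fun y : ℝ => y) (𝓝[>] 0) (𝓝 0) :=
  nhdsWithin_le_nhds

lemma inv_Gamma_mul_inv_Gamma_one_sub (ν : ℝ) :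
    (Real.Gamma (1 - ν))⁻¹ * (Real.Gamma ν)⁻¹ = Real.sin (Real.pi * ν) / Real.pi := by
  rw [← mul_inv, mul_comm, Real.Gamma_mul_Gamma_one_sub, inv_div]

/-- With u = E_(-ν), v = y^ν E_ν and M = M_ν, the identity M·W(u,v) = u·W(M,v) - v·W(M,u) holds for
any three functions. The three normalized Wronskians are sin(πν)/π, 1 and 1, found from the limits
at 0. The condition ν < 1 serves only W(M,u). -/
lemma macdonald_mul_sin_of_lt_one {ν y : ℝ} (h0 : 0 < ν) (h1 : ν < 1) (hy : 0 < y) :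
    macdonald ν y * (Real.sin (Real.pi * ν) / Real.pi) =
      besselE (-ν) y - y ^ ν * besselE ν y := by
  have hu : ∀ y, 0 < y → HasDerivAt (besselE (-ν)) (besselE (-ν + 1) y) y :=
    fun y _ => hasDerivAt_besselE _ _
  have hu' : ∀ y, 0 < y → HasDerivAt (besselE (-ν + 1))
      (((ν - 1) * besselE (-ν + 1) y + besselE (-ν) y) / y) y := fun y hy => by
    refine (hasDerivAt_besselE _ _).congr_deriv ?_
    rw [besselE_recurrence (-ν), show -ν + 1 + 1 = -ν + 2 by ring]
    field_simp
    ring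
  have hv : ∀ y, 0 < y → HasDerivAt (fun y => y ^ ν * besselE ν y)
      (y ^ (ν - 1) * besselE (ν - 1) y) y := fun y hy => hasDerivAt_rpow_mul_besselE hy ν
  have hv' : ∀ y, 0 < y → HasDerivAt (fun y => y ^ (ν - 1) * besselE (ν - 1) y)
      (((ν - 1) * (y ^ (ν - 1) * besselE (ν - 1) y) + y ^ ν * besselE ν y) / y) y := fun y hy => by
    refine (hasDerivAt_rpow_mul_besselE hy (ν - 1)).congr_deriv ?_
    rw [besselE_recurrence (ν - 1 - 1), show ν - 1 - 1 + 2 = ν by ring, sub_add_cancel,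
      Real.rpow_sub_one hy.ne', Real.rpow_sub_one hy.ne']
    field_simp
    ring
  have hg : ∀ y, 0 < y → HasDerivAt (macdonald ν) (-macdonald (ν - 1) y) y :=
    fun y hy => hasDerivAt_macdonald hy ν
  have hg' : ∀ y, 0 < y → HasDerivAt (fun y => -macdonald (ν - 1) y)
      (((ν - 1) * (-macdonald (ν - 1) y) + macdonald ν y) / y) y := fun y hy => by
    refine (hasDerivAt_macdonald hy (ν - 1)).neg.congr_deriv ?_
    rw [macdonald_recurrence hy ν, show ν - 1 - 1 = ν - 2 by ring]
    field_simp
    ring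
  have hpow : ∀ y : ℝ, 0 < y → y ^ (1 - ν) * y ^ (ν - 1) = 1 := fun y hy => by
    rw [← Real.rpow_add hy]; simp
  have hpow' : ∀ y : ℝ, 0 < y → y ^ (1 - ν) * y ^ ν = y := fun y hy => by
    rw [← Real.rpow_add hy]; simp
  have W1 : y ^ (1 - ν) * (besselE (-ν) y * (y ^ (ν - 1) * besselE (ν - 1) y) -
      besselE (-ν + 1) y * (y ^ ν * besselE ν y)) = Real.sin (Real.pi * ν) / Real.pi := by
    refine wronskian_eq hu hu' hv hv' ?_ hy
    have h := ((tendsto_besselE_zero (-ν)).mul (tendsto_besselE_zero (ν - 1))).sub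
      (tendsto_id_nhdsGT_zero.mul
        ((tendsto_besselE_zero (-ν + 1)).mul (tendsto_besselE_zero ν)))
    rw [zero_mul, sub_zero, sub_add_cancel, neg_add_eq_sub, inv_Gamma_mul_inv_Gamma_one_sub] at h
    refine h.congr' ?_
    filter_upwards [self_mem_nhdsWithin] with y hy
    simp only [neg_add_eq_sub]
    linear_combination (-besselE (-ν) y * besselE (ν - 1) y) * hpow y hy +
      (besselE (1 - ν) y * besselE ν y) * hpow' y hy
  have W2 : y ^ (1 - ν) * (macdonald ν y * (y ^ (ν - 1) * besselE (ν - 1) y) -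
      -macdonald (ν - 1) y * (y ^ ν * besselE ν y)) = 1 := by
    refine wronskian_eq hg hg' hv hv' ?_ hy
    have h := ((tendsto_macdonald_zero h0).mul (tendsto_besselE_zero (ν - 1))).add
      ((tendsto_mul_macdonald_sub_one_zero h0).mul (tendsto_besselE_zero ν))
    rw [zero_mul, add_zero, sub_add_cancel, mul_inv_cancel₀ (Real.Gamma_pos_of_pos h0).ne'] at h
    refine h.congr' ?_
    filter_upwards [self_mem_nhdsWithin] with y hy
    linear_combination (-macdonald ν y * besselE (ν - 1) y) * hpow y hy -
      (macdonald (ν - 1) y * besselE ν y) * hpow' y hy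
  have W3 : y ^ (1 - ν) * (macdonald ν y * besselE (-ν + 1) y -
      -macdonald (ν - 1) y * besselE (-ν) y) = 1 := by
    refine wronskian_eq hg hg' hu hu' ?_ hy
    have hp : Tendsto (fun y : ℝ => y ^ (1 - ν)) (𝓝[>] 0) (𝓝 0) := by
      have := (Real.continuousAt_rpow_const 0 (1 - ν) (Or.inr (by linarith))).tendsto
      rw [Real.zero_rpow (by linarith)] at this
      exact this.mono_left nhdsWithin_le_nhds
    have h := (hp.mul ((tendsto_macdonald_zero h0).mul (tendsto_besselE_zero (-ν + 1)))).add
      ((tendsto_macdonald_zero (ν := 1 - ν) (by linarith)).mul (tendsto_besselE_zero (-ν)))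
    rw [zero_mul, zero_add, neg_add_eq_sub,
      mul_inv_cancel₀ (Real.Gamma_pos_of_pos (by linarith)).ne'] at h
    refine h.congr' ?_
    filter_upwards [self_mem_nhdsWithin] with y (hy : 0 < y)
    -- Reflection changes the negative order ν - 1 into 1 - ν > 0, where the limit at 0 is a Gamma
    -- value.
    have h2 : y ^ (1 - ν) * macdonald (ν - 1) y = macdonald (1 - ν) y := by
      rw [macdonald_neg hy (1 - ν), neg_sub]
    rw [← h2]
    simp only [neg_add_eq_sub]
    ring
  have hp := Real.rpow_pos_of_pos hy (1 - ν)
  rw [← W1]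
  linear_combination (besselE (-ν) y) * W2 - (y ^ ν * besselE ν y) * W3

lemma macdonald_mul_sin {ν y : ℝ} (h : ν ∈ Ioo (0 : ℝ) 1 ∪ Ioo 1 2) (hy : 0 < y) :
    macdonald ν y * (Real.sin (Real.pi * ν) / Real.pi) =
      besselE (-ν) y - y ^ ν * besselE ν y := by
  rcases h with ⟨h0, h1⟩ | ⟨h1, h2⟩
  · exact macdonald_mul_sin_of_lt_one h0 h1 hy
  · have key : ∀ y, 0 < y → macdonald (ν - 1) y * (Real.sin (Real.pi * (ν - 1)) / Real.pi) =
        besselE (-(ν - 1)) y - y ^ (ν - 1) * besselE (ν - 1) y := fun y hy =>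
      macdonald_mul_sin_of_lt_one (by linarith) (by linarith) hy
    have d1 := (hasDerivAt_macdonald hy (ν - 1)).mul_const (Real.sin (Real.pi * (ν - 1)) / Real.pi)
    have d2 := (hasDerivAt_besselE (-(ν - 1)) y).sub (hasDerivAt_rpow_mul_besselE hy (ν - 1))
    have d3 := d1.unique (d2.congr_of_eventuallyEq (by
      filter_upwards [lt_mem_nhds hy] with z hz using key z hz))
    have hs : Real.sin (Real.pi * (ν - 1)) = -Real.sin (Real.pi * ν) := by
      rw [mul_sub, mul_one, Real.sin_sub_pi]
    have k := key y hy
    rw [hs] at d3 k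
    have r1 := besselE_recurrence (-ν) y
    have r2 := besselE_recurrence (ν - 1 - 1) y
    rw [show ν - 1 - 1 + 2 = ν by ring, sub_add_cancel] at r2
    rw [show -(ν - 1) + 1 = -ν + 2 by ring] at d3
    rw [show -(ν - 1) = -ν + 1 by ring] at k
    rw [macdonald_recurrence hy ν, r1, show ν - 2 = ν - 1 - 1 by ring]
    have p1 : y ^ ν = y * (y * y ^ (ν - 1 - 1)) := by
      rw [Real.rpow_sub_one hy.ne' (ν - 1), Real.rpow_sub_one hy.ne' ν]; field_simp
    have p2 : y ^ (ν - 1) = y * y ^ (ν - 1 - 1) := by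
      rw [Real.rpow_sub_one hy.ne' (ν - 1)]; field_simp
    rw [p2] at k
    rw [p1]
    linear_combination y * d3 - (ν - 1) * k - y * y ^ (ν - 1 - 1) * r2

/-! ### The bracket and the phase in terms of the integral -/

lemma sin_pi_mul_ne_zero {ν : ℝ} (h : ν ∈ Ioo (0 : ℝ) 1 ∪ Ioo 1 2) :
    Real.sin (Real.pi * ν) ≠ 0 := by
  have hpi := Real.pi_pos
  rcases h with ⟨h0, h1⟩ | ⟨h1, h2⟩
  · exact (Real.sin_pos_of_pos_of_lt_pi (by positivity) (by nlinarith)).ne'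
  · have : 0 < Real.sin (Real.pi * ν - Real.pi) :=
      Real.sin_pos_of_pos_of_lt_pi (by nlinarith) (by nlinarith)
    rw [Real.sin_sub_pi] at this
    linarith

lemma besselI_eq {x : ℝ} (hx : 0 < x) (μ : ℝ) :
    besselI μ x = (x / 2) ^ μ * besselE μ ((x / 2) ^ 2) := by
  rw [besselI, besselE, ← tsum_mul_left]
  refine tsum_congr fun k => ?_
  rw [Real.rpow_add (by positivity), ← pow_mul, ← Real.rpow_natCast _ (2 * k)]
  push_cast
  ring

lemma two_mul_besselK_eq {ν x : ℝ} (h : ν ∈ Ioo (0 : ℝ) 1 ∪ Ioo 1 2) (hx : 0 < x) :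
    2 * (x / 2) ^ ν * besselK ν x = macdonald ν ((x / 2) ^ 2) := by
  have hz : 0 < x / 2 := by positivity
  have hs := sin_pi_mul_ne_zero h
  have key := macdonald_mul_sin h (y := (x / 2) ^ 2) (by positivity)
  rw [← Real.rpow_natCast, ← Real.rpow_mul hz.le, Nat.cast_ofNat, two_mul, Real.rpow_add hz,
    ← Nat.cast_ofNat (R := ℝ), Real.rpow_natCast] at key
  rw [besselK, besselI_eq hx, besselI_eq hx, Real.rpow_neg hz.le]
  have hp := Real.rpow_pos_of_pos hz ν
  have hpi := Real.pi_pos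
  generalize macdonald ν ((x / 2) ^ 2) = M at *
  generalize besselE ν ((x / 2) ^ 2) = E1 at *
  generalize besselE (-ν) ((x / 2) ^ 2) = E2 at *
  generalize (x / 2) ^ ν = P at *
  generalize Real.sin (Real.pi * ν) = S at *
  field_simp at key ⊢
  linear_combination (-1 : ℝ) * key

lemma phase_eq {ν x : ℝ} (h : ν ∈ Ioo (0 : ℝ) 1 ∪ Ioo 1 2) (hx : 0 < x) :
    phase ν x = x + Real.log (macdonald ν ((x / 2) ^ 2) / Real.Gamma ν) := by
  rw [phase, two_mul_besselK_eq h hx]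

lemma pos_of_mem {ν : ℝ} (h : ν ∈ Ioo (0 : ℝ) 1 ∪ Ioo 1 2) : 0 < ν := by
  rcases h with ⟨h0, h1⟩ | ⟨h1, h2⟩ <;> linarith

lemma bracket_eq {ν x : ℝ} (h : ν ∈ Ioo (0 : ℝ) 1 ∪ Ioo 1 2) (hx : 0 < x) :
    bracket ν x = Real.exp x * macdonald ν ((x / 2) ^ 2) / Real.Gamma ν := by
  rw [← two_mul_besselK_eq h hx, bracket]
  ring

lemma bracket_eq_exp_phase {ν x : ℝ} (h : ν ∈ Ioo (0 : ℝ) 1 ∪ Ioo 1 2) (hx : 0 < x) :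
    bracket ν x = Real.exp (phase ν x) := by
  have h1 := macdonald_pos (y := (x / 2) ^ 2) (by positivity) ν
  have h2 := Real.Gamma_pos_of_pos (pos_of_mem h)
  rw [bracket_eq h hx, phase_eq h hx, Real.exp_add, Real.exp_log (by positivity), mul_div_assoc]

/-! ### Monotonicity and growth of the phase -/

/-- Averaging each integral with its image under t ↦ z²/t, twice the difference becomes ∫
e^(-t-z²/t) t^(-ν-1) (t^(2ν-1) - z^(2ν-1))(t - z) dt. For 2ν - 1 > 0 the last two factors have the
same sign. At z = x/2 this is exactly ψ' > 0. -/
lemma mul_macdonald_sub_one_lt {ν z : ℝ} (hν : 1 / 2 < ν) (hz : 0 < z) :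
    z * macdonald (ν - 1) (z ^ 2) < macdonald ν (z ^ 2) := by
  have hy : 0 < z ^ 2 := by positivity
  set w : ℝ → ℝ := fun t => Real.exp (-t - z ^ 2 / t) with hw
  have i (a : ℝ) : IntegrableOn (fun t => w t * t ^ a) (Ioi 0) := integrableOn_macdonald hy a
  have hsum : (∫ t in Ioi (0 : ℝ), ((w t * t ^ (ν - 1) + z ^ (2 * ν) * (w t * t ^ (-ν - 1))) -
      (z * (w t * t ^ (ν - 1 - 1)) + z ^ (2 * ν - 1) * (w t * t ^ (-(ν - 1) - 1))))) =
      2 * (macdonald ν (z ^ 2) - z * macdonald (ν - 1) (z ^ 2)) := by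
    have e1 := integral_sub ((i (ν - 1)).add ((i (-ν - 1)).const_mul (z ^ (2 * ν))))
      (((i (ν - 1 - 1)).const_mul z).add ((i (-(ν - 1) - 1)).const_mul (z ^ (2 * ν - 1))))
    have e2 := integral_add (i (ν - 1)) ((i (-ν - 1)).const_mul (z ^ (2 * ν)))
    have e3 := integral_add ((i (ν - 1 - 1)).const_mul z)
      ((i (-(ν - 1) - 1)).const_mul (z ^ (2 * ν - 1)))
    simp only [Pi.add_apply, integral_const_mul] at e1 e2 e3
    rw [e1, e2, e3]
    have s1 : macdonald ν (z ^ 2) = z ^ (2 * ν) * macdonald (-ν) (z ^ 2) := by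
      rw [macdonald_neg hy ν, ← Real.rpow_natCast, ← Real.rpow_mul hz.le, Nat.cast_ofNat]
    have s2 : z * macdonald (ν - 1) (z ^ 2) =
        z ^ (2 * ν - 1) * macdonald (-(ν - 1)) (z ^ 2) := by
      rw [macdonald_neg hy (ν - 1), ← Real.rpow_natCast, ← Real.rpow_mul hz.le, Nat.cast_ofNat,
        show 2 * ν - 1 = 2 * (ν - 1) + 1 by ring, Real.rpow_add_one hz.ne']
      ring
    change macdonald ν (z ^ 2) + z ^ (2 * ν) * macdonald (-ν) (z ^ 2) -
      (z * macdonald (ν - 1) (z ^ 2) + z ^ (2 * ν - 1) * macdonald (-(ν - 1)) (z ^ 2)) = _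
    rw [← s1, ← s2]
    ring
  have hform : EqOn (fun t => (w t * t ^ (ν - 1) + z ^ (2 * ν) * (w t * t ^ (-ν - 1))) -
      (z * (w t * t ^ (ν - 1 - 1)) + z ^ (2 * ν - 1) * (w t * t ^ (-(ν - 1) - 1))))
      (fun t => w t * t ^ (-ν - 1) * ((t ^ (2 * ν - 1) - z ^ (2 * ν - 1)) * (t - z))) (Ioi 0) := by
    intro t (ht : 0 < t)
    have a1 : t ^ (ν - 1) = t ^ (-ν - 1) * t ^ (2 * ν - 1) * t := by
      rw [← Real.rpow_add ht, ← Real.rpow_add_one ht.ne']; ring_nf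
    have a2 : t ^ (ν - 1 - 1) = t ^ (-ν - 1) * t ^ (2 * ν - 1) := by
      rw [← Real.rpow_add ht]; ring_nf
    have a3 : t ^ (-(ν - 1) - 1) = t ^ (-ν - 1) * t := by
      rw [← Real.rpow_add_one ht.ne']; ring_nf
    have a4 : z ^ (2 * ν) = z ^ (2 * ν - 1) * z := by
      rw [← Real.rpow_add_one hz.ne']; ring_nf
    simp only []
    rw [a1, a2, a3, a4]
    ring
  have hint : IntegrableOn (fun t => w t * t ^ (-ν - 1) *
      ((t ^ (2 * ν - 1) - z ^ (2 * ν - 1)) * (t - z))) (Ioi 0) :=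
    IntegrableOn.congr_fun ((((i (ν - 1)).add ((i (-ν - 1)).const_mul (z ^ (2 * ν)))).sub
      (((i (ν - 1 - 1)).const_mul z).add ((i (-(ν - 1) - 1)).const_mul (z ^ (2 * ν - 1)))))) hform
      measurableSet_Ioi
  rw [setIntegral_congr_fun measurableSet_Ioi hform] at hsum
  have hpos : 0 < ∫ t in Ioi (0 : ℝ), w t * t ^ (-ν - 1) *
      ((t ^ (2 * ν - 1) - z ^ (2 * ν - 1)) * (t - z)) := by
    refine (integral_pos_iff_support_of_nonneg_ae ?_ hint).2 ?_
    · filter_upwards [ae_restrict_mem measurableSet_Ioi] with t (ht : 0 < t)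
      refine mul_nonneg (by positivity) ?_
      rcases le_total t z with h | h
      · exact mul_nonneg_of_nonpos_of_nonpos
          (sub_nonpos.2 (Real.rpow_le_rpow ht.le h (by linarith))) (sub_nonpos.2 h)
      · exact mul_nonneg (sub_nonneg.2 (Real.rpow_le_rpow hz.le h (by linarith))) (sub_nonneg.2 h)
    · have hsub : Ioi z ⊆ Function.support fun t => w t * t ^ (-ν - 1) *
          ((t ^ (2 * ν - 1) - z ^ (2 * ν - 1)) * (t - z)) := by
        intro t (ht : z < t)
        have ht0 : 0 < t := hz.trans ht
        refine (mul_pos (by positivity : 0 < w t * t ^ (-ν - 1)) (mul_pos ?_ (sub_pos.2 ht))).ne'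
        exact sub_pos.2 (Real.rpow_lt_rpow hz.le ht (by linarith))
      have h2 : (volume.restrict (Ioi (0 : ℝ))) (Ioi z) = ⊤ := by
        rw [Measure.restrict_apply measurableSet_Ioi, inter_eq_left.2 (Ioi_subset_Ioi hz.le)]
        simp
      exact lt_of_lt_of_le (by simp [h2]) (measure_mono hsub)
  linarith

/-- The exponent is -2z - (t-z)²/t, with saddle point t = z. Only the window (z, z+√z] is kept:
there (t-z)² ≤ t, costing e^(-1), and t ≤ 2z, costing the factor 1/2. The window length √z supplies
the extra half power. -/
lemma le_exp_mul_macdonald {ν z : ℝ} (hν : 0 < ν) (hz : 1 ≤ z) :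
    Real.exp (-1) / 2 * z ^ (ν - 1 / 2) ≤ Real.exp (2 * z) * macdonald ν (z ^ 2) := by
  have hz0 : 0 < z := by linarith
  have hsq : 0 < √z := Real.sqrt_pos.2 hz0
  have hsq2 : √z * √z = z := Real.mul_self_sqrt hz0.le
  have hsqle : √z ≤ z := by nlinarith [Real.one_le_sqrt.2 hz]
  have hi := integrableOn_macdonald (y := z ^ 2) (by positivity) (ν - 1)
  have h1 : ∫ t in Ioc z (z + √z), Real.exp (-2 * z) * (Real.exp (-1) / 2 * z ^ (ν - 1)) ≤
      ∫ t in Ioc z (z + √z), Real.exp (-t - z ^ 2 / t) * t ^ (ν - 1) := by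
    refine setIntegral_mono_on (integrableOn_const (by simp) enorm_ne_top)
      (hi.mono_set fun t ht => hz0.trans ht.1) measurableSet_Ioc fun t ht => ?_
    have ht0 : 0 < t := hz0.trans ht.1
    have e1 : Real.exp (-2 * z) * Real.exp (-1) ≤ Real.exp (-t - z ^ 2 / t) := by
      rw [← Real.exp_add, Real.exp_le_exp]
      have h : (t - z) ^ 2 ≤ t := by nlinarith [ht.1, ht.2]
      have h' : (t - z) ^ 2 / t ≤ 1 := (div_le_one ht0).2 h
      have h'' : (t - z) ^ 2 / t = t + z ^ 2 / t - 2 * z := by field_simp; ring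
      linarith
    have e2 : z ^ (ν - 1) / 2 ≤ t ^ (ν - 1) := by
      rw [Real.rpow_sub_one hz0.ne', Real.rpow_sub_one ht0.ne', div_div]
      have := Real.rpow_le_rpow hz0.le ht.1.le hν.le
      have h2 : t ≤ z * 2 := by linarith [ht.2]
      gcongr
    calc _ = (Real.exp (-2 * z) * Real.exp (-1)) * (z ^ (ν - 1) / 2) := by ring
      _ ≤ _ := by gcongr
  have h2 : ∫ t in Ioc z (z + √z), Real.exp (-t - z ^ 2 / t) * t ^ (ν - 1) ≤
      macdonald ν (z ^ 2) := by
    refine setIntegral_mono_set hi ?_ (Eventually.of_forall fun t ht => hz0.trans ht.1)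
    filter_upwards [ae_restrict_mem measurableSet_Ioi] with t (ht : 0 < t)
    simp only [Pi.zero_apply]
    positivity
  rw [setIntegral_const, Real.volume_real_Ioc_of_le (by linarith), add_sub_cancel_left,
    smul_eq_mul] at h1
  have h3 : Real.exp (2 * z) * (√z * (Real.exp (-2 * z) * (Real.exp (-1) / 2 * z ^ (ν - 1)))) =
      Real.exp (-1) / 2 * z ^ (ν - 1 / 2) := by
    rw [show ν - 1 / 2 = (ν - 1) + 1 / 2 by ring, Real.rpow_add hz0, ← Real.sqrt_eq_rpow,
      show -2 * z = -(2 * z) by ring, Real.exp_neg (2 * z)]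
    field_simp
  rw [← h3]
  gcongr
  exact h1.trans h2

lemma hasDerivAt_phase {ν x : ℝ} (h : ν ∈ Ioo (0 : ℝ) 1 ∪ Ioo 1 2) (hx : 0 < x) :
    HasDerivAt (phase ν)
      (1 - x / 2 * macdonald (ν - 1) ((x / 2) ^ 2) / macdonald ν ((x / 2) ^ 2)) x := by
  have hy : 0 < (x / 2) ^ 2 := by positivity
  have h1 := macdonald_pos hy ν
  have h2 := Real.Gamma_pos_of_pos (pos_of_mem h)
  have d0 : HasDerivAt (fun x : ℝ => (x / 2) ^ 2) (x / 2) x := by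
    refine (((hasDerivAt_id x).div_const 2).pow 2).congr_deriv ?_
    simp only [id, Nat.cast_ofNat, Nat.add_one_sub_one, pow_one]
    ring
  have d := (hasDerivAt_id x).add
    ((((hasDerivAt_macdonald hy ν).comp x d0).div_const (Real.Gamma ν)).log (by
      simp only [Function.comp]; positivity))
  refine (d.congr_of_eventuallyEq ?_).congr_deriv ?_
  · filter_upwards [lt_mem_nhds hx] with t ht
    rw [phase_eq h ht]
    rfl
  · simp only [Function.comp]
    field_simp
    ring

lemma deriv_phase_pos {ν x : ℝ} (hν : 1 / 2 < ν) (hx : 0 < x) :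
    0 < 1 - x / 2 * macdonald (ν - 1) ((x / 2) ^ 2) / macdonald ν ((x / 2) ^ 2) := by
  have h1 := macdonald_pos (y := (x / 2) ^ 2) (by positivity) ν
  rw [sub_pos, div_lt_one h1]
  exact mul_macdonald_sub_one_lt hν (by positivity)

lemma strictMonoOn_phase {ν : ℝ} (h : ν ∈ Ioo (0 : ℝ) 1 ∪ Ioo 1 2) (hν : 1 / 2 < ν) :
    StrictMonoOn (phase ν) (Ioi 0) := by
  refine strictMonoOn_of_deriv_pos (convex_Ioi 0)
    (fun x hx => (hasDerivAt_phase h hx).continuousAt.continuousWithinAt) fun x hx => ?_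
  rw [interior_Ioi] at hx
  rw [(hasDerivAt_phase h hx).deriv]
  exact deriv_phase_pos hν hx

lemma tendsto_phase_zero {ν : ℝ} (h : ν ∈ Ioo (0 : ℝ) 1 ∪ Ioo 1 2) :
    Tendsto (phase ν) (𝓝[>] 0) (𝓝 0) := by
  have hG := Real.Gamma_pos_of_pos (pos_of_mem h)
  have hsq : Tendsto (fun x : ℝ => (x / 2) ^ 2) (𝓝[>] 0) (𝓝[>] 0) := by
    refine tendsto_nhdsWithin_iff.2 ⟨?_, ?_⟩
    · have : Continuous fun x : ℝ => (x / 2) ^ 2 := by fun_prop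
      simpa using (this.tendsto 0).mono_left (nhdsWithin_le_nhds (s := Ioi 0))
    · filter_upwards [self_mem_nhdsWithin] with x (hx : 0 < x)
      exact mem_Ioi.2 (by positivity)
  have h1 := (((tendsto_macdonald_zero (pos_of_mem h)).comp hsq).div_const (Real.Gamma ν)).log
    (by positivity)
  have h2 := tendsto_id_nhdsGT_zero.add h1
  rw [div_self hG.ne', Real.log_one, add_zero] at h2
  refine h2.congr' ?_
  filter_upwards [self_mem_nhdsWithin] with x hx
  rw [phase_eq h hx]
  rfl

/-- The algebraic lower bound for `e^ψ` at infinity. -/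
lemma exists_rpow_le_bracket {ν : ℝ} (h : ν ∈ Ioo (0 : ℝ) 1 ∪ Ioo 1 2) :
    ∃ c > 0, ∀ x, 2 ≤ x → c * x ^ (ν - 1 / 2) ≤ bracket ν x := by
  have hG := Real.Gamma_pos_of_pos (pos_of_mem h)
  refine ⟨Real.exp (-1) / 2 / 2 ^ (ν - 1 / 2) / Real.Gamma ν, by positivity, fun x hx => ?_⟩
  have key := le_exp_mul_macdonald (pos_of_mem h) (z := x / 2) (by linarith)
  rw [bracket_eq h (by linarith)]
  rw [Real.div_rpow (by linarith) (by norm_num), show 2 * (x / 2) = x by ring] at key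
  calc _ = Real.exp (-1) / 2 * (x ^ (ν - 1 / 2) / 2 ^ (ν - 1 / 2)) / Real.Gamma ν := by ring
    _ ≤ _ := by gcongr

lemma tendsto_phase_atTop {ν : ℝ} (h : ν ∈ Ioo (0 : ℝ) 1 ∪ Ioo 1 2) (hν : 1 / 2 < ν) :
    Tendsto (phase ν) atTop atTop := by
  obtain ⟨c, hc, hle⟩ := exists_rpow_le_bracket h
  have h1 : Tendsto (fun x : ℝ => Real.log (c * x ^ (ν - 1 / 2))) atTop atTop :=
    Real.tendsto_log_atTop.comp ((tendsto_rpow_atTop (by linarith)).const_mul_atTop hc)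
  refine tendsto_atTop_mono' _ ?_ h1
  filter_upwards [eventually_ge_atTop 2] with x hx
  have hx0 : 0 < x := by linarith
  rw [← Real.log_exp (phase ν x), ← bracket_eq_exp_phase h hx0]
  exact Real.log_le_log (by positivity) (hle x hx)

/-- By monotonicity ψ(x) > ψ(x/2), and ψ(x/2) is at least the limit 0 of ψ at 0. -/
lemma phase_pos {ν x : ℝ} (h : ν ∈ Ioo (0 : ℝ) 1 ∪ Ioo 1 2) (hν : 1 / 2 < ν) (hx : 0 < x) :
    0 < phase ν x := by
  have hmono := strictMonoOn_phase h hν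
  have h2 : 0 ≤ phase ν (x / 2) := by
    refine le_of_tendsto (tendsto_phase_zero h) ?_
    filter_upwards [Ioo_mem_nhdsGT (show 0 < x / 2 by linarith)] with t ht
    exact (hmono ht.1 (mem_Ioi.2 (by linarith)) ht.2).le
  exact h2.trans_lt (hmono (mem_Ioi.2 (by linarith)) hx (by linarith))

lemma continuousOn_phase {ν : ℝ} (h : ν ∈ Ioo (0 : ℝ) 1 ∪ Ioo 1 2) :
    ContinuousOn (phase ν) (Ioi 0) :=
  fun _ hx => (hasDerivAt_phase h hx).continuousAt.continuousWithinAt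

lemma bijOn_phase {ν : ℝ} (h : ν ∈ Ioo (0 : ℝ) 1 ∪ Ioo 1 2) (hν : 1 / 2 < ν) :
    BijOn (phase ν) (Ioi 0) (Ioi 0) := by
  refine ⟨fun x hx => phase_pos h hν hx, (strictMonoOn_phase h hν).injOn, fun τ (hτ : 0 < τ) => ?_⟩
  obtain ⟨a, ha0, ha⟩ : ∃ a, 0 < a ∧ phase ν a < τ := by
    have := ((tendsto_phase_zero h).eventually_lt_const hτ).and self_mem_nhdsWithin
    obtain ⟨a, ha⟩ := this.exists
    exact ⟨a, ha.2, ha.1⟩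
  obtain ⟨b, hb, hab⟩ := (((tendsto_phase_atTop h hν).eventually_gt_atTop τ).and
    (eventually_ge_atTop a)).exists
  obtain ⟨x, hx, hxτ⟩ := intermediate_value_Icc hab
    ((continuousOn_phase h).mono fun t ht => ha0.trans_le ht.1) ⟨ha.le, hb.le⟩
  exact ⟨x, ha0.trans_le hx.1, hxτ⟩

lemma bracket_rpow_neg {ν x : ℝ} (h : ν ∈ Ioo (0 : ℝ) 1 ∪ Ioo 1 2) (hx : 0 < x) (n : ℝ) :
    bracket ν x ^ (-n) = Real.exp (-n * phase ν x) := by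
  rw [bracket_eq_exp_phase h hx, ← Real.exp_mul, mul_comm]

lemma continuousOn_bracket_rpow {ν : ℝ} (h : ν ∈ Ioo (0 : ℝ) 1 ∪ Ioo 1 2) (n : ℝ) :
    ContinuousOn (fun x => bracket ν x ^ (-n)) (Ioi 0) :=
  ContinuousOn.congr (Real.continuous_exp.comp_continuousOn
    ((continuousOn_phase h).const_smul (-n))) fun _ hx => bracket_rpow_neg h hx n

/-- On (0, 2] positivity of ψ bounds the integrand by 1; beyond 2 the algebraic lower bound leaves
the integrable power x^(-n(ν-1/2)). -/
lemma integrableOn_bracket_rpow {ν n : ℝ} (h : ν ∈ Ioo (0 : ℝ) 1 ∪ Ioo 1 2) (hν : 1 / 2 < ν)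
    (hn : 1 < n * (ν - 1 / 2)) : IntegrableOn (fun x => bracket ν x ^ (-n)) (Ioi 0) := by
  obtain ⟨c, hc, hle⟩ := exists_rpow_le_bracket h
  have hn0 : 0 < n := by
    by_contra hneg
    nlinarith
  have hm : ∀ s ⊆ Ioi (0 : ℝ), MeasurableSet s →
      AEStronglyMeasurable (fun x => bracket ν x ^ (-n)) (volume.restrict s) := fun s hs hs' =>
    ((continuousOn_bracket_rpow h n).mono hs).aestronglyMeasurable hs'
  rw [← Ioc_union_Ioi_eq_Ioi (show (0 : ℝ) ≤ 2 by norm_num), integrableOn_union]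
  constructor
  · refine Integrable.mono' (integrableOn_const (C := (1 : ℝ)) (by simp) (by simp))
      (hm _ (fun x hx => hx.1) measurableSet_Ioc) ?_
    filter_upwards [ae_restrict_mem measurableSet_Ioc] with x hx
    rw [bracket_rpow_neg h hx.1, Real.norm_of_nonneg (Real.exp_pos _).le, Real.exp_le_one_iff]
    nlinarith [phase_pos h hν hx.1]
  · refine Integrable.mono' ((integrableOn_Ioi_rpow_of_lt (a := -(n * (ν - 1 / 2))) (by linarith)
      (show (0 : ℝ) < 2 by norm_num)).const_mul (c ^ (-n)))
      (hm _ (Ioi_subset_Ioi (by norm_num)) measurableSet_Ioi) ?_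
    filter_upwards [ae_restrict_mem measurableSet_Ioi] with x (hx : 2 < x)
    have hx0 : 0 < x := by linarith
    have hb := hle x hx.le
    have hp : 0 < c * x ^ (ν - 1 / 2) := by positivity
    rw [Real.norm_of_nonneg (Real.rpow_nonneg (hp.le.trans hb) _)]
    refine (Real.rpow_le_rpow_of_nonpos hp hb (by linarith)).trans_eq ?_
    rw [Real.mul_rpow hc.le (by positivity), ← Real.rpow_mul hx0.le]
    ring_nf

/-! ### Analytic germs and their power series -/

open PowerSeries in
/-- The function `f` is the sum of the power series `P` in a neighbourhood of `0`. -/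
def Represents (f : ℝ → ℝ) (P : ℝ⟦X⟧) : Prop :=
  ∀ᶠ t in 𝓝 (0 : ℝ), HasSum (fun m : ℕ => coeff m P * t ^ m) (f t)

namespace Represents

open PowerSeries

variable {f g : ℝ → ℝ} {P Q : ℝ⟦X⟧}

lemma hasFPowerSeriesAt (h : Represents f P) :
    HasFPowerSeriesAt f (FormalMultilinearSeries.ofScalars ℝ fun m => coeff m P) 0 := by
  refine hasFPowerSeriesAt_iff.2 (h.mono fun t ht => ?_)
  simpa [mul_comm] using ht

lemma analyticAt (h : Represents f P) : AnalyticAt ℝ f 0 := ⟨_, h.hasFPowerSeriesAt⟩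

/-- This is the bridge to formal identities: two series that sum to the same germ coincide. -/
lemma unique (h : Represents f P) (h' : Represents f Q) : P = Q := by
  have := h.hasFPowerSeriesAt.eq_formalMultilinearSeries h'.hasFPowerSeriesAt
  have h2 := FormalMultilinearSeries.ofScalars_series_injective ℝ ℝ this
  ext m
  exact congrFun h2 m

lemma congr (h : Represents f P) (hfg : f =ᶠ[𝓝 0] g) : Represents g P := by
  filter_upwards [h, hfg] with t ht hfg
  rwa [← hfg]

lemma apply_zero (h : Represents f P) : f 0 = constantCoeff P := by
  have h0 := h.self_of_nhds
  have h1 := hasSum_single (f := fun m : ℕ => coeff m P * (0 : ℝ) ^ m) 0 fun m hm => by simp [hm]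
  rw [h0.unique h1]
  simp

lemma add (hf : Represents f P) (hg : Represents g Q) :
    Represents (fun t => f t + g t) (P + Q) := by
  filter_upwards [hf, hg] with t hf hg
  simpa [add_mul] using hf.add hg

lemma neg (hf : Represents f P) : Represents (fun t => -f t) (-P) := by
  filter_upwards [hf] with t hf
  simpa using hf.neg

lemma const (c : ℝ) : Represents (fun _ => c) (C c) := by
  refine Eventually.of_forall fun t => ?_
  have h1 := hasSum_single (f := fun m : ℕ => coeff m (C c) * t ^ m) 0 fun m hm => by
    simp [coeff_C, hm]
  simpa using h1

lemma id : Represents (fun t => t) X := by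
  refine Eventually.of_forall fun t => ?_
  have h1 := hasSum_single (f := fun m : ℕ => coeff m (X : ℝ⟦X⟧) * t ^ m) 1 fun m hm => by
    simp [coeff_X, hm]
  simpa using h1

lemma mul (hf : Represents f P) (hg : Represents g Q) :
    Represents (fun t => f t * g t) (P * Q) := by
  filter_upwards [hf, hg] with t hf hg
  have h1 : Summable fun m : ℕ => ‖coeff m P * t ^ m‖ := summable_abs_iff.2 hf.summable
  have h2 : Summable fun m : ℕ => ‖coeff m Q * t ^ m‖ := summable_abs_iff.2 hg.summable
  have h5 := (summable_norm_sum_mul_antidiagonal_of_summable_norm h1 h2).of_norm.hasSum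
  rw [← tsum_mul_tsum_eq_tsum_sum_antidiagonal_of_summable_norm h1 h2, hf.tsum_eq,
    hg.tsum_eq] at h5
  have h6 : ∀ m : ℕ, coeff m (P * Q) * t ^ m =
      ∑ ij ∈ Finset.HasAntidiagonal.antidiagonal m, coeff ij.1 P * t ^ ij.1 * (coeff ij.2 Q * t ^ ij.2) := by
    intro m
    rw [coeff_mul, Finset.sum_mul]
    refine Finset.sum_congr rfl fun ij hij => ?_
    rw [← Finset.HasAntidiagonal.mem_antidiagonal.1 hij, pow_add]
    ring
  simp only [h6]
  exact h5

lemma pow (hf : Represents f P) (n : ℕ) : Represents (fun t => f t ^ n) (P ^ n) := by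
  induction n with
  | zero => simpa using const 1
  | succ n ih => simpa only [pow_succ] using ih.mul hf

lemma coeff_eq (hf : Represents f P) (m : ℕ) : coeff m P = iteratedDeriv m f 0 / m.factorial := by
  have h2 := FormalMultilinearSeries.ofScalars_series_injective ℝ ℝ
    (hf.hasFPowerSeriesAt.eq_formalMultilinearSeries hf.analyticAt.hasFPowerSeriesAt)
  exact congrFun h2 m

lemma exists_of_analyticAt (hf : AnalyticAt ℝ f 0) : ∃ P, Represents f P := by
  refine ⟨mk fun m => iteratedDeriv m f 0 / m.factorial, ?_⟩
  have h := hasFPowerSeriesAt_iff.1 hf.hasFPowerSeriesAt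
  filter_upwards [h] with t ht
  simpa [mul_comm] using ht

lemma deriv (hf : Represents f P) : Represents (deriv f) (derivative ℝ P) := by
  obtain ⟨Q, hQ⟩ := exists_of_analyticAt hf.analyticAt.deriv
  convert hQ
  ext m
  rw [hQ.coeff_eq, coeff_derivative, hf.coeff_eq, ← iteratedDeriv_succ', Nat.factorial_succ]
  push_cast
  field_simp

lemma coeff_one (hf : Represents f P) : coeff 1 P = _root_.deriv f 0 := by
  rw [hf.coeff_eq]
  simp

/-- The difference quotient at `0` is represented by the shifted series. -/
lemma exists_eq_add_mul (hf : Represents f P) :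
    ∃ r : ℝ → ℝ, Represents r (mk fun m => coeff (m + 1) P) ∧
      ∀ t, f t = constantCoeff P + t * r t := by
  refine ⟨dslope f 0, ?_, fun t => ?_⟩
  · have h := hasFPowerSeriesAt_iff.1 hf.hasFPowerSeriesAt.has_fpower_series_dslope_fslope
    filter_upwards [h] with t ht
    simpa [mul_comm] using ht
  · have := sub_smul_dslope f 0 t
    rw [sub_zero, smul_eq_mul, hf.apply_zero] at this
    linarith

/-- The composite is analytic, so it has some series R, to be identified with the formal
substitution. Writing f(u) = f(0) + u·r(u) on both sides, the factor Q has no constant term, so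
coefficient n of the composite depends only on lower coefficients of r ∘ g. Induction on n, with f
varying, concludes. -/
lemma comp (hf : Represents f P) (hg : Represents g Q) (hQ : constantCoeff Q = 0) :
    Represents (fun t => f (g t)) (P.subst Q) := by
  have hs : HasSubst Q := HasSubst.of_constantCoeff_zero' hQ
  have hg0 : g 0 = 0 := by rw [hg.apply_zero, hQ]
  have han : ∀ {f : ℝ → ℝ} {P : ℝ⟦X⟧}, Represents f P → ∃ R, Represents (fun t => f (g t)) R :=
    fun hf => exists_of_analyticAt (AnalyticAt.fun_comp (by rw [hg0]; exact hf.analyticAt) hg.analyticAt)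
  obtain ⟨R, hR⟩ := han hf
  suffices key : ∀ n : ℕ, ∀ (f : ℝ → ℝ) (P R : ℝ⟦X⟧), Represents f P →
      Represents (fun t => f (g t)) R → coeff n R = coeff n (P.subst Q) by
    have : R = P.subst Q := by
      ext n
      exact key n f P R hf hR
    rwa [← this]
  intro n
  induction n using Nat.strong_induction_on with
  | _ n ih =>
    intro f P R hf hR
    obtain ⟨r, hr, hfr⟩ := hf.exists_eq_add_mul
    obtain ⟨S, hS⟩ := han hr
    have h1 : R = C (constantCoeff P) + Q * S := by
      refine hR.unique (((const _).add (hg.mul hS)).congr (Eventually.of_forall fun t => ?_))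
      exact (hfr (g t)).symm
    have h2 : P.subst Q = C (constantCoeff P) + Q * (mk fun m => coeff (m + 1) P).subst Q := by
      conv_lhs => rw [eq_X_mul_shift_add_const P]
      rw [subst_add hs, subst_mul hs, subst_X hs, subst_C, add_comm]
      rfl
    rw [h1, h2, map_add, map_add, coeff_mul, coeff_mul]
    congr 1
    refine Finset.sum_congr rfl fun ij hij => ?_
    rcases Nat.eq_zero_or_pos ij.1 with h0 | h0
    · simp [h0, hQ]
    · rw [ih ij.2 (by have := Finset.HasAntidiagonal.mem_antidiagonal.1 hij; omega) r _ S hr hS]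

end Represents

/-! ### Formal power series: Lagrange inversion and recurrences -/

section

open PowerSeries

section Formal

/-- Substitution as a polynomial in Q plus a multiple of Q^n: when Q has no constant term, a given
coefficient only sees the finite sum. -/
lemma subst_eq_sum_add {Q : ℝ⟦X⟧} (hs : HasSubst Q) (P : ℝ⟦X⟧) (n : ℕ) :
    P.subst Q = ∑ i ∈ Finset.range n, C (coeff i P) * Q ^ i +
      Q ^ n * (mk fun m => coeff (m + n) P).subst Q := by
  induction n with
  | zero =>
    simp only [Finset.range_zero, Finset.sum_empty, pow_zero, one_mul, zero_add, add_zero]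
    congr 1
    ext m
    simp
  | succ n ih =>
    rw [ih, Finset.sum_range_succ, add_assoc]
    congr 1
    conv_lhs => rw [eq_X_mul_shift_add_const (mk fun m => coeff (m + n) P)]
    rw [subst_add hs, subst_mul hs, subst_X hs, subst_C, pow_succ]
    simp only [coeff_mk, ← coeff_zero_eq_constantCoeff_apply, zero_add]
    rw [show (fun p => coeff (p + 1 + n) P) = fun p => coeff (p + (n + 1)) P by
      ext p; congr 2; ring]
    change Q ^ n * (_ + C (coeff n P)) = _
    ring

lemma derivative_inv_pow {H : ℝ⟦X⟧} (hH : constantCoeff H = 1) (d : ℕ) :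
    derivative ℝ (H⁻¹ ^ d) = -(d : ℝ⟦X⟧) * (H⁻¹ ^ (d + 1) * derivative ℝ H) := by
  have h1 : H * H⁻¹ = 1 := PowerSeries.mul_inv_cancel _ (by rw [hH]; exact one_ne_zero)
  have h2 := congrArg (derivative ℝ) h1
  rw [Derivation.leibniz, Derivation.map_one_eq_zero, smul_eq_mul, smul_eq_mul] at h2
  have h3 : derivative ℝ H⁻¹ = -(H⁻¹ ^ 2 * derivative ℝ H) := by
    linear_combination H⁻¹ * h2 - derivative ℝ H⁻¹ * h1
  rw [Derivation.leibniz_pow, h3]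
  rcases d with _ | d
  · simp
  · simp only [Nat.add_sub_cancel, smul_eq_mul, nsmul_eq_mul]
    push_cast
    ring

/-- With W = XH this is the residue of W' / W^(d+1). For d > 0 that is the derivative of -W^(-d)/d,
so its residue is 0; for d = 0 it is the order of vanishing of W, namely 1. -/
lemma coeff_inv_pow_mul_derivative_X_mul {H : ℝ⟦X⟧} (hH : constantCoeff H = 1) (d : ℕ) :
    coeff d (H⁻¹ ^ (d + 1) * derivative ℝ (X * H)) = if d = 0 then 1 else 0 := by
  have h1 : H * H⁻¹ = 1 := PowerSeries.mul_inv_cancel _ (by rw [hH]; exact one_ne_zero)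
  have h2 : H⁻¹ ^ (d + 1) * derivative ℝ (X * H) =
      H⁻¹ ^ d + X * (H⁻¹ ^ (d + 1) * derivative ℝ H) := by
    rw [Derivation.leibniz, derivative_X, smul_eq_mul, smul_eq_mul]
    linear_combination H⁻¹ ^ d * h1
  rw [h2, map_add]
  rcases d with _ | d
  · simp
  · rw [coeff_succ_X_mul]
    have h3 := congrArg (coeff d) (derivative_inv_pow hH (d + 1))
    have h4 : -((d + 1 : ℕ) : ℝ⟦X⟧) = C (-((d : ℝ) + 1)) := by simp
    rw [coeff_derivative, h4, coeff_C_mul] at h3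
    have h5 : (d : ℝ) + 1 ≠ 0 := by positivity
    rw [if_neg (Nat.succ_ne_zero d)]
    refine mul_left_cancel₀ h5 ?_
    linear_combination h3

/-- Lagrange inversion for the powers of the compositional inverse `T` of `X * H`. -/
lemma lagrange_inversion {H T : ℝ⟦X⟧} (hH : constantCoeff H = 1) (hT : T.subst (X * H) = X)
    {q m : ℕ} (hq : 0 < q) :
    ((m + q : ℕ) : ℝ) * coeff (m + q) (T ^ q) = q * coeff m (H⁻¹ ^ (m + q)) := by
  obtain ⟨n, hn⟩ : ∃ n, m + q = n + 1 := ⟨m + q - 1, by omega⟩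
  obtain ⟨r, rfl⟩ : ∃ r, q = r + 1 := ⟨q - 1, by omega⟩
  have h1 : H * H⁻¹ = 1 := PowerSeries.mul_inv_cancel _ (by rw [hH]; exact one_ne_zero)
  have hs : HasSubst (X * H) := HasSubst.of_constantCoeff_zero' (by simp)
  have e1 : (T ^ (r + 1)).subst (X * H) = X ^ (r + 1) := by rw [subst_pow hs, hT]
  have e2 := congrArg (derivative ℝ) e1
  rw [derivative_subst hs, subst_eq_sum_add hs _ (n + 1), Derivation.leibniz_pow (a := (X : ℝ⟦X⟧))] at e2
  -- With G = T^q and W = XH, the chain rule reads G'(W) W' = q X^(q-1). Dividing by W^(n+1) and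
  -- taking residues isolates coefficient n of G', as only i = n survives below and the remainder is
  -- divisible by X^(n+1).
  have e3 := congrArg (fun A => coeff n (H⁻¹ ^ (n + 1) * A)) e2
  beta_reduce at e3
  rw [add_mul, mul_add, map_add, Finset.sum_mul, Finset.mul_sum, map_sum] at e3
  have t1 : coeff n (H⁻¹ ^ (n + 1) * ((X * H) ^ (n + 1) *
      (mk fun m => coeff (m + (n + 1)) (derivative ℝ (T ^ (r + 1)))).subst (X * H) *
        derivative ℝ (X * H))) = 0 := by
    rw [mul_pow, show ∀ a b c d e : ℝ⟦X⟧, a * (b * c * d * e) = b * (a * c * d * e) by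
      intros; ring, coeff_X_pow_mul', if_neg (by omega)]
  have t2 : ∀ i ∈ Finset.range (n + 1), coeff n (H⁻¹ ^ (n + 1) *
      (C (coeff i (derivative ℝ (T ^ (r + 1)))) * (X * H) ^ i * derivative ℝ (X * H))) =
      if i = n then coeff n (derivative ℝ (T ^ (r + 1))) else 0 := by
    intro i hi
    obtain ⟨d, hd⟩ : ∃ d, n = d + i := ⟨n - i, by have := Finset.mem_range.1 hi; omega⟩
    subst hd
    have : H⁻¹ ^ (d + i + 1) *
      (C (coeff i (derivative ℝ (T ^ (r + 1)))) * (X * H) ^ i * derivative ℝ (X * H)) =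
      C (coeff i (derivative ℝ (T ^ (r + 1)))) *
        (X ^ i * (H⁻¹ ^ (d + 1) * derivative ℝ (X * H))) := by
      have h2 : H ^ i * H⁻¹ ^ i = 1 := by rw [← mul_pow, h1, one_pow]
      rw [mul_pow, show d + i + 1 = (d + 1) + i by ring, pow_add H⁻¹]
      linear_combination (C (coeff i (derivative ℝ (T ^ (r + 1)))) *
        (X ^ i * (H⁻¹ ^ (d + 1) * derivative ℝ (X * H)))) * h2
    rw [this, coeff_C_mul, coeff_X_pow_mul, coeff_inv_pow_mul_derivative_X_mul hH]
    by_cases hd : d = 0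
    · subst hd; simp
    · rw [if_neg hd, if_neg (by omega), mul_zero]
  rw [t1, Finset.sum_congr rfl t2, Finset.sum_ite_eq' (Finset.range (n + 1)) n] at e3
  rw [if_pos (Finset.self_mem_range_succ n), add_zero, coeff_derivative, derivative_X] at e3
  have t3 : H⁻¹ ^ (n + 1) * ((r + 1) • (X : ℝ⟦X⟧) ^ (r + 1 - 1) • (1 : ℝ⟦X⟧)) =
      C ((r : ℝ) + 1) * (X ^ r * H⁻¹ ^ (n + 1)) := by
    simp only [nsmul_eq_mul, smul_eq_mul, mul_one, Nat.add_sub_cancel]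
    push_cast
    simp only [map_add, map_natCast, map_one]
    ring
  have hmn : n = m + r := by omega
  rw [t3, coeff_C_mul, hmn, coeff_X_pow_mul] at e3
  rw [hn, hmn]
  push_cast
  push_cast at e3
  linear_combination e3

/-- Euler's recurrence for the coefficients of `H⁻¹ ^ n` in terms of those of `H ^ q`. -/
lemma sum_coeff_pow_mul_coeff_inv_pow {H : ℝ⟦X⟧} (hH : constantCoeff H = 1) {q : ℕ} (hq : 0 < q)
    (n j : ℕ) :
    ∑ ij ∈ Finset.HasAntidiagonal.antidiagonal j, ((q : ℝ) * ij.2 + n * ij.1) *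
      (coeff ij.1 (H ^ q) * coeff ij.2 (H⁻¹ ^ n)) = 0 := by
  obtain ⟨r, rfl⟩ : ∃ r, q = r + 1 := ⟨q - 1, by omega⟩
  have h1 : H * H⁻¹ = 1 := PowerSeries.mul_inv_cancel _ (by rw [hH]; exact one_ne_zero)
  -- For A = H^q and V = H^(-n), comparing logarithmic derivatives gives q A V' + n A' V = 0.
  -- Multiplication by X then turns d/dX into the operator that scales coefficient j by j.
  have e1 : C ((r + 1 : ℕ) : ℝ) * (H ^ (r + 1) * derivative ℝ (H⁻¹ ^ n)) +
      C (n : ℝ) * (derivative ℝ (H ^ (r + 1)) * H⁻¹ ^ n) = 0 := by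
    rw [derivative_inv_pow hH, Derivation.leibniz_pow]
    simp only [nsmul_eq_mul, smul_eq_mul, Nat.add_sub_cancel, map_natCast]
    linear_combination (-((r + 1 : ℕ) : ℝ⟦X⟧) * n * H ^ r * H⁻¹ ^ n * derivative ℝ H) * h1
  have hx : ∀ (P : ℝ⟦X⟧) (a : ℕ), coeff a (X * derivative ℝ P) = a * coeff a P := by
    intro P a
    rcases a with _ | a
    · simp
    · rw [coeff_succ_X_mul, coeff_derivative]
      push_cast
      ring
  have e2 : C ((r + 1 : ℕ) : ℝ) * (H ^ (r + 1) * (X * derivative ℝ (H⁻¹ ^ n))) +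
      C (n : ℝ) * ((X * derivative ℝ (H ^ (r + 1))) * H⁻¹ ^ n) = 0 := by
    linear_combination X * e1
  have e3 := congrArg (coeff j) e2
  rw [map_add, coeff_C_mul, coeff_C_mul, coeff_mul, coeff_mul, Finset.mul_sum, Finset.mul_sum,
    ← Finset.sum_add_distrib, map_zero] at e3
  rw [← e3]
  refine Finset.sum_congr rfl fun ij _ => ?_
  rw [hx, hx]
  ring

/-- In the recurrence at j, the term with index (0, j) has the nonzero factor qj. Every other
nonzero term splits j into an exponent of H^q and a smaller exponent of the inverse power, both in S
by induction, so j ∈ S. -/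
lemma coeff_inv_pow_mem {H : ℝ⟦X⟧} (hH : constantCoeff H = 1) {q : ℕ} (hq : 0 < q)
    (S : AddSubmonoid ℕ) (hS : ∀ m, coeff m (H ^ q) ≠ 0 → m ∈ S) (n : ℕ) :
    ∀ j, coeff j (H⁻¹ ^ n) ≠ 0 → j ∈ S := by
  intro j
  induction j using Nat.strong_induction_on with
  | _ j ih =>
    intro hj
    by_contra hjS
    have hj0 : j ≠ 0 := fun h => hjS (h ▸ S.zero_mem)
    have key := sum_coeff_pow_mul_coeff_inv_pow hH hq n j
    rw [Finset.sum_eq_single (0, j)] at key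
    · have : (0 : ℝ) < q * j := by positivity
      simp [hH, hj, hj0, hq.ne'] at key
    · rintro ⟨a, b⟩ hab hne
      have hab' : a + b = j := by simpa using hab
      have ha : a ≠ 0 := fun h => hne (by subst h; simp at hab' ⊢; exact hab')
      by_contra h
      have h1 : coeff a (H ^ q) ≠ 0 := fun h0 => h (by simp [h0])
      have h2 : coeff b (H⁻¹ ^ n) ≠ 0 := fun h0 => h (by simp [h0])
      exact hjS (hab' ▸ S.add_mem (hS a h1) (ih b (by omega) h2))
    · intro h
      simp at h

lemma derivative_logOf_mul {P : ℝ⟦X⟧} (hP : constantCoeff P = 1) :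
    derivative ℝ (logOf P) * P = derivative ℝ P := by
  have hs : HasSubst (P - 1) := HasSubst.of_constantCoeff_zero' (by simp [hP])
  have h1 : (1 + X) * derivative ℝ (log ℝ) = 1 := by
    rw [deriv_log, add_mul, one_mul]
    ext n
    rcases n with _ | n
    · simp
    · rw [map_add, coeff_succ_X_mul]
      simp [coeff_one, pow_succ]
  have h2 := congrArg (subst (P - 1)) h1
  have h3 : subst (P - 1) (1 : ℝ⟦X⟧) = 1 := by
    rw [← coe_substAlgHom hs, map_one]
  rw [subst_mul hs, subst_add hs, subst_X hs, h3, add_sub_cancel] at h2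
  rw [logOf_eq, derivative_subst hs, map_sub, Derivation.map_one_eq_zero, sub_zero]
  linear_combination derivative ℝ P * h2

lemma sum_coeff_logOf_mul_coeff {P : ℝ⟦X⟧} (hP : constantCoeff P = 1) (j : ℕ) :
    ∑ ij ∈ Finset.HasAntidiagonal.antidiagonal j, (ij.1 : ℝ) * (coeff ij.1 (logOf P) * coeff ij.2 P) =
      j * coeff j P := by
  have hx : ∀ (P : ℝ⟦X⟧) (a : ℕ), coeff a (X * derivative ℝ P) = a * coeff a P := by
    intro P a
    rcases a with _ | a
    · simp
    · rw [coeff_succ_X_mul, coeff_derivative]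
      push_cast
      ring
  have e : (X * derivative ℝ (logOf P)) * P = X * derivative ℝ P := by
    rw [mul_assoc, derivative_logOf_mul hP]
  rw [← hx, ← e, coeff_mul]
  refine Finset.sum_congr rfl fun ij _ => ?_
  rw [hx]
  ring

/-- The same support argument, now with the recurrence obtained from (log P)' P = P'. -/
lemma coeff_logOf_mem {P : ℝ⟦X⟧} (hP : constantCoeff P = 1)
    (S : AddSubmonoid ℕ) (hS : ∀ m, coeff m P ≠ 0 → m ∈ S) :
    ∀ j, coeff j (logOf P) ≠ 0 → j ∈ S := by
  intro j
  induction j using Nat.strong_induction_on with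
  | _ j ih =>
    intro hj
    by_contra hjS
    have hj0 : j ≠ 0 := fun h => hjS (h ▸ S.zero_mem)
    have hPj : coeff j P = 0 := by_contra fun h => hjS (hS j h)
    have key := sum_coeff_logOf_mul_coeff hP j
    rw [Finset.sum_eq_single (j, 0), hPj] at key
    · simp [hP, hj, hj0] at key
    · rintro ⟨a, b⟩ hab hne
      have hab' : a + b = j := by simpa using hab
      have hb : b ≠ 0 := fun h => hne (by subst h; simp at hab' ⊢; exact hab')
      by_contra h
      have h1 : coeff b P ≠ 0 := fun h0 => h (by simp [h0])
      have h2 : coeff a (logOf P) ≠ 0 := fun h0 => h (by simp [h0])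
      exact hjS (hab' ▸ S.add_mem (ih a (by omega) h2) (hS b h1))
    · intro h
      simp at h

end Formal

/-! ### Logarithms, roots and inverses of analytic germs -/

namespace Represents

variable {f g : ℝ → ℝ} {P Q : ℝ⟦X⟧}

lemma log_one_add : Represents (fun t => Real.log (1 + t)) (PowerSeries.log ℝ) := by
  filter_upwards [Metric.ball_mem_nhds (0 : ℝ) one_pos] with t ht
  have ht' : |(-t)| < 1 := by simpa using ht
  have h := (Real.hasSum_pow_div_log_of_abs_lt_one ht').neg
  rw [neg_neg, sub_neg_eq_add] at h
  rw [← hasSum_nat_add_iff' 1]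
  simp only [Finset.range_one, Finset.sum_singleton, coeff_log, if_true, zero_mul, sub_zero]
  convert h using 2 with n
  rw [neg_pow t]
  simp [pow_succ]
  ring

lemma logOf (hf : Represents f P) (hP : constantCoeff P = 1) :
    Represents (fun t => Real.log (f t)) (PowerSeries.logOf P) := by
  have h := log_one_add.comp (hf.add (const (-1))) (by simp [hP])
  have e : P + C (-1) = P - 1 := by rw [map_neg, map_one, sub_eq_add_neg]
  rw [e, ← logOf_eq] at h
  refine h.congr (Eventually.of_forall fun t => ?_)
  simp only [add_neg_cancel_comm_assoc]

/-- The root is exp(log f / q), analytic because f(0) = 1; uniqueness of series makes its q-th power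
formally equal to P. -/
lemma exists_root (hf : Represents f P) (hP : constantCoeff P = 1) {q : ℕ} (hq : 0 < q) :
    ∃ h H, Represents h H ∧ constantCoeff H = 1 ∧ H ^ q = P ∧ ∀ᶠ t in 𝓝 0, h t ^ q = f t := by
  have hf0 : f 0 = 1 := by rw [hf.apply_zero, hP]
  have hpos : ∀ᶠ t in 𝓝 0, 0 < f t :=
    hf.analyticAt.continuousAt.eventually (lt_mem_nhds (by rw [hf0]; exact one_pos))
  have han : AnalyticAt ℝ (fun t => Real.exp (Real.log (f t) * (q : ℝ)⁻¹)) 0 :=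
    ((hf.analyticAt.log (by rw [hf0]; exact one_pos)).mul analyticAt_const).rexp
  obtain ⟨H, hH⟩ := exists_of_analyticAt han
  have hpow : ∀ᶠ t in 𝓝 0, Real.exp (Real.log (f t) * (q : ℝ)⁻¹) ^ q = f t := by
    filter_upwards [hpos] with t ht
    rw [← Real.exp_nat_mul, mul_comm (Real.log _), mul_inv_cancel_left₀ (by positivity),
      Real.exp_log ht]
  refine ⟨_, H, hH, ?_, ((hH.pow q).congr hpow).unique hf, hpow⟩
  rw [← hH.apply_zero, hf0]
  simp

/-- The analytic inverse function theorem supplies g; uniqueness of series turns both compositional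
identities into formal ones. -/
lemma exists_inverse (hf : Represents f P) (hP : constantCoeff P = 0) (hP1 : coeff 1 P = 1) :
    ∃ g T, Represents g T ∧ constantCoeff T = 0 ∧ coeff 1 T = 1 ∧ P.subst T = X ∧ T.subst P = X ∧
      (∀ᶠ s in 𝓝 0, f (g s) = s) := by
  have hf0 : f 0 = 0 := by rw [hf.apply_zero, hP]
  have hd : _root_.deriv f 0 ≠ 0 := by
    rw [← hf.coeff_one, hP1]
    exact one_ne_zero
  set hsd := hf.analyticAt.hasStrictDerivAt
  set g := hsd.localInverse f (_root_.deriv f 0) 0 hd with hg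
  have hga : AnalyticAt ℝ g (f 0) := hf.analyticAt.analyticAt_localInverse hd
  have hfg : ∀ᶠ s in 𝓝 (f 0), f (g s) = s :=
    (hsd.hasStrictFDerivAt_equiv hd).eventually_right_inverse
  have hgf : ∀ᶠ t in 𝓝 0, g (f t) = t :=
    (hsd.hasStrictFDerivAt_equiv hd).eventually_left_inverse
  have hg0 : g 0 = 0 := by simpa [hf0] using hgf.self_of_nhds
  rw [hf0] at hga hfg
  obtain ⟨T, hT⟩ := exists_of_analyticAt hga
  have hT0 : constantCoeff T = 0 := by rw [← hT.apply_zero, hg0]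
  have e1 : P.subst T = X := ((hf.comp hT hT0).congr hfg).unique id
  have e2 : T.subst P = X := ((hT.comp hf hP).congr hgf).unique id
  refine ⟨g, T, hT, hT0, ?_, e1, e2, hfg⟩
  have h1 := congrArg (coeff 1) e1
  rw [subst_eq_sum_add (HasSubst.of_constantCoeff_zero' hT0) _ 2, map_add] at h1
  have h2 : coeff 1 (T ^ 2 * (mk fun m => coeff (m + 2) P).subst T) = 0 := by
    obtain ⟨R, rfl⟩ := X_dvd_iff.2 hT0
    rw [mul_pow, mul_assoc, coeff_X_pow_mul', if_neg (by norm_num)]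
  rw [h2] at h1
  simpa [Finset.sum_range_succ, hP, hP1, coeff_X] using h1

lemma exists_eq_X_pow_mul (q : ℕ) (hf : Represents f (X ^ q * P)) :
    ∃ u, Represents u P ∧ ∀ t, f t = t ^ q * u t := by
  induction q generalizing f with
  | zero => exact ⟨f, by simpa using hf, by simp⟩
  | succ q ih =>
    obtain ⟨r, hr, hfr⟩ := hf.exists_eq_add_mul
    have : (mk fun m => coeff (m + 1) (X ^ (q + 1) * P)) = X ^ q * P := by
      ext m
      rw [coeff_mk, pow_succ', mul_assoc, coeff_succ_X_mul]
    rw [this] at hr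
    obtain ⟨u, hu, hru⟩ := ih hr
    refine ⟨u, hu, fun t => ?_⟩
    rw [hfr, hru]
    simp [pow_succ']
    ring

end Represents

end

/-! ### The generalized series of the bracket and of the phase -/

section

open PowerSeries

lemma Gamma_add_natCast {s : ℝ} (hs : ∀ k : ℕ, s + k ≠ 0) (k : ℕ) :
    Real.Gamma (s + k) = Real.Gamma s * (ascPochhammer ℝ k).eval s := by
  induction k with
  | zero => simp
  | succ k ih =>
    rw [ascPochhammer_succ_eval, Nat.cast_succ, ← add_assoc, Real.Gamma_add_one (hs k), ih]
    ring

lemma hypCoeff_eq {μ : ℝ} (hμ : ∀ k : ℕ, 1 + μ + k ≠ 0) (k : ℕ) :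
    hypCoeff μ k = Real.Gamma (1 + μ) * (1 / ((k.factorial : ℝ) * Real.Gamma (μ + k + 1))) *
      (1 / 4) ^ k := by
  have hG : Real.Gamma (1 + μ) ≠ 0 := Real.Gamma_ne_zero fun m h => hμ m (by rw [h]; ring)
  rw [hypCoeff, show μ + k + 1 = 1 + μ + k by ring, Gamma_add_natCast hμ, one_div_pow]
  field_simp

lemma hasSum_hypCoeff {μ : ℝ} (hμ : ∀ k : ℕ, 1 + μ + k ≠ 0) (y : ℝ) :
    HasSum (fun k : ℕ => hypCoeff μ k * y ^ k) (Real.Gamma (1 + μ) * besselE μ (y / 4)) := by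
  refine ((summable_besselE μ (y / 4)).hasSum.mul_left (Real.Gamma (1 + μ))).congr_fun fun k => ?_
  rw [hypCoeff_eq hμ, div_pow y, one_div_pow]
  ring

/-- The sum of the generalized series of `(2/Γ(ν)) (x/2)^ν K_ν(x)`, for `ν = p/q` and
`t = x^(1/q)`. -/
def bracketSum (p q : ℕ) (t : ℝ) : ℝ :=
  Real.Gamma (1 + -((p : ℝ) / q)) * besselE (-((p : ℝ) / q)) (t ^ (2 * q) / 4) +
    (1 / 2 : ℝ) ^ (2 * ((p : ℝ) / q)) * (Real.Gamma (-((p : ℝ) / q)) / Real.Gamma ((p : ℝ) / q)) *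
      t ^ (2 * p) * (Real.Gamma (1 + (p : ℝ) / q) * besselE ((p : ℝ) / q) (t ^ (2 * q) / 4))

lemma one_sub_add_ne_zero {ν : ℝ} (h : ν ∈ Ioo (0 : ℝ) 1 ∪ Ioo 1 2) (k : ℕ) :
    1 + -ν + k ≠ 0 := by
  intro hk
  rcases h with ⟨h0, h1⟩ | ⟨h1, h2⟩
  · have : (0 : ℝ) ≤ k := k.cast_nonneg
    linarith
  · rcases k with _ | k
    · simp at hk
      linarith
    · push_cast at hk
      have : (0 : ℝ) ≤ k := k.cast_nonneg
      linarith

lemma one_add_add_ne_zero {ν : ℝ} (h : 0 < ν) (k : ℕ) : 1 + ν + k ≠ 0 := by positivity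

lemma hasSum_bracketSeries {p q : ℕ} (hq : 0 < q)
    (h : (p : ℝ) / q ∈ Ioo (0 : ℝ) 1 ∪ Ioo 1 2) (t : ℝ) :
    HasSum (fun m => coeff m (bracketSeries p q) * t ^ m) (bracketSum p q t) := by
  set ν : ℝ := (p : ℝ) / q with hν
  have h1 := hasSum_hypCoeff (one_sub_add_ne_zero h) (t ^ (2 * q))
  have h2 := (hasSum_hypCoeff (one_add_add_ne_zero (pos_of_mem h)) (t ^ (2 * q))).mul_left
    ((1 / 2 : ℝ) ^ (2 * ν) * (Real.Gamma (-ν) / Real.Gamma ν) * t ^ (2 * p))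
  have hq2 : 0 < 2 * q := by positivity
  -- The coefficients are supported on the progressions 2qk and 2p + 2qk; each sum is reindexed
  -- along its own progression.
  have i1 : Function.Injective fun k : ℕ => 2 * q * k := fun a b hab =>
    Nat.eq_of_mul_eq_mul_left hq2 hab
  have i2 : Function.Injective fun k : ℕ => 2 * p + 2 * q * k := fun a b hab =>
    Nat.eq_of_mul_eq_mul_left hq2 (Nat.add_left_cancel hab)
  have s1 : HasSum (fun m => (if 2 * q ∣ m then hypCoeff (-ν) (m / (2 * q)) else 0) * t ^ m)
      (Real.Gamma (1 + -ν) * besselE (-ν) (t ^ (2 * q) / 4)) := by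
    rw [← i1.hasSum_iff]
    · convert h1 using 2 with k
      simp only [Function.comp, dvd_mul_right, if_true, Nat.mul_div_cancel_left _ hq2, pow_mul]
    · intro m hm
      rw [if_neg fun ⟨k, hk⟩ => hm ⟨k, hk.symm⟩, zero_mul]
  have s2 : HasSum (fun m => (if 2 * p ≤ m ∧ 2 * q ∣ m - 2 * p then
      (1 / 2 : ℝ) ^ (2 * ν) * (Real.Gamma (-ν) / Real.Gamma ν) *
        hypCoeff ν ((m - 2 * p) / (2 * q)) else 0) * t ^ m)
      ((1 / 2 : ℝ) ^ (2 * ν) * (Real.Gamma (-ν) / Real.Gamma ν) * t ^ (2 * p) *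
        (Real.Gamma (1 + ν) * besselE ν (t ^ (2 * q) / 4))) := by
    rw [← i2.hasSum_iff]
    · refine h2.congr_fun fun k => ?_
      have e : 2 * p + 2 * q * k - 2 * p = 2 * q * k := Nat.add_sub_cancel_left _ _
      rw [Function.comp_apply, if_pos ⟨Nat.le_add_right _ _, by rw [e]; exact dvd_mul_right _ _⟩, e,
        Nat.mul_div_cancel_left _ hq2, pow_add, ← pow_mul]
      ring
    · intro m hm
      rw [if_neg, zero_mul]
      rintro ⟨hle, k, hk⟩
      exact hm ⟨k, (by omega : 2 * p + 2 * q * k = m)⟩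
  refine (s1.add s2).congr_fun fun m => ?_
  rw [bracketSeries, coeff_mk, add_mul]

lemma represents_bracketSeries {p q : ℕ} (hq : 0 < q)
    (h : (p : ℝ) / q ∈ Ioo (0 : ℝ) 1 ∪ Ioo 1 2) :
    Represents (bracketSum p q) (bracketSeries p q) :=
  Eventually.of_forall (hasSum_bracketSeries hq h)

lemma constantCoeff_bracketSeries {p q : ℕ} (hp : 0 < p) :
    constantCoeff (bracketSeries p q) = 1 := by
  rw [← coeff_zero_eq_constantCoeff_apply, bracketSeries, coeff_mk, if_pos (dvd_zero _),
    if_neg (by omega)]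
  simp [hypCoeff]

lemma coeff_bracketSeries_mem {p q : ℕ} (m : ℕ) (hm : coeff m (bracketSeries p q) ≠ 0) :
    m ∈ AddSubmonoid.closure {2 * q, 2 * p} := by
  rw [AddSubmonoid.mem_closure_pair]
  rw [bracketSeries, coeff_mk] at hm
  by_cases h1 : 2 * q ∣ m
  · obtain ⟨k, rfl⟩ := h1
    exact ⟨k, 0, by simp [mul_comm]⟩
  · by_cases h2 : 2 * p ≤ m ∧ 2 * q ∣ m - 2 * p
    · obtain ⟨h3, k, hk⟩ := h2
      exact ⟨k, 1, by simp only [smul_eq_mul]; rw [mul_comm, ← hk]; omega⟩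
    · simp [h1, h2] at hm

/-- The connection formula at y = (t^q/2)², with sin(πν)/π rewritten as 1/(Γ(ν)Γ(1-ν)). The
restriction t > 0 is essential: the right side is analytic through 0, whereas the fractional power
y^ν equals a multiple of t^(2p) only for the branch t > 0. -/
lemma macdonald_div_Gamma_eq {p q : ℕ} (hq : 0 < q)
    (h : (p : ℝ) / q ∈ Ioo (0 : ℝ) 1 ∪ Ioo 1 2) {t : ℝ} (ht : 0 < t) :
    macdonald ((p : ℝ) / q) ((t ^ q / 2) ^ 2) / Real.Gamma ((p : ℝ) / q) = bracketSum p q t := by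
  have hqr : (0 : ℝ) < q := by exact_mod_cast hq
  have hpow : ((t ^ q / 2) ^ 2) ^ ((p : ℝ) / q) = (1 / 2 : ℝ) ^ (2 * ((p : ℝ) / q)) * t ^ (2 * p) := by
    rw [← Real.rpow_natCast _ 2, ← Real.rpow_mul (by positivity), Nat.cast_ofNat, div_eq_mul_one_div,
      Real.mul_rpow (by positivity) (by norm_num), mul_comm, ← Real.rpow_natCast t,
      ← Real.rpow_natCast t, ← Real.rpow_mul ht.le]
    congr 2
    push_cast
    field_simp
  have hy : (t ^ q / 2) ^ 2 = t ^ (2 * q) / 4 := by ring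
  rw [bracketSum]
  have key := macdonald_mul_sin h (y := (t ^ q / 2) ^ 2) (by positivity)
  rw [hpow, hy] at key
  rw [hy]
  have hν := pos_of_mem h
  have hs := sin_pi_mul_ne_zero h
  have hG := Real.Gamma_pos_of_pos hν
  have hG1 := inv_Gamma_mul_inv_Gamma_one_sub ((p : ℝ) / q)
  generalize (p : ℝ) / q = ν at *
  have hGm : Real.Gamma (1 - ν) ≠ 0 := Real.Gamma_ne_zero fun m hm =>
    one_sub_add_ne_zero h m (by linarith)
  have g1 : Real.Gamma (1 + -ν) = -ν * Real.Gamma (-ν) := by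
    rw [add_comm, Real.Gamma_add_one (by linarith)]
  have g2 : Real.Gamma (1 + ν) = ν * Real.Gamma ν := by
    rw [add_comm, Real.Gamma_add_one hν.ne']
  rw [← hG1] at key
  rw [← sub_eq_add_neg] at g1 ⊢
  rw [g2]
  have g3 : Real.Gamma (-ν) = -Real.Gamma (1 - ν) / ν := by
    rw [g1]; field_simp
  rw [g3]
  field_simp at key ⊢
  linear_combination key

lemma phase_pow_eq {p q : ℕ} (hq : 0 < q)
    (h : (p : ℝ) / q ∈ Ioo (0 : ℝ) 1 ∪ Ioo 1 2) {t : ℝ} (ht : 0 < t) :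
    phase ((p : ℝ) / q) (t ^ q) = t ^ q + Real.log (bracketSum p q t) := by
  rw [phase_eq h (by positivity), macdonald_div_Gamma_eq hq h ht]

lemma represents_phaseSeries {p q : ℕ} (hp : 0 < p) (hq : 0 < q)
    (h : (p : ℝ) / q ∈ Ioo (0 : ℝ) 1 ∪ Ioo 1 2) :
    Represents (fun t => t ^ q + Real.log (bracketSum p q t)) (phaseSeries p q) :=
  (Represents.id.pow q).add ((represents_bracketSeries hq h).logOf (constantCoeff_bracketSeries hp))

lemma hasSum_phaseSeries {p q : ℕ} (hp : 0 < p) (hq : 0 < q)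
    (h : (p : ℝ) / q ∈ Ioo (0 : ℝ) 1 ∪ Ioo 1 2) :
    ∃ δ > 0, ∀ x ∈ Ioo (0 : ℝ) δ,
      HasSum (fun m : ℕ => coeff m (phaseSeries p q) * x ^ ((m : ℝ) / q))
        (phase ((p : ℝ) / q) x) := by
  have hqr : (0 : ℝ) < q := by exact_mod_cast hq
  have hc : Tendsto (fun x : ℝ => x ^ (1 / (q : ℝ))) (𝓝 0) (𝓝 0) := by
    have := (Real.continuousAt_rpow_const 0 (1 / (q : ℝ)) (Or.inr (by positivity))).tendsto
    rwa [Real.zero_rpow (by positivity)] at this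
  obtain ⟨δ, hδ, hball⟩ := Metric.eventually_nhds_iff.1
    (hc.eventually (represents_phaseSeries hp hq h))
  refine ⟨δ, hδ, fun x hx => ?_⟩
  have hs := hball (y := x) (by simpa [abs_of_pos hx.1] using hx.2)
  have hx' : (x ^ (1 / (q : ℝ))) ^ q = x := by
    rw [← Real.rpow_natCast, ← Real.rpow_mul hx.1.le, one_div_mul_cancel hqr.ne', Real.rpow_one]
  beta_reduce at hs
  rw [← phase_pow_eq hq h (Real.rpow_pos_of_pos hx.1 _), hx'] at hs
  convert hs using 3 with m
  rw [← Real.rpow_natCast, ← Real.rpow_mul hx.1.le]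
  congr 1
  ring

end

/-! ### Reversion and the derivative of the inverse phase -/

section

open PowerSeries

lemma coeff_phaseSeries_mem {p q : ℕ} (hq : 0 < q) (hqp : q < 2 * p) (m : ℕ)
    (hm : coeff (m + q) (phaseSeries p q) ≠ 0) :
    m ∈ AddSubmonoid.closure {q, 2 * p - q} := by
  rw [AddSubmonoid.mem_closure_pair]
  rcases Nat.eq_zero_or_pos m with rfl | hm0
  · exact ⟨0, 0, by simp⟩
  rw [phaseSeries, map_add, coeff_X_pow, if_neg (by omega), zero_add] at hm
  have h1 := coeff_logOf_mem (constantCoeff_bracketSeries (by omega)) _ coeff_bracketSeries_mem _ hm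
  obtain ⟨a, b, hab⟩ := (AddSubmonoid.mem_closure_pair _ _ _).1 h1
  obtain ⟨d, hd⟩ : ∃ d, 2 * p = d + q := ⟨2 * p - q, by omega⟩
  simp only [smul_eq_mul, hd, Nat.add_sub_cancel] at hab ⊢
  -- An exponent of the logarithm is 2aq + 2bp = (2a+b)q + b(2p-q). Removing the leading q lowers
  -- 2a+b by one, which is possible since the exponent is positive.
  rcases hc : 2 * a + b with _ | c
  · have ha : a = 0 := by omega
    have hb : b = 0 := by omega
    simp [ha, hb] at hab
    omega
  · refine ⟨c, b, Nat.add_right_cancel (m := q) ?_⟩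
    rw [← hab]
    calc c * q + b * d + q = (c + 1) * q + b * d := by ring
      _ = (2 * a + b) * q + b * d := by rw [hc]
      _ = _ := by ring

/-- The least positive exponent available is min(2p, 2q) > q. Hence x is the leading term of the
phase. -/
lemma coeff_logOf_bracketSeries_of_le {p q : ℕ} (hq : 0 < q) (hqp : q < 2 * p) {j : ℕ}
    (hj : j ≤ q) : coeff j (logOf (bracketSeries p q)) = 0 := by
  have h1 := constantCoeff_bracketSeries (p := p) (q := q) (by omega)
  rcases Nat.eq_zero_or_pos j with rfl | hj0
  · rw [coeff_zero_eq_constantCoeff_apply]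
    exact constantCoeff_logOf h1
  by_contra hne
  obtain ⟨a, b, hab⟩ := (AddSubmonoid.mem_closure_pair _ _ _).1
    (coeff_logOf_mem h1 _ coeff_bracketSeries_mem _ hne)
  simp only [smul_eq_mul] at hab
  rcases Nat.eq_zero_or_pos a with rfl | ha
  · rcases Nat.eq_zero_or_pos b with rfl | hb
    · omega
    · nlinarith
  · nlinarith

lemma phaseSeries_eq_X_pow_mul {p q : ℕ} (hq : 0 < q) (hqp : q < 2 * p) :
    phaseSeries p q = X ^ q * mk fun m => coeff (m + q) (phaseSeries p q) := by
  ext j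
  rw [coeff_X_pow_mul']
  split_ifs with h
  · rw [coeff_mk, Nat.sub_add_cancel h]
  · rw [phaseSeries, map_add, coeff_X_pow, if_neg (by omega), zero_add,
      coeff_logOf_bracketSeries_of_le hq hqp (by omega)]

/-- A^q - 1 = (A - 1)(1 + A + ⋯ + A^(q-1)), and the second factor has constant term q ≠ 0. The
normalization A(0) = 1 excludes the root -1 when q is even. -/
lemma eq_X_of_pow_eq {q : ℕ} (hq : 0 < q) {A : ℝ⟦X⟧} (hA : constantCoeff A = 1)
    (h : (X * A) ^ q = X ^ q) : A = 1 := by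
  rw [mul_pow] at h
  have h1 : A ^ q = 1 :=
    mul_left_cancel₀ (pow_ne_zero q X_ne_zero) (h.trans (mul_one _).symm)
  have h2 : (∑ i ∈ Finset.range q, A ^ i) * (A - 1) = 0 := by
    rw [geom_sum_mul, h1, sub_self]
  rcases mul_eq_zero.1 h2 with h3 | h3
  · have h4 := congrArg constantCoeff h3
    simp [hA] at h4
    omega
  · exact sub_eq_zero.1 h3

/-- The phase series is W^q with W = XH, H the q-th root of its cofactor of X^q. The inverse T of W
is a reversion. Conversely W(T')^q = X^q forces W(T') = X, and applying T on the left gives T' = T.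
-/
lemma exists_reversion {p q : ℕ} (hq : 0 < q) (hqp : q < 2 * p)
    (h : (p : ℝ) / q ∈ Ioo (0 : ℝ) 1 ∪ Ioo 1 2) :
    ∃ (g : ℝ → ℝ) (T H : ℝ⟦X⟧), Represents g T ∧ IsReversion p q T ∧
      (∀ T', IsReversion p q T' → T' = T) ∧ constantCoeff H = 1 ∧
      (∀ m, coeff m (H ^ q) = coeff (m + q) (phaseSeries p q)) ∧ T.subst (X * H) = X ∧
      ∀ᶠ s in 𝓝 0, g s ^ q + Real.log (bracketSum p q (g s)) = s ^ q := by
  have hΦ := phaseSeries_eq_X_pow_mul hq hqp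
  set U : ℝ⟦X⟧ := mk fun m => coeff (m + q) (phaseSeries p q) with hU
  have hrep := represents_phaseSeries (by omega) hq h
  rw [hΦ] at hrep
  obtain ⟨u, hu, hφ⟩ := hrep.exists_eq_X_pow_mul
  have hU0 : constantCoeff U = 1 := by
    rw [← coeff_zero_eq_constantCoeff_apply, hU, coeff_mk, zero_add, phaseSeries, map_add,
      coeff_X_pow, if_pos rfl, coeff_logOf_bracketSeries_of_le hq hqp le_rfl, add_zero]
  obtain ⟨r, H, hr, hH0, hHq, hrq⟩ := hu.exists_root hU0 hq
  have hw := Represents.id.mul hr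
  have hW1 : coeff 1 (X * H) = 1 := by
    rw [coeff_succ_X_mul, coeff_zero_eq_constantCoeff_apply, hH0]
  obtain ⟨g, T, hg, hT0, hT1, hWT, hTW, hinv⟩ := hw.exists_inverse (by simp) hW1
  have hΦW : phaseSeries p q = (X * H) ^ q := by rw [hΦ, mul_pow, hHq]
  have hsT : HasSubst T := HasSubst.of_constantCoeff_zero' hT0
  have hsW : HasSubst (X * H) := HasSubst.of_constantCoeff_zero' (by simp)
  refine ⟨g, T, H, hg, ⟨hT0, hT1, ?_⟩, ?_, hH0, fun m => by rw [hHq, hU, coeff_mk], hTW, ?_⟩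
  · rw [hΦW, subst_pow hsT, hWT]
  · rintro T' ⟨h0, h1, h2⟩
    have hsT' : HasSubst T' := HasSubst.of_constantCoeff_zero' h0
    rw [hΦW, subst_pow hsT', subst_mul hsT', subst_X hsT'] at h2
    obtain ⟨S, rfl⟩ := X_dvd_iff.2 h0
    rw [coeff_succ_X_mul, coeff_zero_eq_constantCoeff_apply] at h1
    rw [mul_assoc] at h2
    have hc : constantCoeff (H.subst (X * S)) = 1 := by
      rw [subst_eq_sum_add hsT' _ 1]
      simp [hH0]
    have h3 := eq_X_of_pow_eq hq (by rw [map_mul, h1, hc, one_mul]) h2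
    have h4 : (X * H).subst (X * S) = X := by
      rw [subst_mul hsT', subst_X hsT', mul_assoc, h3, mul_one]
    have h5 := subst_comp_subst_apply hsW hsT' T
    rw [hTW, h4, subst_X hsT', X_subst] at h5
    exact h5
  · have hg0 : Tendsto g (𝓝 0) (𝓝 0) := by
      have := hg.analyticAt.continuousAt.tendsto
      rwa [hg.apply_zero, hT0] at this
    filter_upwards [hinv, hg0.eventually hrq] with s hs hs2
    rw [hφ, ← hs2, ← mul_pow, hs]

lemma existsUnique_isReversion {p q : ℕ} (hq : 0 < q) (hqp : q < 2 * p)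
    (h : (p : ℝ) / q ∈ Ioo (0 : ℝ) 1 ∪ Ioo 1 2) : ∃! T, IsReversion p q T := by
  obtain ⟨g, T, H, -, hT, huniq, -⟩ := exists_reversion hq hqp h
  exact ⟨T, hT, huniq⟩

lemma isReversion_reversion {p q : ℕ} (hq : 0 < q) (hqp : q < 2 * p)
    (h : (p : ℝ) / q ∈ Ioo (0 : ℝ) 1 ∪ Ioo 1 2) : IsReversion p q (reversion p q) :=
  Classical.epsilon_spec (existsUnique_isReversion hq hqp h).exists

/-- The coefficients of `dx/dτ` by Lagrange inversion. -/
lemma exists_derivCoeff_eq {p q : ℕ} (hq : 0 < q) (hqp : q < 2 * p)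
    (h : (p : ℝ) / q ∈ Ioo (0 : ℝ) 1 ∪ Ioo 1 2) :
    ∃ H : ℝ⟦X⟧, constantCoeff H = 1 ∧
      (∀ m, coeff m (H ^ q) = coeff (m + q) (phaseSeries p q)) ∧
      ∀ m, derivCoeff p q m = coeff m (H⁻¹ ^ (m + q)) := by
  obtain ⟨g, T, H, -, -, huniq, hH0, hHq, hTW, -⟩ := exists_reversion hq hqp h
  refine ⟨H, hH0, hHq, fun m => ?_⟩
  have hL := lagrange_inversion hH0 hTW (m := m) hq
  have hqr : (0 : ℝ) < q := by exact_mod_cast hq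
  rw [derivCoeff, huniq _ (isReversion_reversion hq hqp h)]
  push_cast at hL
  field_simp
  exact hL

lemma derivCoeff_mem {p q : ℕ} (hq : 0 < q) (hqp : q < 2 * p)
    (h : (p : ℝ) / q ∈ Ioo (0 : ℝ) 1 ∪ Ioo 1 2) {m : ℕ} (hm : derivCoeff p q m ≠ 0) :
    ∃ a b : ℕ, m = a * q + b * (2 * p - q) := by
  obtain ⟨H, hH0, hHq, hd⟩ := exists_derivCoeff_eq hq hqp h
  rw [hd] at hm
  have := coeff_inv_pow_mem hH0 hq _
    (fun m hm => coeff_phaseSeries_mem hq hqp m (by rwa [← hHq])) _ m hm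
  obtain ⟨a, b, hab⟩ := (AddSubmonoid.mem_closure_pair _ _ _).1 this
  exact ⟨a, b, by simpa using hab.symm⟩

lemma infinite_exponents {p q : ℕ} (hq : 0 < q) :
    {m : ℕ | ∃ a b : ℕ, m = a * q + b * (2 * p - q)}.Infinite :=
  infinite_of_injective_forall_mem (f := fun a : ℕ => a * q)
    (fun a b hab => Nat.eq_of_mul_eq_mul_right hq hab) fun a => ⟨a, 0, by simp⟩

lemma strictMono_expIndex {p q : ℕ} (hq : 0 < q) : StrictMono (expIndex p q) :=
  Nat.nth_strictMono (infinite_exponents hq)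

lemma range_expIndex {p q : ℕ} (hq : 0 < q) :
    range (expIndex p q) = {m : ℕ | ∃ a b : ℕ, m = a * q + b * (2 * p - q)} :=
  Nat.range_nth_of_infinite (infinite_exponents hq)

lemma exists_eq_expIndex {p q : ℕ} (hq : 0 < q) (hqp : q < 2 * p)
    (h : (p : ℝ) / q ∈ Ioo (0 : ℝ) 1 ∪ Ioo 1 2) {m : ℕ} (hm : derivCoeff p q m ≠ 0) :
    ∃ k : ℕ, m = expIndex p q k := by
  have h1 : m ∈ range (expIndex p q) := by
    rw [range_expIndex hq]
    exact derivCoeff_mem hq hqp h hm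
  obtain ⟨k, hk⟩ := h1
  exact ⟨k, hk.symm⟩

lemma invPhase_phase {ν x : ℝ} (h : ν ∈ Ioo (0 : ℝ) 1 ∪ Ioo 1 2) (hν : 1 / 2 < ν) (hx : 0 < x) :
    invPhase ν (phase ν x) = x :=
  (strictMonoOn_phase h hν).injOn.leftInvOn_invFunOn hx

lemma half_lt_div {p q : ℕ} (hq : 0 < q) (hqp : q < 2 * p) : 1 / 2 < (p : ℝ) / q := by
  have hqr : (0 : ℝ) < q := by exact_mod_cast hq
  have : (q : ℝ) < 2 * p := by exact_mod_cast hqp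
  rw [div_lt_div_iff₀ two_pos hqr]
  linarith

lemma hasDerivAt_invPhase {p q : ℕ} (hq : 0 < q) (hqp : q < 2 * p)
    (h : (p : ℝ) / q ∈ Ioo (0 : ℝ) 1 ∪ Ioo 1 2) :
    ∃ δ > 0, ∀ τ ∈ Ioo (0 : ℝ) δ, ∃ d : ℝ,
      HasDerivAt (invPhase ((p : ℝ) / q)) d τ ∧
      HasSum (fun k : ℕ => B p q k * τ ^ expo p q k) d := by
  obtain ⟨g, T, H, hg, hT, huniq, -, -, -, hφ⟩ := exists_reversion hq hqp h
  have hqr : (0 : ℝ) < q := by exact_mod_cast hq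
  have hrev : reversion p q = T := huniq _ (isReversion_reversion hq hqp h)
  obtain ⟨T', rfl⟩ := X_dvd_iff.2 hT.1
  have hg1 : ∀ᶠ s in 𝓝 0, 0 < s → 0 < g s := by
    have h1 : X * T' = X ^ 1 * T' := by rw [pow_one]
    rw [h1] at hg
    obtain ⟨u, hu, hgu⟩ := hg.exists_eq_X_pow_mul
    have hu0 : u 0 = 1 := by
      have := hT.2.1
      rw [coeff_succ_X_mul, coeff_zero_eq_constantCoeff_apply] at this
      rw [hu.apply_zero, this]
    have := hu.analyticAt.continuousAt.eventually (lt_mem_nhds (by rw [hu0]; exact one_pos))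
    filter_upwards [this] with s hs hs0
    rw [hgu]
    positivity
  have hG := hg.pow q
  obtain ⟨r, rfl⟩ : ∃ r, q = r + 1 := ⟨q - 1, by omega⟩
  -- In s = τ^(1/q), x = g(s)^q has derivative s^(q-1) z(s). The chain rule factor s^(1-q)/q cancels
  -- the power, so dx/dτ = z(s)/q.
  set Z : ℝ⟦X⟧ := mk fun m => ((m + r : ℕ) + 1 : ℝ) * coeff (m + (r + 1)) ((X * T') ^ (r + 1)) with hZ
  have hGd : derivative ℝ ((X * T') ^ (r + 1)) = X ^ r * Z := by
    ext j
    rw [coeff_X_pow_mul', coeff_derivative]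
    split_ifs with hj
    · rw [hZ, coeff_mk, Nat.sub_add_cancel hj, mul_comm]
      congr 2
      congr 1
      omega
    · rw [mul_pow, coeff_X_pow_mul', if_neg (by omega), zero_mul]
  have hG' := hG.deriv
  rw [hGd] at hG'
  obtain ⟨z, hz, hGz⟩ := hG'.exists_eq_X_pow_mul
  obtain ⟨δ, hδ, hball⟩ := Metric.eventually_nhds_iff.1
    (hφ.and (hg1.and (hz.and hG.analyticAt.eventually_analyticAt)))
  set Q : ℝ := ((r + 1 : ℕ) : ℝ) with hQ
  have hinvpow : ∀ τ : ℝ, 0 < τ → (τ ^ (1 / Q)) ^ (r + 1) = τ := fun τ hτ => by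
    rw [← Real.rpow_natCast, ← Real.rpow_mul hτ.le, one_div_mul_cancel hqr.ne', Real.rpow_one]
  have hsmall : ∀ τ ∈ Ioo (0 : ℝ) (δ ^ Q), dist (τ ^ (1 / Q)) 0 < δ := fun τ hτ => by
    rw [Real.dist_0_eq_abs, abs_of_pos (Real.rpow_pos_of_pos hτ.1 _)]
    have := Real.rpow_lt_rpow hτ.1.le hτ.2 (show 0 < 1 / Q by positivity)
    rwa [← Real.rpow_mul hδ.le, mul_one_div_cancel hqr.ne', Real.rpow_one] at this
  have hX : ∀ τ ∈ Ioo (0 : ℝ) (δ ^ Q), invPhase (p / Q) τ = g (τ ^ (1 / Q)) ^ (r + 1) := by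
    intro τ hτ
    obtain ⟨a1, a2, -⟩ := hball (hsmall τ hτ)
    have hgpos := a2 (Real.rpow_pos_of_pos hτ.1 _)
    rw [← phase_pow_eq hq h hgpos, hinvpow τ hτ.1] at a1
    rw [← invPhase_phase h (half_lt_div hq hqp) (pow_pos hgpos (r + 1)), a1]
  refine ⟨δ ^ Q, by positivity, fun τ hτ => ⟨z (τ ^ (1 / Q)) / Q, ?_, ?_⟩⟩
  · obtain ⟨-, -, -, a4⟩ := hball (hsmall τ hτ)
    have d1 := a4.differentiableAt.hasDerivAt
    rw [hGz] at d1
    have d2 := d1.comp τ (Real.hasDerivAt_rpow_const (p := 1 / Q) (Or.inl hτ.1.ne'))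
    refine (d2.congr_of_eventuallyEq ?_).congr_deriv ?_
    · filter_upwards [Ioo_mem_nhds hτ.1 hτ.2] with t ht
      exact hX t ht
    · have e : (τ ^ (1 / Q)) ^ r * τ ^ (1 / Q - 1) = 1 := by
        rw [Real.rpow_sub_one hτ.1.ne', mul_div_assoc', ← pow_succ, hinvpow τ hτ.1,
          div_self hτ.1.ne']
      linear_combination (z (τ ^ (1 / Q)) / Q) * e
  · obtain ⟨-, -, a3, -⟩ := hball (hsmall τ hτ)
    have s1 : HasSum (fun m : ℕ => derivCoeff p (r + 1) m * τ ^ ((m : ℝ) / Q))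
        (z (τ ^ (1 / Q)) / Q) := by
      refine (a3.div_const Q).congr_fun fun m => ?_
      rw [derivCoeff, hrev, hZ, coeff_mk, ← Real.rpow_natCast, ← Real.rpow_mul hτ.1.le,
        show 1 / Q * m = (m : ℝ) / Q by ring]
      push_cast at hQ ⊢
      rw [← hQ]
      field_simp
      rw [hQ]
      ring
    -- Outside the enumerated exponents all coefficients vanish, so the sum over m becomes a sum
    -- over k.
    rw [← (strictMono_expIndex (p := p) hq).injective.hasSum_iff] at s1
    · exact s1
    · intro m hm
      by_contra hne
      obtain ⟨k, hk⟩ := exists_eq_expIndex hq hqp h (left_ne_zero_of_mul hne)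
      exact hm ⟨k, hk.symm⟩

end

/-! ### Watson's lemma and the asymptotic expansion -/

lemma integrableOn_rpow_mul_exp_neg_mul_Ioi {a n : ℝ} (ha : 0 ≤ a) (hn : 0 < n) :
    IntegrableOn (fun τ : ℝ => τ ^ a * Real.exp (-n * τ)) (Ioi 0) := by
  have h := integrableOn_rpow_mul_exp_neg_mul_rpow (s := a) (p := 1) (b := n) (by linarith) one_pos hn
  simpa using h

lemma integral_rpow_mul_exp_neg_mul_Ioi_zero {a n : ℝ} (ha : 0 ≤ a) (hn : 0 < n) :
    ∫ τ in Ioi (0 : ℝ), τ ^ a * Real.exp (-n * τ) = Real.Gamma (a + 1) / n ^ (a + 1) := by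
  have h := Real.integral_rpow_mul_exp_neg_mul_Ioi (a := a + 1) (r := n) (by linarith) hn
  rw [add_sub_cancel_right, Real.div_rpow zero_le_one hn.le, Real.one_rpow] at h
  simp only [neg_mul]
  rw [h]
  ring

/-- On the missing tail τ ≥ ε one has e^(-nτ) ≤ e^(-(n-1)ε) e^(-τ), so truncating the Gamma integral
costs only O(e^(-εn)). -/
lemma abs_integral_Ioo_rpow_mul_exp_sub_le {a n ε : ℝ} (ha : 0 ≤ a) (hn : 1 ≤ n) (hε : 0 < ε) :
    |(∫ τ in Ioo 0 ε, τ ^ a * Real.exp (-n * τ)) - Real.Gamma (a + 1) / n ^ (a + 1)| ≤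
      Real.Gamma (a + 1) * Real.exp ε * Real.exp (-ε * n) := by
  have hn0 : 0 < n := by linarith
  have hi := integrableOn_rpow_mul_exp_neg_mul_Ioi ha hn0
  have hi1 := integrableOn_rpow_mul_exp_neg_mul_Ioi ha one_pos
  have hsub : Ici ε ⊆ Ioi 0 := fun x hx => lt_of_lt_of_le hε hx
  have hdisj : Disjoint (Ioo 0 ε) (Ici ε) := disjoint_left.2 fun x hx hx' =>
    absurd hx.2 (not_lt.2 hx')
  have hu := setIntegral_union (f := fun τ : ℝ => τ ^ a * Real.exp (-n * τ)) hdisj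
    measurableSet_Ici (hi.mono_set fun x hx => hx.1) (hi.mono_set hsub) (μ := volume)
  rw [Ioo_union_Ici_eq_Ioi hε, integral_rpow_mul_exp_neg_mul_Ioi_zero ha hn0] at hu
  rw [hu, sub_add_cancel_left, abs_neg, abs_of_nonneg]
  · calc ∫ τ in Ici ε, τ ^ a * Real.exp (-n * τ)
        ≤ ∫ τ in Ici ε, Real.exp (-(n - 1) * ε) * (τ ^ a * Real.exp (-1 * τ)) := by
          refine setIntegral_mono_on (hi.mono_set hsub) ((hi1.mono_set hsub).const_mul _)
            measurableSet_Ici fun τ (hτ : ε ≤ τ) => ?_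
          have hτ0 : 0 < τ := hε.trans_le hτ
          rw [mul_left_comm, ← Real.exp_add]
          gcongr
          nlinarith
      _ = Real.exp (-(n - 1) * ε) * ∫ τ in Ici ε, τ ^ a * Real.exp (-1 * τ) := integral_const_mul _ _
      _ ≤ Real.exp (-(n - 1) * ε) * ∫ τ in Ioi 0, τ ^ a * Real.exp (-1 * τ) := by
          refine mul_le_mul_of_nonneg_left (setIntegral_mono_set hi1 ?_
            (Eventually.of_forall hsub)) (Real.exp_pos _).le
          filter_upwards [ae_restrict_mem measurableSet_Ioi] with τ (hτ : 0 < τ)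
          simp only [Pi.zero_apply]
          positivity
      _ = _ := by
          rw [integral_rpow_mul_exp_neg_mul_Ioi_zero ha one_pos, Real.one_rpow, div_one,
            mul_assoc (Real.Gamma _), ← Real.exp_add, mul_comm]
          ring_nf
  · refine setIntegral_nonneg measurableSet_Ici fun τ (hτ : ε ≤ τ) => ?_
    have hτ0 : 0 < τ := hε.trans_le hτ
    positivity

lemma isBigO_exp_neg_mul {ε : ℝ} (hε : 0 < ε) (K a : ℝ) :
    (fun n : ℝ => K * Real.exp (-ε * n)) =O[atTop] fun n : ℝ => n ^ a :=
  ((isLittleO_exp_neg_mul_rpow_atTop hε a).isBigO).const_mul_left K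

/-- Watson's lemma on a finite interval. -/
lemma watson {d : ℝ → ℝ} {ε C : ℝ} (hε : 0 < ε) {e : ℕ → ℝ} (he : ∀ k, 0 ≤ e k) (b : ℕ → ℝ) (N : ℕ)
    (hd : ∀ τ ∈ Ioo 0 ε, |d τ - ∑ k ∈ Finset.range N, b k * τ ^ e k| ≤ C * τ ^ e N)
    (hint : ∀ᶠ n : ℝ in atTop, IntegrableOn (fun τ => d τ * Real.exp (-n * τ)) (Ioo 0 ε)) :
    (fun n : ℝ => (∫ τ in Ioo 0 ε, d τ * Real.exp (-n * τ)) -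
      ∑ k ∈ Finset.range N, b k * Real.Gamma (e k + 1) / n ^ (e k + 1))
      =O[atTop] fun n : ℝ => n ^ (-(e N + 1)) := by
  have hterm : ∀ k, (fun n : ℝ => b k * ((∫ τ in Ioo 0 ε, τ ^ e k * Real.exp (-n * τ)) -
      Real.Gamma (e k + 1) / n ^ (e k + 1))) =O[atTop] fun n : ℝ => n ^ (-(e N + 1)) := by
    intro k
    refine IsBigO.const_mul_left (IsBigO.trans (IsBigO.of_bound 1 ?_) (isBigO_exp_neg_mul hε
      (Real.Gamma (e k + 1) * Real.exp ε) _)) _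
    filter_upwards [eventually_ge_atTop 1] with n hn
    rw [one_mul, Real.norm_eq_abs]
    exact (abs_integral_Ioo_rpow_mul_exp_sub_le (he k) hn hε).trans (le_abs_self _)
  have hrem : (fun n : ℝ => ∫ τ in Ioo 0 ε, (d τ - ∑ k ∈ Finset.range N, b k * τ ^ e k) *
      Real.exp (-n * τ)) =O[atTop] fun n : ℝ => n ^ (-(e N + 1)) := by
    have hC : 0 ≤ C := by
      have h1 := (abs_nonneg _).trans (hd (ε / 2) ⟨by linarith, by linarith⟩)
      exact nonneg_of_mul_nonneg_left h1 (by positivity)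
    refine IsBigO.of_bound (C * Real.Gamma (e N + 1)) ?_
    filter_upwards [eventually_gt_atTop 0] with n hn
    have hi := integrableOn_rpow_mul_exp_neg_mul_Ioi (he N) hn
    rw [Real.norm_of_nonneg (by positivity : 0 ≤ n ^ (-(e N + 1)))]
    calc _ ≤ ∫ τ in Ioo 0 ε, C * (τ ^ e N * Real.exp (-n * τ)) := by
          refine norm_integral_le_of_norm_le
            ((hi.mono_set fun x (hx : x ∈ Ioo 0 ε) => hx.1).const_mul C) ?_
          filter_upwards [ae_restrict_mem measurableSet_Ioo] with τ hτ
          rw [norm_mul, Real.norm_eq_abs, Real.norm_of_nonneg (Real.exp_pos _).le, ← mul_assoc]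
          exact mul_le_mul_of_nonneg_right (hd τ hτ) (Real.exp_pos _).le
      _ ≤ C * ∫ τ in Ioi 0, τ ^ e N * Real.exp (-n * τ) := by
          rw [integral_const_mul]
          refine mul_le_mul_of_nonneg_left (setIntegral_mono_set hi ?_
            (Eventually.of_forall fun x (hx : x ∈ Ioo 0 ε) => hx.1)) hC
          filter_upwards [ae_restrict_mem measurableSet_Ioi] with τ (hτ : 0 < τ)
          simp only [Pi.zero_apply]
          positivity
      _ = _ := by
          rw [integral_rpow_mul_exp_neg_mul_Ioi_zero (he N) hn, Real.rpow_neg hn.le]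
          ring
  refine ((IsBigO.sum fun k (_ : k ∈ Finset.range N) => hterm k).add hrem).congr' ?_
    EventuallyEq.rfl
  filter_upwards [hint, eventually_gt_atTop 0] with n hn hn0
  have hi : ∀ k ∈ Finset.range N, IntegrableOn (fun τ => b k * (τ ^ e k * Real.exp (-n * τ)))
      (Ioo 0 ε) := fun k _ => ((integrableOn_rpow_mul_exp_neg_mul_Ioi (he k) hn0).mono_set
        fun x (hx : x ∈ Ioo 0 ε) => hx.1).const_mul _
  have hsplit : ∫ τ in Ioo 0 ε, (d τ - ∑ k ∈ Finset.range N, b k * τ ^ e k) * Real.exp (-n * τ) =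
      (∫ τ in Ioo 0 ε, d τ * Real.exp (-n * τ)) -
        ∑ k ∈ Finset.range N, b k * ∫ τ in Ioo 0 ε, τ ^ e k * Real.exp (-n * τ) := by
    have h1 := integral_sub hn (integrable_finsetSum _ hi)
    rw [integral_finsetSum _ hi] at h1
    simp only [integral_const_mul] at h1
    rw [← h1]
    congr 1
    ext τ
    rw [sub_mul, Finset.sum_mul]
    simp only [mul_assoc]
  rw [hsplit]
  simp only [Finset.sum_apply, mul_sub, Finset.sum_sub_distrib, mul_div_assoc]
  ring

/-- The remainder of a convergent series of increasing real powers. -/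
lemma exists_abs_sub_sum_le {b e : ℕ → ℝ} (he : Monotone e) {ε s : ℝ} (hε : 0 < ε)
    (hs : HasSum (fun k => b k * ε ^ e k) s) (N : ℕ) :
    ∃ C, ∀ τ ∈ Ioo 0 ε, ∀ d, HasSum (fun k => b k * τ ^ e k) d →
      |d - ∑ k ∈ Finset.range N, b k * τ ^ e k| ≤ C * τ ^ e N := by
  have hsum := summable_abs_iff.2 ((summable_nat_add_iff N).2 hs.summable)
  refine ⟨(∑' k, |b (k + N) * ε ^ e (k + N)|) / ε ^ e N, fun τ hτ d hd => ?_⟩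
  have h1 := (hasSum_nat_add_iff' N).2 hd
  rw [← h1.tsum_eq, ← Real.norm_eq_abs]
  -- Since the exponents increase, τ < ε gives (τ/ε)^(e_(k+N)) ≤ (τ/ε)^(e_N), so absolute
  -- convergence at ε controls all smaller τ.
  have hle : ∀ k, ‖b (k + N) * τ ^ e (k + N)‖ ≤
      |b (k + N) * ε ^ e (k + N)| * (τ ^ e N / ε ^ e N) := fun k => by
    have hτ0 := hτ.1
    rw [Real.norm_eq_abs, abs_mul, abs_mul, abs_of_pos (Real.rpow_pos_of_pos hτ0 _),
      abs_of_pos (Real.rpow_pos_of_pos hε _), mul_assoc]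
    refine mul_le_mul_of_nonneg_left ?_ (abs_nonneg _)
    rw [mul_div_assoc', le_div_iff₀ (by positivity)]
    have h2 : e (k + N) = (e (k + N) - e N) + e N := by ring
    have h3 := Real.rpow_le_rpow hτ0.le hτ.2.le (sub_nonneg.2 (he (Nat.le_add_left N k)))
    rw [h2, Real.rpow_add hτ0, Real.rpow_add hε]
    calc τ ^ (e (k + N) - e N) * τ ^ e N * ε ^ e N
        ≤ ε ^ (e (k + N) - e N) * τ ^ e N * ε ^ e N := by gcongr
      _ = _ := by ring
  refine (tsum_of_norm_bounded ((hsum.mul_right _).hasSum) hle).trans_eq ?_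
  rw [tsum_mul_right]
  ring

lemma expo_nonneg (p q k : ℕ) : 0 ≤ expo p q k := by
  rw [expo]
  positivity

lemma monotone_expo {p q : ℕ} (hq : 0 < q) : Monotone (expo p q) := fun a b hab => by
  have : (expIndex p q a : ℝ) ≤ expIndex p q b := by
    exact_mod_cast (strictMono_expIndex hq).monotone hab
  rw [expo, expo]
  gcongr

/-- On (0, x₀) with ψ(x₀) = ε, the substitution τ = ψ(x) gives ∫₀^ε e^(-nτ) x'(τ) dτ, to which
Watson's lemma applies. On [x₀, ∞) the phase is at least ε and the contribution is exponentially
small. -/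
lemma calK_expansion {p q : ℕ} (hq : 0 < q) (hqp : q < 2 * p)
    (h : (p : ℝ) / q ∈ Ioo (0 : ℝ) 1 ∪ Ioo 1 2) (N : ℕ) :
    (fun n : ℝ => calK ((p : ℝ) / q) n -
      ∑ k ∈ Finset.range N, B p q k * Real.Gamma (expo p q k + 1) / n ^ (expo p q k + 1))
      =O[atTop] fun n : ℝ => n ^ (-(expo p q N + 1)) := by
  obtain ⟨δ, hδ, hX⟩ := hasDerivAt_invPhase hq hqp h
  have hν := half_lt_div hq hqp
  set ν : ℝ := (p : ℝ) / q with hνdef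
  choose! d hd hdsum using hX
  -- Halving δ leaves the series convergent at the endpoint ε itself, which the remainder bound
  -- requires.
  set ε := δ / 2 with hε
  have hε0 : 0 < ε := by positivity
  have hεδ : ε < δ := by linarith
  obtain ⟨C, hC⟩ := exists_abs_sub_sum_le (monotone_expo hq) hε0
    (hdsum ε ⟨hε0, hεδ⟩) N
  have hbij := bijOn_phase h hν
  have hmono := strictMonoOn_phase h hν
  have hinv : ∀ τ, 0 < τ → 0 < invPhase ν τ ∧ phase ν (invPhase ν τ) = τ := fun τ hτ => by
    obtain ⟨x, hx, rfl⟩ := hbij.surjOn hτ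
    rw [invPhase_phase h hν hx]
    exact ⟨hx, rfl⟩
  have hIoo : ∀ τ ∈ Ioo 0 ε, τ ∈ Ioo 0 δ := fun τ hτ => ⟨hτ.1, hτ.2.trans hεδ⟩
  have hdpos : ∀ τ ∈ Ioo 0 ε, 0 < d τ := by
    intro τ hτ
    obtain ⟨h1, h2⟩ := hinv τ hτ.1
    have hc := (hasDerivAt_phase h h1).comp τ (hd τ (hIoo τ hτ))
    have hid : HasDerivAt (phase ν ∘ invPhase ν) 1 τ := (hasDerivAt_id τ).congr_of_eventuallyEq (by
      filter_upwards [lt_mem_nhds hτ.1] with t ht using (hinv t ht).2)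
    exact pos_of_mul_pos_right (by rw [hc.unique hid]; exact one_pos) (deriv_phase_pos hν h1).le
  set x₀ := invPhase ν ε with hx₀
  obtain ⟨hx₀0, hx₀ε⟩ := hinv ε hε0
  have himage : invPhase ν '' Ioo 0 ε = Ioo 0 x₀ := by
    ext x
    constructor
    · rintro ⟨τ, hτ, rfl⟩
      obtain ⟨h1, h2⟩ := hinv τ hτ.1
      refine ⟨h1, (hmono.lt_iff_lt h1 hx₀0).1 ?_⟩
      rw [h2, hx₀ε]
      exact hτ.2
    · intro hx
      refine ⟨phase ν x, ⟨phase_pos h hν hx.1, ?_⟩, invPhase_phase h hν hx.1⟩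
      rw [← hx₀ε]
      exact hmono hx.1 hx₀0 hx.2
  have hderiv : ∀ τ ∈ Ioo 0 ε, HasDerivWithinAt (invPhase ν) (d τ) (Ioo 0 ε) τ := fun τ hτ =>
    (hd τ (hIoo τ hτ)).hasDerivWithinAt
  have hinj : InjOn (invPhase ν) (Ioo 0 ε) := fun a ha b hb hab => by
    rw [← (hinv a ha.1).2, hab, (hinv b hb.1).2]
  have hcongr : ∀ n : ℝ, EqOn (fun τ => |d τ| • bracket ν (invPhase ν τ) ^ (-n))
      (fun τ => d τ * Real.exp (-n * τ)) (Ioo 0 ε) := fun n τ hτ => by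
    obtain ⟨h1, h2⟩ := hinv τ hτ.1
    simp only [smul_eq_mul]
    rw [abs_of_pos (hdpos τ hτ), bracket_rpow_neg h h1, h2]
  have hint : ∀ᶠ n : ℝ in atTop, IntegrableOn (fun x => bracket ν x ^ (-n)) (Ioi 0) := by
    have hlim : Tendsto (fun n : ℝ => n * (ν - 1 / 2)) atTop atTop :=
      tendsto_id.atTop_mul_const (by linarith)
    filter_upwards [hlim.eventually_gt_atTop 1] with n hn
    exact integrableOn_bracket_rpow h hν hn
  -- Integrability of x'(τ) e^(-nτ) is inherited from that of `bracket` ^ (-n) through the change of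
  -- variables.
  have hW := watson hε0 (fun k => expo_nonneg p q k) (B p q) N
    (fun τ hτ => hC τ hτ (d τ) (hdsum τ (hIoo τ hτ))) (by
      filter_upwards [hint] with n hn
      have h1 := (integrableOn_image_iff_integrableOn_abs_deriv_smul measurableSet_Ioo hderiv hinj
        (fun x => bracket ν x ^ (-n))).1 (by
          rw [himage]
          exact hn.mono_set fun x hx => hx.1)
      exact h1.congr_fun (hcongr n) measurableSet_Ioo)
  obtain ⟨n₀, hn₀⟩ := hint.exists
  -- Compared with one fixed convergent exponent n₀, the integrand gains a factor e^(-(n-n₀)ψ) ≤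
  -- e^(-(n-n₀)ε).
  have htail : (fun n : ℝ => ∫ x in Ici x₀, bracket ν x ^ (-n)) =O[atTop]
      fun n : ℝ => n ^ (-(expo p q N + 1)) := by
    have hsub : Ici x₀ ⊆ Ioi 0 := fun x hx => hx₀0.trans_le hx
    refine IsBigO.trans (IsBigO.of_bound 1 ?_) (isBigO_exp_neg_mul hε0
      (Real.exp (n₀ * ε) * ∫ x in Ici x₀, bracket ν x ^ (-n₀)) _)
    filter_upwards [hint, eventually_ge_atTop n₀] with n hn hnn
    rw [one_mul]
    have hnn0 : 0 ≤ ∫ x in Ici x₀, bracket ν x ^ (-n) :=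
      setIntegral_nonneg measurableSet_Ici fun x hx => by
        rw [bracket_rpow_neg h (hsub hx)]
        exact (Real.exp_pos _).le
    rw [Real.norm_of_nonneg hnn0]
    refine le_trans ?_ (le_abs_self _)
    calc ∫ x in Ici x₀, bracket ν x ^ (-n)
        ≤ ∫ x in Ici x₀, Real.exp (-(n - n₀) * ε) * bracket ν x ^ (-n₀) := by
          refine setIntegral_mono_on (hn.mono_set hsub) ((hn₀.mono_set hsub).const_mul _)
            measurableSet_Ici fun x hx => ?_
          have hle : ε ≤ phase ν x := by
            rw [← hx₀ε]
            exact (hmono.le_iff_le hx₀0 (hsub hx)).2 hx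
          rw [bracket_rpow_neg h (hsub hx), bracket_rpow_neg h (hsub hx), ← Real.exp_add,
            Real.exp_le_exp]
          nlinarith
      _ = _ := by
          rw [integral_const_mul, mul_right_comm, ← Real.exp_add]
          congr 2
          ring
  refine (hW.add htail).congr' ?_ EventuallyEq.rfl
  filter_upwards [hint] with n hn
  have hsplit : calK ν n = (∫ x in Ioo 0 x₀, bracket ν x ^ (-n)) +
      ∫ x in Ici x₀, bracket ν x ^ (-n) := by
    have hdisj : Disjoint (Ioo 0 x₀) (Ici x₀) := disjoint_left.2 fun x hx hx' =>
      absurd hx.2 (not_lt.2 hx')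
    rw [calK, ← Ioo_union_Ici_eq_Ioi hx₀0]
    exact setIntegral_union hdisj measurableSet_Ici (hn.mono_set fun x hx => hx.1)
      (hn.mono_set fun x hx => hx₀0.trans_le hx)
  have hchange := integral_image_eq_integral_abs_deriv_smul measurableSet_Ioo hderiv hinj
    (fun x => bracket ν x ^ (-n))
  rw [himage, setIntegral_congr_fun measurableSet_Ioo (hcongr n)] at hchange
  rw [hsplit, hchange]
  ring

/-! ### Rational enclosures of Gamma quotients -/

/-- Euler's limit for both Gamma values. The D-th power makes the exponent D(s₁ - s₂) an integer, so
all approximants are rational when the parameters are. -/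
lemma tendsto_pow_mul_prod {s₁ s₂ : ℝ} (h₁ : 0 < s₁) (h₂ : 0 < s₂) {e D : ℕ}
    (he : D * (s₁ - s₂) = e) :
    Tendsto (fun n : ℕ => (n : ℝ) ^ e * ∏ j ∈ Finset.range (n + 1), ((s₂ + j) / (s₁ + j)) ^ D)
      atTop (𝓝 ((Real.Gamma s₁ / Real.Gamma s₂) ^ D)) := by
  have h := ((Real.GammaSeq_tendsto_Gamma s₁).div (Real.GammaSeq_tendsto_Gamma s₂)
    (Real.Gamma_pos_of_pos h₂).ne').pow D
  refine h.congr' ?_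
  filter_upwards [eventually_gt_atTop 0] with n hn
  have hn0 : (0 : ℝ) < n := by exact_mod_cast hn
  have p₁ : ∏ j ∈ Finset.range (n + 1), (s₁ + j) ≠ 0 :=
    Finset.prod_ne_zero_iff.2 fun j _ => by positivity
  have p₂ : ∏ j ∈ Finset.range (n + 1), (s₂ + j) ≠ 0 :=
    Finset.prod_ne_zero_iff.2 fun j _ => by positivity
  rw [Finset.prod_pow, Finset.prod_div_distrib, ← Real.rpow_natCast _ e, ← he, mul_comm (D : ℝ),
    Real.rpow_mul hn0.le, Real.rpow_natCast, ← mul_pow, Real.rpow_sub hn0]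
  simp only [Pi.div_apply, Real.GammaSeq]
  field_simp

lemma tendsto_corrected_prod {s₁ s₂ : ℝ} (h₁ : 0 < s₁) (h₂ : 0 < s₂) {e D : ℕ}
    (he : D * (s₁ - s₂) = e) {r : ℝ → ℝ} (hr : Tendsto r atTop (𝓝 1)) :
    Tendsto (fun n : ℕ => (n : ℝ) ^ e * r n * ∏ j ∈ Finset.range n, ((s₂ + j) / (s₁ + j)) ^ D)
      atTop (𝓝 ((Real.Gamma s₁ / Real.Gamma s₂) ^ D)) := by
  rw [← tendsto_add_atTop_iff_nat 1]
  have h1 : Tendsto (fun n : ℕ => (1 + 1 / (n : ℝ)) ^ e * r ((n + 1 : ℕ) : ℝ)) atTop (𝓝 1) := by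
    have h2 := ((tendsto_const_div_atTop_nhds_zero_nat (1 : ℝ)).const_add 1).pow e
    have h3 := h2.mul (hr.comp (tendsto_natCast_atTop_atTop.comp (tendsto_add_atTop_nat 1)))
    simpa using h3
  have h2 := (tendsto_pow_mul_prod h₁ h₂ he).mul h1
  rw [mul_one] at h2
  refine h2.congr' ?_
  filter_upwards [eventually_gt_atTop 0] with n hn
  have hn0 : (0 : ℝ) < n := by exact_mod_cast hn
  have h4 : ((n + 1 : ℕ) : ℝ) = n * (1 + 1 / n) := by
    push_cast
    field_simp
  rw [h4, mul_pow]
  ring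

/-- A correction factor r → 1 leaves the limit unchanged. If the corrected sequence decreases, each
term bounds the limit from above; `hstep` is that decrease with denominators cleared. -/
lemma Gamma_ratio_pow_le {s₁ s₂ : ℝ} (h₁ : 0 < s₁) (h₂ : 0 < s₂) {e D : ℕ}
    (he : D * (s₁ - s₂) = e) {r : ℝ → ℝ} (hr : Tendsto r atTop (𝓝 1))
    {n : ℕ} (hn : 0 < n)
    (hstep : ∀ x : ℝ, 0 < x → (x + 1) ^ e * r (x + 1) * (s₂ + x) ^ D ≤ x ^ e * r x * (s₁ + x) ^ D) :
    (Real.Gamma s₁ / Real.Gamma s₂) ^ D ≤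
      (n : ℝ) ^ e * r n * ∏ j ∈ Finset.range n, ((s₂ + j) / (s₁ + j)) ^ D := by
  set F : ℕ → ℝ := fun n => (n : ℝ) ^ e * r n * ∏ j ∈ Finset.range n, ((s₂ + j) / (s₁ + j)) ^ D
    with hF
  have hanti : Antitone fun k => F (k + n) := antitone_nat_of_succ_le fun k => by
    have hk : (0 : ℝ) < ((k + n : ℕ) : ℝ) := by exact_mod_cast (by omega : 0 < k + n)
    have h := hstep _ hk
    rw [show k + 1 + n = k + n + 1 by ring]
    simp only [hF]
    rw [Finset.prod_range_succ, div_pow, Nat.cast_succ]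
    have hP : 0 ≤ ∏ j ∈ Finset.range (k + n), ((s₂ + j) / (s₁ + j)) ^ D :=
      Finset.prod_nonneg fun j _ => by positivity
    have h3 : 0 < (s₁ + ((k + n : ℕ) : ℝ)) ^ D := by positivity
    calc _ = ((((k + n : ℕ) : ℝ) + 1) ^ e * r (((k + n : ℕ) : ℝ) + 1) *
          (s₂ + ((k + n : ℕ) : ℝ)) ^ D) / (s₁ + ((k + n : ℕ) : ℝ)) ^ D *
          ∏ j ∈ Finset.range (k + n), ((s₂ + j) / (s₁ + j)) ^ D := by ring
      _ ≤ _ := mul_le_mul_of_nonneg_right ((div_le_iff₀ h3).2 h) hP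
  have h := hanti.le_of_tendsto ((tendsto_corrected_prod h₁ h₂ he hr).comp (tendsto_add_atTop_nat n)) 0
  simpa using h

lemma le_Gamma_ratio_pow {s₁ s₂ : ℝ} (h₁ : 0 < s₁) (h₂ : 0 < s₂) {e D : ℕ}
    (he : D * (s₁ - s₂) = e) {r : ℝ → ℝ} (hr : Tendsto r atTop (𝓝 1))
    {n : ℕ} (hn : 0 < n)
    (hstep : ∀ x : ℝ, 0 < x → x ^ e * r x * (s₁ + x) ^ D ≤ (x + 1) ^ e * r (x + 1) * (s₂ + x) ^ D) :
    (n : ℝ) ^ e * r n * ∏ j ∈ Finset.range n, ((s₂ + j) / (s₁ + j)) ^ D ≤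
      (Real.Gamma s₁ / Real.Gamma s₂) ^ D := by
  set F : ℕ → ℝ := fun n => (n : ℝ) ^ e * r n * ∏ j ∈ Finset.range n, ((s₂ + j) / (s₁ + j)) ^ D
    with hF
  have hmono : Monotone fun k => F (k + n) := monotone_nat_of_le_succ fun k => by
    have hk : (0 : ℝ) < ((k + n : ℕ) : ℝ) := by exact_mod_cast (by omega : 0 < k + n)
    have h := hstep _ hk
    rw [show k + 1 + n = k + n + 1 by ring]
    simp only [hF]
    rw [Finset.prod_range_succ, div_pow, Nat.cast_succ]
    have hP : 0 ≤ ∏ j ∈ Finset.range (k + n), ((s₂ + j) / (s₁ + j)) ^ D :=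
      Finset.prod_nonneg fun j _ => by positivity
    have h3 : 0 < (s₁ + ((k + n : ℕ) : ℝ)) ^ D := by positivity
    calc _ ≤ ((((k + n : ℕ) : ℝ) + 1) ^ e * r (((k + n : ℕ) : ℝ) + 1) *
          (s₂ + ((k + n : ℕ) : ℝ)) ^ D) / (s₁ + ((k + n : ℕ) : ℝ)) ^ D *
          ∏ j ∈ Finset.range (k + n), ((s₂ + j) / (s₁ + j)) ^ D :=
          mul_le_mul_of_nonneg_right ((le_div_iff₀ h3).2 h) hP
      _ = _ := by ring
  have h := hmono.ge_of_tendsto ((tendsto_corrected_prod h₁ h₂ he hr).comp (tendsto_add_atTop_nat n)) 0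
  simpa using h

/-- The correction is the asymptotic series of (Γ(x+2/3)/Γ(x+1/3))³/x truncated after x^(-8); it is
even in x because 2/3 + 1/3 = 1. Consecutive truncations err on opposite sides, so this one makes
the sequence increase, while one more term makes it decrease. The difference is a quotient with
positive coefficients. -/
lemma gammaRatio_third_step_ge {x : ℝ} (hx : 0 < x) :
    x ^ 1 * (1 + 1 / 27 / x ^ 2 - 4 / 729 / x ^ 4 + 176 / 59049 / x ^ 6 - 5248 / 1594323 / x ^ 8) * (2 / 3 + x) ^ 3 ≤
      (x + 1) ^ 1 * (1 + 1 / 27 / (x + 1) ^ 2 - 4 / 729 / (x + 1) ^ 4 + 176 / 59049 / (x + 1) ^ 6 - 5248 / 1594323 / (x + 1) ^ 8) * (1 / 3 + x) ^ 3 := by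
  rw [← sub_nonneg]
  have h : (x + 1) ^ 1 * (1 + 1 / 27 / (x + 1) ^ 2 - 4 / 729 / (x + 1) ^ 4 + 176 / 59049 / (x + 1) ^ 6 - 5248 / 1594323 / (x + 1) ^ 8) * (1 / 3 + x) ^ 3 -
      x ^ 1 * (1 + 1 / 27 / x ^ 2 - 4 / 729 / x ^ 4 + 176 / 59049 / x ^ 6 - 5248 / 1594323 / x ^ 8) * (2 / 3 + x) ^ 3 =
      (41984 + 482816 * x ^ 1 + 2449536 * x ^ 2 + 7125184 * x ^ 3 + 12842560 * x ^ 4 + 14345664 * x ^ 5 + 9208640 * x ^ 6 + 2631040 * x ^ 7) /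
        (43046721 * x ^ 7 * (x + 1) ^ 7) := by
    field_simp
    ring
  rw [h]
  positivity

lemma gammaRatio_third_step_le {x : ℝ} (hx : 0 < x) :
    (x + 1) ^ 1 * (1 + 1 / 27 / (x + 1) ^ 2 - 4 / 729 / (x + 1) ^ 4 + 176 / 59049 / (x + 1) ^ 6 - 5248 / 1594323 / (x + 1) ^ 8 + 263104 / 43046721 / (x + 1) ^ 10) * (1 / 3 + x) ^ 3 ≤
      x ^ 1 * (1 + 1 / 27 / x ^ 2 - 4 / 729 / x ^ 4 + 176 / 59049 / x ^ 6 - 5248 / 1594323 / x ^ 8 + 263104 / 43046721 / x ^ 10) * (2 / 3 + x) ^ 3 := by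
  rw [← sub_nonneg]
  have h : x ^ 1 * (1 + 1 / 27 / x ^ 2 - 4 / 729 / x ^ 4 + 176 / 59049 / x ^ 6 - 5248 / 1594323 / x ^ 8 + 263104 / 43046721 / x ^ 10) * (2 / 3 + x) ^ 3 -
      (x + 1) ^ 1 * (1 + 1 / 27 / (x + 1) ^ 2 - 4 / 729 / (x + 1) ^ 4 + 176 / 59049 / (x + 1) ^ 6 - 5248 / 1594323 / (x + 1) ^ 8 + 263104 / 43046721 / (x + 1) ^ 10) * (1 / 3 + x) ^ 3 =
      (2104832 + 28415232 * x ^ 1 + 174093696 * x ^ 2 + 637457856 * x ^ 3 + 1542900672 * x ^ 4 + 2570134464 * x ^ 5 + 2959478592 * x ^ 6 + 2283428736 * x ^ 7 + 1078397568 * x ^ 8 + 239643904 * x ^ 9) /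
        (1162261467 * x ^ 9 * (x + 1) ^ 9) := by
    field_simp
    ring
  rw [h]
  positivity

/-- The analogous truncation for (Γ(x+4/5)/Γ(x+1/5))⁵/x³. -/
lemma gammaRatio_fifth_step_ge {x : ℝ} (hx : 0 < x) :
    x ^ 3 * (1 + 2 / 25 / x ^ 2 - 27 / 3125 / x ^ 4 + 396 / 78125 / x ^ 6 - 56448 / 9765625 / x ^ 8) * (4 / 5 + x) ^ 5 ≤
      (x + 1) ^ 3 * (1 + 2 / 25 / (x + 1) ^ 2 - 27 / 3125 / (x + 1) ^ 4 + 396 / 78125 / (x + 1) ^ 6 - 56448 / 9765625 / (x + 1) ^ 8) * (1 / 5 + x) ^ 5 := by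
  rw [← sub_nonneg]
  have h : (x + 1) ^ 3 * (1 + 2 / 25 / (x + 1) ^ 2 - 27 / 3125 / (x + 1) ^ 4 + 396 / 78125 / (x + 1) ^ 6 - 56448 / 9765625 / (x + 1) ^ 8) * (1 / 5 + x) ^ 5 -
      x ^ 3 * (1 + 2 / 25 / x ^ 2 - 27 / 3125 / x ^ 4 + 396 / 78125 / x ^ 6 - 56448 / 9765625 / x ^ 8) * (4 / 5 + x) ^ 5 =
      (57802752 + 650280960 * x ^ 1 + 3236843520 * x ^ 2 + 9265259520 * x ^ 3 + 16487285760 * x ^ 4 + 18247394304 * x ^ 5 + 11652480000 * x ^ 6 + 3329280000 * x ^ 7) /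
        (30517578125 * x ^ 5 * (x + 1) ^ 5) := by
    field_simp
    ring
  rw [h]
  positivity

lemma gammaRatio_fifth_step_le {x : ℝ} (hx : 0 < x) :
    (x + 1) ^ 3 * (1 + 2 / 25 / (x + 1) ^ 2 - 27 / 3125 / (x + 1) ^ 4 + 396 / 78125 / (x + 1) ^ 6 - 56448 / 9765625 / (x + 1) ^ 8 + 2663424 / 244140625 / (x + 1) ^ 10) * (1 / 5 + x) ^ 5 ≤
      x ^ 3 * (1 + 2 / 25 / x ^ 2 - 27 / 3125 / x ^ 4 + 396 / 78125 / x ^ 6 - 56448 / 9765625 / x ^ 8 + 2663424 / 244140625 / x ^ 10) * (4 / 5 + x) ^ 5 := by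
  rw [← sub_nonneg]
  have h : x ^ 3 * (1 + 2 / 25 / x ^ 2 - 27 / 3125 / x ^ 4 + 396 / 78125 / x ^ 6 - 56448 / 9765625 / x ^ 8 + 2663424 / 244140625 / x ^ 10) * (4 / 5 + x) ^ 5 -
      (x + 1) ^ 3 * (1 + 2 / 25 / (x + 1) ^ 2 - 27 / 3125 / (x + 1) ^ 4 + 396 / 78125 / (x + 1) ^ 6 - 56448 / 9765625 / (x + 1) ^ 8 + 2663424 / 244140625 / (x + 1) ^ 10) * (1 / 5 + x) ^ 5 =
      (2727346176 + 36137336832 * x ^ 1 + 217765380096 * x ^ 2 + 785846108160 * x ^ 3 + 1878266511360 * x ^ 4 + 3095678877696 * x ^ 5 + 3534014840832 * x ^ 6 + 2709207908352 * x ^ 7 + 1274617036800 * x ^ 8 + 283248230400 * x ^ 9) /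
        (762939453125 * x ^ 7 * (x + 1) ^ 7) := by
    field_simp
    ring
  rw [h]
  positivity

lemma tendsto_const_div_pow_atTop_zero (c : ℝ) {k : ℕ} (hk : k ≠ 0) :
    Tendsto (fun x : ℝ => c / x ^ k) atTop (𝓝 0) :=
  tendsto_const_nhds.div_atTop (tendsto_pow_atTop hk)

lemma Gamma_ratio_third_ge :
    (0.1291460795949618067 : ℝ) ≤ (Real.Gamma (2 / 3) / Real.Gamma (1 / 3)) ^ 3 := by
  have t := fun (c : ℝ) (k : ℕ) (hk : k ≠ 0) => tendsto_const_div_pow_atTop_zero c hk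
  have hr : Tendsto (fun x : ℝ => 1 + 1 / 27 / x ^ 2 - 4 / 729 / x ^ 4 + 176 / 59049 / x ^ 6 -
      5248 / 1594323 / x ^ 8) atTop (𝓝 1) := by
    simpa using ((((tendsto_const_nhds (x := (1 : ℝ))).add (t (1 / 27) 2 (by norm_num))).sub
      (t (4 / 729) 4 (by norm_num))).add (t (176 / 59049) 6 (by norm_num))).sub
      (t (5248 / 1594323) 8 (by norm_num))
  have h := le_Gamma_ratio_pow (s₁ := 2 / 3) (s₂ := 1 / 3) (by norm_num) (by norm_num) (e := 1)
    (D := 3) (by norm_num) hr (n := 40) (by norm_num) fun x hx => gammaRatio_third_step_ge hx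
  refine le_trans ?_ h
  norm_num [Finset.prod_range_succ]

lemma Gamma_ratio_third_le :
    (Real.Gamma (2 / 3) / Real.Gamma (1 / 3)) ^ 3 ≤ (0.1291460795949618069 : ℝ) := by
  have t := fun (c : ℝ) (k : ℕ) (hk : k ≠ 0) => tendsto_const_div_pow_atTop_zero c hk
  have hr : Tendsto (fun x : ℝ => 1 + 1 / 27 / x ^ 2 - 4 / 729 / x ^ 4 + 176 / 59049 / x ^ 6 -
      5248 / 1594323 / x ^ 8 + 263104 / 43046721 / x ^ 10) atTop (𝓝 1) := by
    simpa using (((((tendsto_const_nhds (x := (1 : ℝ))).add (t (1 / 27) 2 (by norm_num))).sub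
      (t (4 / 729) 4 (by norm_num))).add (t (176 / 59049) 6 (by norm_num))).sub
      (t (5248 / 1594323) 8 (by norm_num))).add (t (263104 / 43046721) 10 (by norm_num))
  have h := Gamma_ratio_pow_le (s₁ := 2 / 3) (s₂ := 1 / 3) (by norm_num) (by norm_num) (e := 1)
    (D := 3) (by norm_num) hr (n := 40) (by norm_num) fun x hx => gammaRatio_third_step_le hx
  refine h.trans ?_
  norm_num [Finset.prod_range_succ]

lemma Gamma_ratio_fifth_ge :
    (0.0010488921991939609 : ℝ) ≤ (Real.Gamma (4 / 5) / Real.Gamma (1 / 5)) ^ 5 := by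
  have t := fun (c : ℝ) (k : ℕ) (hk : k ≠ 0) => tendsto_const_div_pow_atTop_zero c hk
  have hr : Tendsto (fun x : ℝ => 1 + 2 / 25 / x ^ 2 - 27 / 3125 / x ^ 4 + 396 / 78125 / x ^ 6 -
      56448 / 9765625 / x ^ 8) atTop (𝓝 1) := by
    simpa using ((((tendsto_const_nhds (x := (1 : ℝ))).add (t (2 / 25) 2 (by norm_num))).sub
      (t (27 / 3125) 4 (by norm_num))).add (t (396 / 78125) 6 (by norm_num))).sub
      (t (56448 / 9765625) 8 (by norm_num))
  have h := le_Gamma_ratio_pow (s₁ := 4 / 5) (s₂ := 1 / 5) (by norm_num) (by norm_num) (e := 3)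
    (D := 5) (by norm_num) hr (n := 20) (by norm_num) fun x hx => gammaRatio_fifth_step_ge hx
  refine le_trans ?_ h
  norm_num [Finset.prod_range_succ]

lemma Gamma_ratio_fifth_le :
    (Real.Gamma (4 / 5) / Real.Gamma (1 / 5)) ^ 5 ≤ (0.0010488921991939621 : ℝ) := by
  have t := fun (c : ℝ) (k : ℕ) (hk : k ≠ 0) => tendsto_const_div_pow_atTop_zero c hk
  have hr : Tendsto (fun x : ℝ => 1 + 2 / 25 / x ^ 2 - 27 / 3125 / x ^ 4 + 396 / 78125 / x ^ 6 -
      56448 / 9765625 / x ^ 8 + 2663424 / 244140625 / x ^ 10) atTop (𝓝 1) := by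
    simpa using (((((tendsto_const_nhds (x := (1 : ℝ))).add (t (2 / 25) 2 (by norm_num))).sub
      (t (27 / 3125) 4 (by norm_num))).add (t (396 / 78125) 6 (by norm_num))).sub
      (t (56448 / 9765625) 8 (by norm_num))).add (t (2663424 / 244140625) 10 (by norm_num))
  have h := Gamma_ratio_pow_le (s₁ := 4 / 5) (s₂ := 1 / 5) (by norm_num) (by norm_num) (e := 3)
    (D := 5) (by norm_num) hr (n := 20) (by norm_num) fun x hx => gammaRatio_fifth_step_le hx
  refine h.trans ?_
  norm_num [Finset.prod_range_succ]

/-! ### The coefficient of the first non-analytic power -/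

/-- The coefficient of `x^(2ν)` in the generalized series of `(2/Γ(ν)) (x/2)^ν K_ν(x)`. -/
def nonanalyticCoeff (p q : ℕ) : ℝ :=
  (1 / 2 : ℝ) ^ (2 * ((p : ℝ) / q)) * (Real.Gamma (-((p : ℝ) / q)) / Real.Gamma ((p : ℝ) / q))

lemma Gamma_eq_div {s : ℝ} (hs : s ≠ 0) : Real.Gamma s = Real.Gamma (s + 1) / s := by
  rw [Real.Gamma_add_one hs]
  field_simp

lemma half_rpow_pow {a : ℝ} {D N : ℕ} (h : a * D = N) : ((1 / 2 : ℝ) ^ a) ^ D = (1 / 2) ^ N := by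
  rw [← Real.rpow_natCast, ← Real.rpow_mul (by norm_num), h, Real.rpow_natCast]

lemma nonanalyticCoeff_two_three :
    1.17767156510235101 ≤ -nonanalyticCoeff 2 3 ∧ -nonanalyticCoeff 2 3 ≤ 1.17767156510235104 := by
  have h1 := Gamma_ratio_third_ge
  have h2 := Gamma_ratio_third_le
  have g1 : 0 < Real.Gamma (1 / 3) := Real.Gamma_pos_of_pos (by norm_num)
  have g2 : 0 < Real.Gamma (2 / 3) := Real.Gamma_pos_of_pos (by norm_num)
  have e : -nonanalyticCoeff 2 3 =
      (1 / 2 : ℝ) ^ (4 / 3 : ℝ) * (3 / 2) / (Real.Gamma (2 / 3) / Real.Gamma (1 / 3)) := by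
    rw [nonanalyticCoeff, Nat.cast_ofNat, Nat.cast_ofNat, Gamma_eq_div (s := -(2 / 3)) (by norm_num)]
    norm_num
    field_simp
  -- Cubing removes the fractional power of 2 and leaves only the enclosed cube of the ratio. Here
  -- it stands in the denominator, so its upper bound yields the lower bound, and conversely.
  have e3 : (-nonanalyticCoeff 2 3) ^ 3 =
      27 / 128 / (Real.Gamma (2 / 3) / Real.Gamma (1 / 3)) ^ 3 := by
    rw [e, div_pow, mul_pow, half_rpow_pow (N := 4) (by norm_num)]
    norm_num
  have hpos : 0 ≤ -nonanalyticCoeff 2 3 := by rw [e]; positivity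
  constructor
  · refine le_of_pow_le_pow_left₀ three_ne_zero hpos ?_
    rw [e3, le_div_iff₀ (by positivity)]
    refine (mul_le_mul_of_nonneg_left h2 (by positivity)).trans ?_
    norm_num
  · refine le_of_pow_le_pow_left₀ three_ne_zero (by norm_num) ?_
    rw [e3, div_le_iff₀ (by positivity)]
    refine le_trans ?_ (mul_le_mul_of_nonneg_left h1 (by positivity))
    norm_num

lemma nonanalyticCoeff_four_three :
    0.53734208989329082 ≤ nonanalyticCoeff 4 3 ∧ nonanalyticCoeff 4 3 ≤ 0.53734208989329083 := by
  have h1 := Gamma_ratio_third_ge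
  have h2 := Gamma_ratio_third_le
  have g1 : 0 < Real.Gamma (1 / 3) := Real.Gamma_pos_of_pos (by norm_num)
  have g2 : 0 < Real.Gamma (2 / 3) := Real.Gamma_pos_of_pos (by norm_num)
  have e : nonanalyticCoeff 4 3 =
      (1 / 2 : ℝ) ^ (8 / 3 : ℝ) * (27 / 4) * (Real.Gamma (2 / 3) / Real.Gamma (1 / 3)) := by
    have a1 : Real.Gamma (-(4 / 3)) = 9 / 4 * Real.Gamma (2 / 3) := by
      rw [Gamma_eq_div (by norm_num), Gamma_eq_div (by norm_num)]
      norm_num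
      ring
    have a2 : Real.Gamma (4 / 3) = Real.Gamma (1 / 3) / 3 := by
      rw [show (4 / 3 : ℝ) = 1 / 3 + 1 by norm_num, Real.Gamma_add_one (by norm_num)]
      ring
    rw [nonanalyticCoeff, Nat.cast_ofNat, Nat.cast_ofNat, a1, a2]
    norm_num
    field_simp
    norm_num
  have e3 : nonanalyticCoeff 4 3 ^ 3 =
      (27 / 4) ^ 3 / 256 * (Real.Gamma (2 / 3) / Real.Gamma (1 / 3)) ^ 3 := by
    rw [e, mul_pow, mul_pow, half_rpow_pow (N := 8) (by norm_num)]
    norm_num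
  have hpos : 0 ≤ nonanalyticCoeff 4 3 := by rw [e]; positivity
  constructor
  · refine le_of_pow_le_pow_left₀ three_ne_zero hpos ?_
    rw [e3]
    refine le_trans ?_ (mul_le_mul_of_nonneg_left h1 (by positivity))
    norm_num
  · refine le_of_pow_le_pow_left₀ three_ne_zero (by norm_num) ?_
    rw [e3]
    refine (mul_le_mul_of_nonneg_left h2 (by positivity)).trans ?_
    norm_num

lemma nonanalyticCoeff_six_five :
    1.000997387760121 ≤ nonanalyticCoeff 6 5 ∧ nonanalyticCoeff 6 5 ≤ 1.000997387760122 := by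
  have h1 := Gamma_ratio_fifth_ge
  have h2 := Gamma_ratio_fifth_le
  have g1 : 0 < Real.Gamma (1 / 5) := Real.Gamma_pos_of_pos (by norm_num)
  have g2 : 0 < Real.Gamma (4 / 5) := Real.Gamma_pos_of_pos (by norm_num)
  have e : nonanalyticCoeff 6 5 =
      (1 / 2 : ℝ) ^ (12 / 5 : ℝ) * (125 / 6) * (Real.Gamma (4 / 5) / Real.Gamma (1 / 5)) := by
    have a1 : Real.Gamma (-(6 / 5)) = 25 / 6 * Real.Gamma (4 / 5) := by
      rw [Gamma_eq_div (by norm_num), Gamma_eq_div (by norm_num)]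
      norm_num
      ring
    have a2 : Real.Gamma (6 / 5) = Real.Gamma (1 / 5) / 5 := by
      rw [show (6 / 5 : ℝ) = 1 / 5 + 1 by norm_num, Real.Gamma_add_one (by norm_num)]
      ring
    rw [nonanalyticCoeff, Nat.cast_ofNat, Nat.cast_ofNat, a1, a2]
    norm_num
    field_simp
    norm_num
  have e3 : nonanalyticCoeff 6 5 ^ 5 =
      (125 / 6) ^ 5 / 4096 * (Real.Gamma (4 / 5) / Real.Gamma (1 / 5)) ^ 5 := by
    rw [e, mul_pow, mul_pow, half_rpow_pow (N := 12) (by norm_num)]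
    norm_num
  have hpos : 0 ≤ nonanalyticCoeff 6 5 := by rw [e]; positivity
  constructor
  · refine le_of_pow_le_pow_left₀ (n := 5) (by norm_num) hpos ?_
    rw [e3]
    refine le_trans ?_ (mul_le_mul_of_nonneg_left h1 (by positivity))
    norm_num
  · refine le_of_pow_le_pow_left₀ (n := 5) (by norm_num) (by norm_num) ?_
    rw [e3]
    refine (mul_le_mul_of_nonneg_left h2 (by positivity)).trans ?_
    norm_num

/-! ### Explicit coefficients -/

section

open PowerSeries

/-- Here v n j is the j-th coefficient of H^(-n). Only its initial value, support and recurrence are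
kept, so that the first coefficients become finite computations. -/
lemma exists_coeff_recurrence {p q : ℕ} (hq : 0 < q) (hqp : q < 2 * p)
    (h : (p : ℝ) / q ∈ Ioo (0 : ℝ) 1 ∪ Ioo 1 2) :
    ∃ v : ℕ → ℕ → ℝ, (∀ n, v n 0 = 1) ∧
      (∀ n j, (¬ ∃ a b : ℕ, j = a * q + b * (2 * p - q)) → v n j = 0) ∧
      (∀ n j, ∑ a ∈ Finset.range (j + 1), ((q : ℝ) * (j - a : ℕ) + n * a) *
        (coeff (a + q) (phaseSeries p q) * v n (j - a)) = 0) ∧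
      ∀ m, derivCoeff p q m = v (m + q) m := by
  obtain ⟨H, hH0, hHq, hd⟩ := exists_derivCoeff_eq hq hqp h
  refine ⟨fun n j => coeff j (H⁻¹ ^ n), fun n => ?_, fun n j hj => ?_, fun n j => ?_, hd⟩
  · simp [hH0]
  · by_contra hne
    obtain ⟨a, b, hab⟩ := (AddSubmonoid.mem_closure_pair _ _ _).1 (coeff_inv_pow_mem hH0 hq _
      (fun m hm => coeff_phaseSeries_mem hq hqp m (by rwa [← hHq])) n j hne)
    exact hj ⟨a, b, by simpa using hab.symm⟩
  · have := sum_coeff_pow_mul_coeff_inv_pow hH0 hq n j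
    rw [Finset.Nat.sum_antidiagonal_eq_sum_range_succ_mk] at this
    simpa only [hHq] using this

lemma coeff_logOf_recurrence {p : ℕ} (hp : 0 < p) (q j : ℕ) :
    ∑ a ∈ Finset.range (j + 1), (a : ℝ) *
      (coeff a (logOf (bracketSeries p q)) * coeff (j - a) (bracketSeries p q)) =
      j * coeff j (bracketSeries p q) := by
  have := sum_coeff_logOf_mul_coeff (constantCoeff_bracketSeries (q := q) hp) j
  rwa [Finset.Nat.sum_antidiagonal_eq_sum_range_succ_mk] at this

lemma coeff_phaseSeries (p q m : ℕ) :
    coeff m (phaseSeries p q) = (if m = q then 1 else 0) + coeff m (logOf (bracketSeries p q)) := by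
  rw [phaseSeries, map_add, coeff_X_pow]

lemma coeff_logOf_bracketSeries_eq_zero {p q j : ℕ} (hp : 0 < p)
    (hj : ¬ ∃ a b : ℕ, j = a * (2 * q) + b * (2 * p)) :
    coeff j (logOf (bracketSeries p q)) = 0 := by
  by_contra hne
  obtain ⟨a, b, hab⟩ := (AddSubmonoid.mem_closure_pair _ _ _).1
    (coeff_logOf_mem (constantCoeff_bracketSeries hp) _ coeff_bracketSeries_mem _ hne)
  exact hj ⟨a, b, by simpa using hab.symm⟩

lemma coeff_phaseSeries_two_three {j : ℕ} (hj : j ∈ Finset.range 7) :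
    coeff (j + 3) (phaseSeries 2 3) = if j = 0 then 1 else if j = 1 then nonanalyticCoeff 2 3 else if j = 3 then 3 / 4 else if j = 5 then -nonanalyticCoeff 2 3 ^ 2 / 2 else 0 := by
  have hP : ∀ j ∈ Finset.range 10, coeff j (bracketSeries 2 3) =
      if j = 0 then 1 else if j = 4 then nonanalyticCoeff 2 3 else if j = 6 then 3 / 4 else 0 := by
    intro j hj
    have := Finset.mem_range.1 hj
    interval_cases j <;>
      norm_num [bracketSeries, hypCoeff, ascPochhammer_succ_eval, nonanalyticCoeff]
  have hrec := coeff_logOf_recurrence (p := 2) (by norm_num) 3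
  -- The support statement settles all but three coefficients of the logarithm; the recurrence gives
  -- the remaining ones.
  have h0 : ∀ j ∈ Finset.range 10, j ∉ ({4, 6, 8} : Finset ℕ) →
      coeff j (logOf (bracketSeries 2 3)) = 0 := by
    intro j hj hj'
    rcases eq_or_ne j 0 with rfl | hj0
    · exact coeff_logOf_bracketSeries_of_le (by norm_num) (by norm_num) (Nat.zero_le _)
    refine coeff_logOf_bracketSeries_eq_zero (by norm_num) ?_
    rintro ⟨a, b, hab⟩
    simp at hj hj'
    have ha : a ≤ 3 := by omega
    interval_cases a <;> omega
  have l4 : coeff 4 (logOf (bracketSeries 2 3)) = nonanalyticCoeff 2 3 := by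
    have := hrec 4
    simp [Finset.sum_range_succ, hP, h0] at this
    linarith
  have l6 : coeff 6 (logOf (bracketSeries 2 3)) = 3 / 4 := by
    have := hrec 6
    simp [Finset.sum_range_succ, hP, h0, l4] at this
    linarith
  have l8 : coeff 8 (logOf (bracketSeries 2 3)) = -nonanalyticCoeff 2 3 ^ 2 / 2 := by
    have := hrec 8
    simp [Finset.sum_range_succ, hP, h0, l4, l6] at this
    linarith
  rw [coeff_phaseSeries]
  have := Finset.mem_range.1 hj
  interval_cases j <;> simp [h0, l4, l6, l8]

lemma coeff_phaseSeries_six_five {j : ℕ} (hj : j ∈ Finset.range 16) :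
    coeff (j + 5) (phaseSeries 6 5) = if j = 0 then 1 else if j = 5 then -5 / 4 else if j = 7 then nonanalyticCoeff 6 5 else if j = 15 then -125 / 128 else 0 := by
  have hP : ∀ j ∈ Finset.range 21, coeff j (bracketSeries 6 5) =
      if j = 0 then 1 else if j = 10 then -5 / 4 else if j = 12 then nonanalyticCoeff 6 5 else if j = 20 then -25 / 128 else 0 := by
    intro j hj
    have := Finset.mem_range.1 hj
    interval_cases j <;>
      norm_num [bracketSeries, hypCoeff, ascPochhammer_succ_eval, nonanalyticCoeff]
  have hrec := coeff_logOf_recurrence (p := 6) (by norm_num) 5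
  have h0 : ∀ j ∈ Finset.range 21, j ∉ ({10, 12, 20} : Finset ℕ) →
      coeff j (logOf (bracketSeries 6 5)) = 0 := by
    intro j hj hj'
    rcases eq_or_ne j 0 with rfl | hj0
    · exact coeff_logOf_bracketSeries_of_le (by norm_num) (by norm_num) (Nat.zero_le _)
    refine coeff_logOf_bracketSeries_eq_zero (by norm_num) ?_
    rintro ⟨a, b, hab⟩
    simp at hj hj'
    have ha : a ≤ 3 := by omega
    interval_cases a <;> omega
  have l10 : coeff 10 (logOf (bracketSeries 6 5)) = -5 / 4 := by
    have := hrec 10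
    simp [Finset.sum_range_succ, hP, h0] at this
    linarith
  have l12 : coeff 12 (logOf (bracketSeries 6 5)) = nonanalyticCoeff 6 5 := by
    have := hrec 12
    simp [Finset.sum_range_succ, hP, h0, l10] at this
    linarith
  have l20 : coeff 20 (logOf (bracketSeries 6 5)) = -125 / 128 := by
    have := hrec 20
    simp [Finset.sum_range_succ, hP, h0, l10, l12] at this
    linarith
  rw [coeff_phaseSeries]
  have := Finset.mem_range.1 hj
  interval_cases j <;> simp [h0, l10, l12, l20]

lemma coeff_phaseSeries_four_three {j : ℕ} (hj : j ∈ Finset.range 11) :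
    coeff (j + 3) (phaseSeries 4 3) = if j = 0 then 1 else if j = 3 then -3 / 4 else if j = 5 then nonanalyticCoeff 4 3 else if j = 9 then -27 / 64 else 0 := by
  have hP : ∀ j ∈ Finset.range 14, coeff j (bracketSeries 4 3) =
      if j = 0 then 1 else if j = 6 then -3 / 4 else if j = 8 then nonanalyticCoeff 4 3 else if j = 12 then -9 / 64 else 0 := by
    intro j hj
    have := Finset.mem_range.1 hj
    interval_cases j <;>
      norm_num [bracketSeries, hypCoeff, ascPochhammer_succ_eval, nonanalyticCoeff]
  have hrec := coeff_logOf_recurrence (p := 4) (by norm_num) 3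
  have h0 : ∀ j ∈ Finset.range 14, j ∉ ({6, 8, 12} : Finset ℕ) →
      coeff j (logOf (bracketSeries 4 3)) = 0 := by
    intro j hj hj'
    rcases eq_or_ne j 0 with rfl | hj0
    · exact coeff_logOf_bracketSeries_of_le (by norm_num) (by norm_num) (Nat.zero_le _)
    refine coeff_logOf_bracketSeries_eq_zero (by norm_num) ?_
    rintro ⟨a, b, hab⟩
    simp at hj hj'
    have ha : a ≤ 3 := by omega
    interval_cases a <;> omega
  have l6 : coeff 6 (logOf (bracketSeries 4 3)) = -3 / 4 := by
    have := hrec 6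
    simp [Finset.sum_range_succ, hP, h0] at this
    linarith
  have l8 : coeff 8 (logOf (bracketSeries 4 3)) = nonanalyticCoeff 4 3 := by
    have := hrec 8
    simp [Finset.sum_range_succ, hP, h0, l6] at this
    linarith
  have l12 : coeff 12 (logOf (bracketSeries 4 3)) = -27 / 64 := by
    have := hrec 12
    simp [Finset.sum_range_succ, hP, h0, l6, l8] at this
    linarith
  rw [coeff_phaseSeries]
  have := Finset.mem_range.1 hj
  interval_cases j <;> simp [h0, l6, l8, l12]

end

section

open PowerSeries

lemma two_thirds_mem : ((2 : ℕ) : ℝ) / (3 : ℕ) ∈ Ioo (0 : ℝ) 1 ∪ Ioo 1 2 :=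
  Or.inl (by norm_num [mem_Ioo])

lemma six_fifths_mem : ((6 : ℕ) : ℝ) / (5 : ℕ) ∈ Ioo (0 : ℝ) 1 ∪ Ioo 1 2 :=
  Or.inr (by norm_num [mem_Ioo])

lemma four_thirds_mem : ((4 : ℕ) : ℝ) / (3 : ℕ) ∈ Ioo (0 : ℝ) 1 ∪ Ioo 1 2 :=
  Or.inr (by norm_num [mem_Ioo])

/-- With r = n/3, H^(-n) is U^(-r) for U = H³ = 1 + ct + (3/4)t³ - (c²/2)t⁵ + ⋯, so the values are
those of the binomial expansion. Each is solved from the recurrence, where v n j carries the factor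
3j. -/
lemma exists_derivCoeff_two_three : ∃ v : ℕ → ℕ → ℝ, (∀ m, derivCoeff 2 3 m = v (m + 3) m) ∧
    (∀ n, v n 0 = 1) ∧ ∀ (n : ℕ) (r c : ℝ), (n : ℝ) = 3 * r → c = nonanalyticCoeff 2 3 →
      v n 1 = -r * c ∧
      v n 2 = r * (r + 1) / 2 * c ^ 2 ∧
      v n 3 = -r * (3 / 4) - r * (r + 1) * (r + 2) / 6 * c ^ 3 ∧
      v n 4 = r * (r + 1) * (3 / 4) * c + r * (r + 1) * (r + 2) * (r + 3) / 24 * c ^ 4 ∧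
      v n 5 = r * c ^ 2 / 2 - r * (r + 1) * (r + 2) * (3 / 8) * c ^ 2 -
        r * (r + 1) * (r + 2) * (r + 3) * (r + 4) / 120 * c ^ 5 ∧
      v n 6 = r * (r + 1) * (9 / 32) - r * (r + 1) / 2 * c ^ 3 +
        r * (r + 1) * (r + 2) * (r + 3) / 8 * c ^ 3 +
        r * (r + 1) * (r + 2) * (r + 3) * (r + 4) * (r + 5) / 720 * c ^ 6 := by
  obtain ⟨v, hv0, hvS, hrec, hd⟩ := exists_coeff_recurrence (p := 2) (q := 3) (by norm_num)
    (by norm_num) two_thirds_mem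
  refine ⟨v, hd, hv0, fun n r c hr hc => ?_⟩
  have hu : ∀ j ∈ Finset.range 7, _ := fun j hj => coeff_phaseSeries_two_three hj
  simp only [← hc] at hu
  have v1 : v n 1 = -r * c := by
    have := hrec n 1
    simp [Finset.sum_range_succ, hu, hv0, hr] at this
    linear_combination (1 / 3) * this
  have v2 : v n 2 = r * (r + 1) / 2 * c ^ 2 := by
    have := hrec n 2
    simp [Finset.sum_range_succ, hu, hv0, hr, v1] at this
    linear_combination (1 / 6) * this
  have v3 : v n 3 = -r * (3 / 4) - r * (r + 1) * (r + 2) / 6 * c ^ 3 := by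
    have := hrec n 3
    simp [Finset.sum_range_succ, hu, hv0, hr, v1, v2] at this
    linear_combination (1 / 9) * this
  have v4 : v n 4 = r * (r + 1) * (3 / 4) * c + r * (r + 1) * (r + 2) * (r + 3) / 24 * c ^ 4 := by
    have := hrec n 4
    simp [Finset.sum_range_succ, hu, hv0, hr, v1, v2, v3] at this
    linear_combination (1 / 12) * this
  have v5 : v n 5 = r * c ^ 2 / 2 - r * (r + 1) * (r + 2) * (3 / 8) * c ^ 2 -
        r * (r + 1) * (r + 2) * (r + 3) * (r + 4) / 120 * c ^ 5 := by
    have := hrec n 5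
    simp [Finset.sum_range_succ, hu, hv0, hr, v1, v2, v3, v4] at this
    linear_combination (1 / 15) * this
  have v6 : v n 6 = r * (r + 1) * (9 / 32) - r * (r + 1) / 2 * c ^ 3 +
        r * (r + 1) * (r + 2) * (r + 3) / 8 * c ^ 3 +
        r * (r + 1) * (r + 2) * (r + 3) * (r + 4) * (r + 5) / 720 * c ^ 6 := by
    have := hrec n 6
    simp [Finset.sum_range_succ, hu, hv0, hr, v1, v2, v3, v4, v5] at this
    linear_combination (1 / 18) * this
  exact ⟨v1, v2, v3, v4, v5, v6⟩

lemma exists_derivCoeff_six_five : ∃ v : ℕ → ℕ → ℝ, (∀ m, derivCoeff 6 5 m = v (m + 5) m) ∧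
    (∀ n, v n 0 = 1) ∧ ∀ (n : ℕ) (r c : ℝ), (n : ℝ) = 5 * r → c = nonanalyticCoeff 6 5 →
      v n 5 = 5 / 4 * r ∧
      v n 7 = -r * c ∧
      v n 10 = r * (r + 1) * (25 / 32) ∧
      v n 12 = -r * (r + 1) * (5 / 4) * c ∧
      v n 14 = r * (r + 1) / 2 * c ^ 2 ∧
      v n 15 = 125 / 128 * r + r * (r + 1) * (r + 2) * (125 / 384) := by
  obtain ⟨v, hv0, hvS, hrec, hd⟩ := exists_coeff_recurrence (p := 6) (q := 5) (by norm_num)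
    (by norm_num) six_fifths_mem
  refine ⟨v, hd, hv0, fun n r c hr hc => ?_⟩
  have hu : ∀ j ∈ Finset.range 16, _ := fun j hj => coeff_phaseSeries_six_five hj
  simp only [← hc] at hu
  have hz : ∀ j ∈ Finset.range 16, j ∉ ({0, 5, 7, 10, 12, 14, 15} : Finset ℕ) → v n j = 0 := by
    intro j hj hj'
    refine hvS n j ?_
    rintro ⟨a, b, hab⟩
    simp at hj hj'
    have hb : b ≤ 3 := by omega
    interval_cases b <;> omega
  have v5 : v n 5 = 5 / 4 * r := by
    have := hrec n 5
    simp [Finset.sum_range_succ, hu, hz, hv0, hr] at this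
    linear_combination (1 / 25) * this
  have v7 : v n 7 = -r * c := by
    have := hrec n 7
    simp [Finset.sum_range_succ, hu, hz, hv0, hr, v5] at this
    linear_combination (1 / 35) * this
  have v10 : v n 10 = r * (r + 1) * (25 / 32) := by
    have := hrec n 10
    simp [Finset.sum_range_succ, hu, hz, hv0, hr, v5, v7] at this
    linear_combination (1 / 50) * this
  have v12 : v n 12 = -r * (r + 1) * (5 / 4) * c := by
    have := hrec n 12
    simp [Finset.sum_range_succ, hu, hz, hv0, hr, v5, v7, v10] at this
    linear_combination (1 / 60) * this
  have v14 : v n 14 = r * (r + 1) / 2 * c ^ 2 := by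
    have := hrec n 14
    simp [Finset.sum_range_succ, hu, hz, hv0, hr, v5, v7, v10, v12] at this
    linear_combination (1 / 70) * this
  have v15 : v n 15 = 125 / 128 * r + r * (r + 1) * (r + 2) * (125 / 384) := by
    have := hrec n 15
    simp [Finset.sum_range_succ, hu, hz, hv0, hr, v5, v7, v10, v12, v14] at this
    linear_combination (1 / 75) * this
  exact ⟨v5, v7, v10, v12, v14, v15⟩

lemma exists_derivCoeff_four_three : ∃ v : ℕ → ℕ → ℝ, (∀ m, derivCoeff 4 3 m = v (m + 3) m) ∧
    (∀ n, v n 0 = 1) ∧ ∀ (n : ℕ) (r c : ℝ), (n : ℝ) = 3 * r → c = nonanalyticCoeff 4 3 →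
      v n 3 = 3 / 4 * r ∧
      v n 5 = -r * c ∧
      v n 6 = r * (r + 1) * (9 / 32) ∧
      v n 8 = -r * (r + 1) * (3 / 4) * c ∧
      v n 9 = 27 / 64 * r + r * (r + 1) * (r + 2) * (9 / 128) ∧
      v n 10 = r * (r + 1) / 2 * c ^ 2 := by
  obtain ⟨v, hv0, hvS, hrec, hd⟩ := exists_coeff_recurrence (p := 4) (q := 3) (by norm_num)
    (by norm_num) four_thirds_mem
  refine ⟨v, hd, hv0, fun n r c hr hc => ?_⟩
  have hu : ∀ j ∈ Finset.range 11, _ := fun j hj => coeff_phaseSeries_four_three hj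
  simp only [← hc] at hu
  have hz : ∀ j ∈ Finset.range 11, j ∉ ({0, 3, 5, 6, 8, 9, 10} : Finset ℕ) → v n j = 0 := by
    intro j hj hj'
    refine hvS n j ?_
    rintro ⟨a, b, hab⟩
    simp at hj hj'
    have hb : b ≤ 3 := by omega
    interval_cases b <;> omega
  have v3 : v n 3 = 3 / 4 * r := by
    have := hrec n 3
    simp [Finset.sum_range_succ, hu, hz, hv0, hr] at this
    linear_combination (1 / 9) * this
  have v5 : v n 5 = -r * c := by
    have := hrec n 5
    simp [Finset.sum_range_succ, hu, hz, hv0, hr, v3] at this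
    linear_combination (1 / 15) * this
  have v6 : v n 6 = r * (r + 1) * (9 / 32) := by
    have := hrec n 6
    simp [Finset.sum_range_succ, hu, hz, hv0, hr, v3, v5] at this
    linear_combination (1 / 18) * this
  have v8 : v n 8 = -r * (r + 1) * (3 / 4) * c := by
    have := hrec n 8
    simp [Finset.sum_range_succ, hu, hz, hv0, hr, v3, v5, v6] at this
    linear_combination (1 / 24) * this
  have v9 : v n 9 = 27 / 64 * r + r * (r + 1) * (r + 2) * (9 / 128) := by
    have := hrec n 9
    simp [Finset.sum_range_succ, hu, hz, hv0, hr, v3, v5, v6, v8] at this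
    linear_combination (1 / 27) * this
  have v10 : v n 10 = r * (r + 1) / 2 * c ^ 2 := by
    have := hrec n 10
    simp [Finset.sum_range_succ, hu, hz, hv0, hr, v3, v5, v6, v8, v9] at this
    linear_combination (1 / 30) * this
  exact ⟨v3, v5, v6, v8, v9, v10⟩

end

/-! ### The first exponents -/

lemma expIndex_zero {p q : ℕ} (hq : 0 < q) : expIndex p q 0 = 0 := by
  obtain ⟨k, hk⟩ : 0 ∈ range (expIndex p q) := by
    rw [range_expIndex hq]
    exact ⟨0, 0, by simp⟩
  have h := (strictMono_expIndex (p := p) hq).monotone (Nat.zero_le k)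
  rw [hk] at h
  exact Nat.le_zero.1 h

/-- The enumeration is strictly increasing and exhausts the set, so an element b above a with
nothing of the set strictly between must come next. -/
lemma expIndex_succ {p q k a b : ℕ} (hq : 0 < q) (ha : expIndex p q k = a) (hab : a < b)
    (hb : ∃ x y : ℕ, b = x * q + y * (2 * p - q))
    (hgap : ∀ c, a < c → c < b → ¬ ∃ x y : ℕ, c = x * q + y * (2 * p - q)) :
    expIndex p q (k + 1) = b := by
  have hmono := strictMono_expIndex (p := p) hq
  obtain ⟨j, hj⟩ : b ∈ range (expIndex p q) := by
    rw [range_expIndex hq]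
    exact hb
  have hkj : k < j := hmono.lt_iff_lt.1 (by rw [ha, hj]; exact hab)
  rcases (Nat.succ_le_of_lt hkj).eq_or_lt with h | h
  · rw [← hj, ← h]
  · refine absurd ?_ (hgap (expIndex p q (k + 1)) (ha ▸ hmono (Nat.lt_succ_self k)) (hj ▸ hmono h))
    have : expIndex p q (k + 1) ∈ range (expIndex p q) := mem_range_self _
    rwa [range_expIndex hq] at this

lemma expIndex_two_three (k : ℕ) : expIndex 2 3 k = k := by
  induction k with
  | zero => exact expIndex_zero (by norm_num)
  | succ k ih =>
    -- Here 2p - q = 1, so every natural number is an exponent index.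
    exact expIndex_succ (by norm_num) ih (Nat.lt_succ_self k) ⟨0, k + 1, by omega⟩
      fun c h1 h2 => by omega

lemma expIndex_six_five : expIndex 6 5 0 = 0 ∧ expIndex 6 5 1 = 5 ∧ expIndex 6 5 2 = 7 ∧ expIndex 6 5 3 = 10 ∧
    expIndex 6 5 4 = 12 ∧ expIndex 6 5 5 = 14 ∧ expIndex 6 5 6 = 15 ∧ expIndex 6 5 7 = 17 := by
  have hgap : ∀ c, c < 17 → c ∉ ({0, 5, 7, 10, 12, 14, 15, 17} : Finset ℕ) →
      ¬ ∃ x y : ℕ, c = x * 5 + y * (2 * 6 - 5) := by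
    rintro c hc hc' ⟨x, y, hxy⟩
    simp at hc'
    have hx : x ≤ 3 := by omega
    interval_cases x <;> omega
  have e0 : expIndex 6 5 0 = 0 := expIndex_zero (by norm_num)
  have e1 : expIndex 6 5 1 = 5 := expIndex_succ (by norm_num) e0 (by norm_num)
    ⟨1, 0, by norm_num⟩ fun c h1 h2 => hgap c (by omega) (by simp; omega)
  have e2 : expIndex 6 5 2 = 7 := expIndex_succ (by norm_num) e1 (by norm_num)
    ⟨0, 1, by norm_num⟩ fun c h1 h2 => hgap c (by omega) (by simp; omega)
  have e3 : expIndex 6 5 3 = 10 := expIndex_succ (by norm_num) e2 (by norm_num)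
    ⟨2, 0, by norm_num⟩ fun c h1 h2 => hgap c (by omega) (by simp; omega)
  have e4 : expIndex 6 5 4 = 12 := expIndex_succ (by norm_num) e3 (by norm_num)
    ⟨1, 1, by norm_num⟩ fun c h1 h2 => hgap c (by omega) (by simp; omega)
  have e5 : expIndex 6 5 5 = 14 := expIndex_succ (by norm_num) e4 (by norm_num)
    ⟨0, 2, by norm_num⟩ fun c h1 h2 => hgap c (by omega) (by simp; omega)
  have e6 : expIndex 6 5 6 = 15 := expIndex_succ (by norm_num) e5 (by norm_num)
    ⟨3, 0, by norm_num⟩ fun c h1 h2 => hgap c (by omega) (by simp; omega)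
  have e7 : expIndex 6 5 7 = 17 := expIndex_succ (by norm_num) e6 (by norm_num)
    ⟨2, 1, by norm_num⟩ fun c h1 h2 => hgap c (by omega) (by simp; omega)
  exact ⟨e0, e1, e2, e3, e4, e5, e6, e7⟩

lemma expIndex_four_three : expIndex 4 3 0 = 0 ∧ expIndex 4 3 1 = 3 ∧ expIndex 4 3 2 = 5 ∧ expIndex 4 3 3 = 6 ∧
    expIndex 4 3 4 = 8 ∧ expIndex 4 3 5 = 9 ∧ expIndex 4 3 6 = 10 ∧ expIndex 4 3 7 = 11 := by
  have hgap : ∀ c, c < 11 → c ∉ ({0, 3, 5, 6, 8, 9, 10, 11} : Finset ℕ) →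
      ¬ ∃ x y : ℕ, c = x * 3 + y * (2 * 4 - 3) := by
    rintro c hc hc' ⟨x, y, hxy⟩
    simp at hc'
    have hx : x ≤ 3 := by omega
    interval_cases x <;> omega
  have e0 : expIndex 4 3 0 = 0 := expIndex_zero (by norm_num)
  have e1 : expIndex 4 3 1 = 3 := expIndex_succ (by norm_num) e0 (by norm_num)
    ⟨1, 0, by norm_num⟩ fun c h1 h2 => hgap c (by omega) (by simp; omega)
  have e2 : expIndex 4 3 2 = 5 := expIndex_succ (by norm_num) e1 (by norm_num)
    ⟨0, 1, by norm_num⟩ fun c h1 h2 => hgap c (by omega) (by simp; omega)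
  have e3 : expIndex 4 3 3 = 6 := expIndex_succ (by norm_num) e2 (by norm_num)
    ⟨2, 0, by norm_num⟩ fun c h1 h2 => hgap c (by omega) (by simp; omega)
  have e4 : expIndex 4 3 4 = 8 := expIndex_succ (by norm_num) e3 (by norm_num)
    ⟨1, 1, by norm_num⟩ fun c h1 h2 => hgap c (by omega) (by simp; omega)
  have e5 : expIndex 4 3 5 = 9 := expIndex_succ (by norm_num) e4 (by norm_num)
    ⟨3, 0, by norm_num⟩ fun c h1 h2 => hgap c (by omega) (by simp; omega)
  have e6 : expIndex 4 3 6 = 10 := expIndex_succ (by norm_num) e5 (by norm_num)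
    ⟨0, 2, by norm_num⟩ fun c h1 h2 => hgap c (by omega) (by simp; omega)
  have e7 : expIndex 4 3 7 = 11 := expIndex_succ (by norm_num) e6 (by norm_num)
    ⟨2, 1, by norm_num⟩ fun c h1 h2 => hgap c (by omega) (by simp; omega)
  exact ⟨e0, e1, e2, e3, e4, e5, e6, e7⟩

/-! ### Numerical values -/

lemma B_two_three : B 2 3 0 = 1 ∧
    |B 2 3 1 - 1.570228753470| ≤ 5 / 10 ^ 13 ∧
    |B 2 3 2 - 3.082022922779| ≤ 5 / 10 ^ 13 ∧
    |B 2 3 3 - 5.033299366471| ≤ 5 / 10 ^ 13 ∧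
    |B 2 3 4 - 7.536861569983| ≤ 5 / 10 ^ 13 ∧
    |B 2 3 5 - 10.658049516385| ≤ 5 / 10 ^ 13 ∧
    |B 2 3 6 - 14.372332247788| ≤ 5 / 10 ^ 13 := by
  obtain ⟨v, hd, hv0, hv⟩ := exists_derivCoeff_two_three
  obtain ⟨hlo, hhi⟩ := nonanalyticCoeff_two_three
  -- The coefficient at m is v (m+3) m, hence r = m/3 + 1.
  obtain ⟨h1, -, -, -, -, -⟩ := hv 4 (4 / 3) _ (by norm_num) rfl
  obtain ⟨-, h2, -, -, -, -⟩ := hv 5 (5 / 3) _ (by norm_num) rfl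
  obtain ⟨-, -, h3, -, -, -⟩ := hv 6 2 _ (by norm_num) rfl
  obtain ⟨-, -, -, h4, -, -⟩ := hv 7 (7 / 3) _ (by norm_num) rfl
  obtain ⟨-, -, -, -, h5, -⟩ := hv 8 (8 / 3) _ (by norm_num) rfl
  obtain ⟨-, -, -, -, -, h6⟩ := hv 9 3 _ (by norm_num) rfl
  have b0 : B 2 3 0 = 1 := by rw [B, expIndex_two_three, hd, hv0]
  have b1 : B 2 3 1 = v 4 1 := by rw [B, expIndex_two_three, hd]
  have b2 : B 2 3 2 = v 5 2 := by rw [B, expIndex_two_three, hd]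
  have b3 : B 2 3 3 = v 6 3 := by rw [B, expIndex_two_three, hd]
  have b4 : B 2 3 4 = v 7 4 := by rw [B, expIndex_two_three, hd]
  have b5 : B 2 3 5 = v 8 5 := by rw [B, expIndex_two_three, hd]
  have b6 : B 2 3 6 = v 9 6 := by rw [B, expIndex_two_three, hd]
  rw [b0, b1, h1, b2, h2, b3, h3, b4, h4, b5, h5, b6, h6]
  generalize hk : -nonanalyticCoeff 2 3 = k at hlo hhi
  have hc : nonanalyticCoeff 2 3 = -k := by rw [← hk, neg_neg]
  rw [hc]
  have hk0 : 0 ≤ k := le_trans (by norm_num) hlo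
  -- Bounds on the individual powers of k make each required estimate linear in them.
  have l2 := pow_le_pow_left₀ (by norm_num) hlo 2
  have u2 := pow_le_pow_left₀ hk0 hhi 2
  have l3 := pow_le_pow_left₀ (by norm_num) hlo 3
  have u3 := pow_le_pow_left₀ hk0 hhi 3
  have l4 := pow_le_pow_left₀ (by norm_num) hlo 4
  have u4 := pow_le_pow_left₀ hk0 hhi 4
  have l5 := pow_le_pow_left₀ (by norm_num) hlo 5
  have u5 := pow_le_pow_left₀ hk0 hhi 5
  have l6 := pow_le_pow_left₀ (by norm_num) hlo 6
  have u6 := pow_le_pow_left₀ hk0 hhi 6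
  refine ⟨rfl, ?_, ?_, ?_, ?_, ?_, ?_⟩ <;> rw [abs_le] <;> constructor <;> linarith

lemma B_six_five : B 6 5 0 = 1 ∧
    |B 6 5 1 - 2.5000000000| ≤ 5 / 10 ^ 11 ∧
    |B 6 5 2 - (-2.4023937306)| ≤ 5 / 10 ^ 11 ∧
    |B 6 5 3 - 9.3750000000| ≤ 5 / 10 ^ 11 ∧
    |B 6 5 4 - (-18.7186511511)| ≤ 5 / 10 ^ 11 ∧
    |B 6 5 5 - 9.1382014252| ≤ 5 / 10 ^ 11 ∧
    |B 6 5 6 - 42.9687500000| ≤ 5 / 10 ^ 11 := by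
  obtain ⟨v, hd, hv0, hv⟩ := exists_derivCoeff_six_five
  obtain ⟨hlo, hhi⟩ := nonanalyticCoeff_six_five
  obtain ⟨e0, e1, e2, e3, e4, e5, e6, -⟩ := expIndex_six_five
  obtain ⟨h1, -, -, -, -, -⟩ := hv 10 2 _ (by norm_num) rfl
  obtain ⟨-, h2, -, -, -, -⟩ := hv 12 (12 / 5) _ (by norm_num) rfl
  obtain ⟨-, -, h3, -, -, -⟩ := hv 15 3 _ (by norm_num) rfl
  obtain ⟨-, -, -, h4, -, -⟩ := hv 17 (17 / 5) _ (by norm_num) rfl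
  obtain ⟨-, -, -, -, h5, -⟩ := hv 19 (19 / 5) _ (by norm_num) rfl
  obtain ⟨-, -, -, -, -, h6⟩ := hv 20 4 _ (by norm_num) rfl
  have b0 : B 6 5 0 = 1 := by rw [B, e0, hd, hv0]
  have b1 : B 6 5 1 = v 10 5 := by rw [B, e1, hd]
  have b2 : B 6 5 2 = v 12 7 := by rw [B, e2, hd]
  have b3 : B 6 5 3 = v 15 10 := by rw [B, e3, hd]
  have b4 : B 6 5 4 = v 17 12 := by rw [B, e4, hd]
  have b5 : B 6 5 5 = v 19 14 := by rw [B, e5, hd]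
  have b6 : B 6 5 6 = v 20 15 := by rw [B, e6, hd]
  rw [b0, b1, h1, b2, h2, b3, h3, b4, h4, b5, h5, b6, h6]
  generalize nonanalyticCoeff 6 5 = k at hlo hhi ⊢
  have hk0 : 0 ≤ k := le_trans (by norm_num) hlo
  have l2 := pow_le_pow_left₀ (by norm_num) hlo 2
  have u2 := pow_le_pow_left₀ hk0 hhi 2
  refine ⟨rfl, ?_, ?_, ?_, ?_, ?_, ?_⟩ <;> rw [abs_le] <;> constructor <;> linarith

lemma B_four_three : B 4 3 0 = 1 ∧
    |B 4 3 1 - 1.5000000000| ≤ 5 / 10 ^ 11 ∧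
    |B 4 3 2 - (-1.4329122397)| ≤ 5 / 10 ^ 11 ∧
    |B 4 3 3 - 3.3750000000| ≤ 5 / 10 ^ 11 ∧
    |B 4 3 4 - (-6.8958901536)| ≤ 5 / 10 ^ 11 ∧
    |B 4 3 5 - 10.1250000000| ≤ 5 / 10 ^ 11 ∧
    |B 4 3 6 - 3.3365109159| ≤ 5 / 10 ^ 11 := by
  obtain ⟨v, hd, hv0, hv⟩ := exists_derivCoeff_four_three
  obtain ⟨hlo, hhi⟩ := nonanalyticCoeff_four_three
  obtain ⟨e0, e1, e2, e3, e4, e5, e6, -⟩ := expIndex_four_three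
  obtain ⟨h1, -, -, -, -, -⟩ := hv 6 2 _ (by norm_num) rfl
  obtain ⟨-, h2, -, -, -, -⟩ := hv 8 (8 / 3) _ (by norm_num) rfl
  obtain ⟨-, -, h3, -, -, -⟩ := hv 9 3 _ (by norm_num) rfl
  obtain ⟨-, -, -, h4, -, -⟩ := hv 11 (11 / 3) _ (by norm_num) rfl
  obtain ⟨-, -, -, -, h5, -⟩ := hv 12 4 _ (by norm_num) rfl
  obtain ⟨-, -, -, -, -, h6⟩ := hv 13 (13 / 3) _ (by norm_num) rfl
  have b0 : B 4 3 0 = 1 := by rw [B, e0, hd, hv0]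
  have b1 : B 4 3 1 = v 6 3 := by rw [B, e1, hd]
  have b2 : B 4 3 2 = v 8 5 := by rw [B, e2, hd]
  have b3 : B 4 3 3 = v 9 6 := by rw [B, e3, hd]
  have b4 : B 4 3 4 = v 11 8 := by rw [B, e4, hd]
  have b5 : B 4 3 5 = v 12 9 := by rw [B, e5, hd]
  have b6 : B 4 3 6 = v 13 10 := by rw [B, e6, hd]
  rw [b0, b1, h1, b2, h2, b3, h3, b4, h4, b5, h5, b6, h6]
  generalize nonanalyticCoeff 4 3 = k at hlo hhi ⊢
  have hk0 : 0 ≤ k := le_trans (by norm_num) hlo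
  have l2 := pow_le_pow_left₀ (by norm_num) hlo 2
  have u2 := pow_le_pow_left₀ hk0 hhi 2
  refine ⟨rfl, ?_, ?_, ?_, ?_, ?_, ?_⟩ <;> rw [abs_le] <;> constructor <;> linarith

/-! ### The displayed expansions -/

lemma calK_expansion_two_three (N : ℕ) :
    (fun n : ℝ => calK (2 / 3) n -
      ∑ k ∈ Finset.range N, B 2 3 k / n ^ ((k : ℝ) / 3 + 1) * Real.Gamma ((k : ℝ) / 3 + 1))
      =O[atTop] fun n : ℝ => n ^ (-((N : ℝ) / 3 + 1)) := by
  have h := calK_expansion (by norm_num) (by norm_num) two_thirds_mem N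
  simp only [expo, expIndex_two_three, Nat.cast_ofNat] at h
  simpa only [div_mul_eq_mul_div] using h

lemma Gamma_three : Real.Gamma 3 = 2 := by
  rw [show (3 : ℝ) = (2 : ℕ) + 1 by norm_num, Real.Gamma_nat_eq_factorial]
  norm_num [Nat.factorial]

lemma Gamma_four : Real.Gamma 4 = 6 := by
  rw [show (4 : ℝ) = (3 : ℕ) + 1 by norm_num, Real.Gamma_nat_eq_factorial]
  norm_num [Nat.factorial]

lemma calK_expansion_six_five :
    (fun n : ℝ => calK (6 / 5) n -
      1 / n * (1 + B 6 5 1 / n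
        + B 6 5 2 / n ^ (7 / 5 : ℝ) * Real.Gamma (12 / 5)
        + 2 * B 6 5 3 / n ^ 2
        + B 6 5 4 / n ^ (12 / 5 : ℝ) * Real.Gamma (17 / 5)
        + B 6 5 5 / n ^ (14 / 5 : ℝ) * Real.Gamma (19 / 5)
        + 6 * B 6 5 6 / n ^ 3))
      =O[atTop] fun n : ℝ => n ^ (-(17 / 5 + 1 : ℝ)) := by
  -- Seven terms are kept, so the error order comes from the next exponent, e_7 = 17/5.
  have h := calK_expansion (by norm_num) (by norm_num) six_fifths_mem 7
  obtain ⟨e0, e1, e2, e3, e4, e5, e6, e7⟩ := expIndex_six_five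
  simp only [expo, Finset.sum_range_succ, Finset.sum_range_zero, e0, e1, e2, e3, e4, e5, e6, e7, Nat.cast_ofNat, Nat.cast_zero,
    B_six_five.1] at h
  refine h.congr' ?_ EventuallyEq.rfl
  filter_upwards [eventually_gt_atTop 0] with n hn
  simp only [Real.rpow_add_one hn.ne']
  rw [show (0 / 5 : ℝ) = (0 : ℕ) by norm_num, Real.rpow_natCast]
  rw [show (5 / 5 : ℝ) = (1 : ℕ) by norm_num, Real.rpow_natCast]
  rw [show (7 / 5 + 1 : ℝ) = 12 / 5 by norm_num]
  rw [show (10 / 5 : ℝ) = (2 : ℕ) by norm_num, Real.rpow_natCast]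
  rw [show (12 / 5 + 1 : ℝ) = 17 / 5 by norm_num]
  rw [show (14 / 5 + 1 : ℝ) = 19 / 5 by norm_num]
  rw [show (15 / 5 : ℝ) = (3 : ℕ) by norm_num, Real.rpow_natCast]
  push_cast
  norm_num [Gamma_three, Gamma_four]
  ring

lemma calK_expansion_four_three :
    (fun n : ℝ => calK (4 / 3) n -
      1 / n * (1 + B 4 3 1 / n
        + B 4 3 2 / n ^ (5 / 3 : ℝ) * Real.Gamma (8 / 3)
        + 2 * B 4 3 3 / n ^ 2
        + B 4 3 4 / n ^ (8 / 3 : ℝ) * Real.Gamma (11 / 3)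
        + 6 * B 4 3 5 / n ^ 3
        + B 4 3 6 / n ^ (10 / 3 : ℝ) * Real.Gamma (13 / 3)))
      =O[atTop] fun n : ℝ => n ^ (-(11 / 3 + 1 : ℝ)) := by
  have h := calK_expansion (by norm_num) (by norm_num) four_thirds_mem 7
  obtain ⟨e0, e1, e2, e3, e4, e5, e6, e7⟩ := expIndex_four_three
  simp only [expo, Finset.sum_range_succ, Finset.sum_range_zero, e0, e1, e2, e3, e4, e5, e6, e7, Nat.cast_ofNat, Nat.cast_zero,
    B_four_three.1] at h
  refine h.congr' ?_ EventuallyEq.rfl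
  filter_upwards [eventually_gt_atTop 0] with n hn
  simp only [Real.rpow_add_one hn.ne']
  rw [show (0 / 3 : ℝ) = (0 : ℕ) by norm_num, Real.rpow_natCast]
  rw [show (3 / 3 : ℝ) = (1 : ℕ) by norm_num, Real.rpow_natCast]
  rw [show (5 / 3 + 1 : ℝ) = 8 / 3 by norm_num]
  rw [show (6 / 3 : ℝ) = (2 : ℕ) by norm_num, Real.rpow_natCast]
  rw [show (8 / 3 + 1 : ℝ) = 11 / 3 by norm_num]
  rw [show (9 / 3 : ℝ) = (3 : ℕ) by norm_num, Real.rpow_natCast]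
  rw [show (10 / 3 + 1 : ℝ) = 13 / 3 by norm_num]
  push_cast
  norm_num [Gamma_three, Gamma_four]
  ring

end BallK

end

theorem mainTheorem4 :
    (∀ p q : ℕ, ((p = 2 ∧ q = 3) ∨ (p = 6 ∧ q = 5) ∨ (p = 4 ∧ q = 3)) →
      -- the integral exists for all large `n`
      (∀ᶠ n : ℝ in atTop,
        IntegrableOn (fun x => BallK.bracket ((p : ℝ) / q) x ^ (-n)) (Ioi 0)) ∧
      -- `ψ` is an increasing bijection of `(0, ∞)`
      StrictMonoOn (BallK.phase ((p : ℝ) / q)) (Ioi 0) ∧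
      BijOn (BallK.phase ((p : ℝ) / q)) (Ioi 0) (Ioi 0) ∧
      -- the generalized series of `ψ` near `0`
      (∃ δ > 0, ∀ x ∈ Ioo (0 : ℝ) δ,
        HasSum (fun m : ℕ => PowerSeries.coeff m (BallK.phaseSeries p q) * x ^ ((m : ℝ) / q))
          (BallK.phase ((p : ℝ) / q) x)) ∧
      -- this series has exactly one reversion, and only the exponents `e_k` occur in `dx/dτ`
      (∃! T, BallK.IsReversion p q T) ∧
      (∀ m : ℕ, BallK.derivCoeff p q m ≠ 0 → ∃ k : ℕ, m = BallK.expIndex p q k) ∧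
      -- `dx/dτ = ∑ₖ B_k τ^(e_k)` near `τ = 0`
      (∃ δ > 0, ∀ τ ∈ Ioo (0 : ℝ) δ, ∃ d : ℝ,
        HasDerivAt (BallK.invPhase ((p : ℝ) / q)) d τ ∧
        HasSum (fun k : ℕ => BallK.B p q k * τ ^ BallK.expo p q k) d) ∧
      -- the complete asymptotic expansion of `𝒦_n`
      (∀ N : ℕ,
        (fun n : ℝ => BallK.calK ((p : ℝ) / q) n -
          ∑ k ∈ Finset.range N, BallK.B p q k * Real.Gamma (BallK.expo p q k + 1) /
            n ^ (BallK.expo p q k + 1))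
          =O[atTop] fun n : ℝ => n ^ (-(BallK.expo p q N + 1)))) ∧
    -- `ν = 2/3`
    (∀ N : ℕ,
      (fun n : ℝ => BallK.calK (2 / 3) n -
        ∑ k ∈ Finset.range N, BallK.B 2 3 k / n ^ ((k : ℝ) / 3 + 1) *
          Real.Gamma ((k : ℝ) / 3 + 1))
        =O[atTop] fun n : ℝ => n ^ (-((N : ℝ) / 3 + 1))) ∧
    -- `ν = 6/5`
    ((fun n : ℝ => BallK.calK (6 / 5) n -
        1 / n * (1 + BallK.B 6 5 1 / n
          + BallK.B 6 5 2 / n ^ (7 / 5 : ℝ) * Real.Gamma (12 / 5)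
          + 2 * BallK.B 6 5 3 / n ^ 2
          + BallK.B 6 5 4 / n ^ (12 / 5 : ℝ) * Real.Gamma (17 / 5)
          + BallK.B 6 5 5 / n ^ (14 / 5 : ℝ) * Real.Gamma (19 / 5)
          + 6 * BallK.B 6 5 6 / n ^ 3))
        =O[atTop] fun n : ℝ => n ^ (-(17 / 5 + 1 : ℝ))) ∧
    -- `ν = 4/3`
    ((fun n : ℝ => BallK.calK (4 / 3) n -
        1 / n * (1 + BallK.B 4 3 1 / n
          + BallK.B 4 3 2 / n ^ (5 / 3 : ℝ) * Real.Gamma (8 / 3)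
          + 2 * BallK.B 4 3 3 / n ^ 2
          + BallK.B 4 3 4 / n ^ (8 / 3 : ℝ) * Real.Gamma (11 / 3)
          + 6 * BallK.B 4 3 5 / n ^ 3
          + BallK.B 4 3 6 / n ^ (10 / 3 : ℝ) * Real.Gamma (13 / 3)))
        =O[atTop] fun n : ℝ => n ^ (-(11 / 3 + 1 : ℝ))) ∧
    -- the numerical values, correctly rounded
    (BallK.B 2 3 0 = 1 ∧
      |BallK.B 2 3 1 - 1.570228753470| ≤ 5 / 10 ^ 13 ∧
      |BallK.B 2 3 2 - 3.082022922779| ≤ 5 / 10 ^ 13 ∧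
      |BallK.B 2 3 3 - 5.033299366471| ≤ 5 / 10 ^ 13 ∧
      |BallK.B 2 3 4 - 7.536861569983| ≤ 5 / 10 ^ 13 ∧
      |BallK.B 2 3 5 - 10.658049516385| ≤ 5 / 10 ^ 13 ∧
      |BallK.B 2 3 6 - 14.372332247788| ≤ 5 / 10 ^ 13) ∧
    (BallK.B 6 5 0 = 1 ∧
      |BallK.B 6 5 1 - 2.5000000000| ≤ 5 / 10 ^ 11 ∧
      |BallK.B 6 5 2 - (-2.4023937306)| ≤ 5 / 10 ^ 11 ∧
      |BallK.B 6 5 3 - 9.3750000000| ≤ 5 / 10 ^ 11 ∧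
      |BallK.B 6 5 4 - (-18.7186511511)| ≤ 5 / 10 ^ 11 ∧
      |BallK.B 6 5 5 - 9.1382014252| ≤ 5 / 10 ^ 11 ∧
      |BallK.B 6 5 6 - 42.9687500000| ≤ 5 / 10 ^ 11) ∧
    (BallK.B 4 3 0 = 1 ∧
      |BallK.B 4 3 1 - 1.5000000000| ≤ 5 / 10 ^ 11 ∧
      |BallK.B 4 3 2 - (-1.4329122397)| ≤ 5 / 10 ^ 11 ∧
      |BallK.B 4 3 3 - 3.3750000000| ≤ 5 / 10 ^ 11 ∧
      |BallK.B 4 3 4 - (-6.8958901536)| ≤ 5 / 10 ^ 11 ∧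
      |BallK.B 4 3 5 - 10.1250000000| ≤ 5 / 10 ^ 11 ∧
      |BallK.B 4 3 6 - 3.3365109159| ≤ 5 / 10 ^ 11) := by
  refine ⟨?_, BallK.calK_expansion_two_three, BallK.calK_expansion_six_five,
    BallK.calK_expansion_four_three, BallK.B_two_three, BallK.B_six_five, BallK.B_four_three⟩
  intro p q hpq
  obtain ⟨hq, hqp, h⟩ : 0 < q ∧ q < 2 * p ∧ (p : ℝ) / q ∈ Ioo (0 : ℝ) 1 ∪ Ioo 1 2 := by
    rcases hpq with ⟨rfl, rfl⟩ | ⟨rfl, rfl⟩ | ⟨rfl, rfl⟩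
    · exact ⟨by norm_num, by norm_num, BallK.two_thirds_mem⟩
    · exact ⟨by norm_num, by norm_num, BallK.six_fifths_mem⟩
    · exact ⟨by norm_num, by norm_num, BallK.four_thirds_mem⟩
  have hν := BallK.half_lt_div hq hqp
  refine ⟨?_, BallK.strictMonoOn_phase h hν, BallK.bijOn_phase h hν,
    BallK.hasSum_phaseSeries (by omega) hq h, BallK.existsUnique_isReversion hq hqp h,
    fun m hm => BallK.exists_eq_expIndex hq hqp h hm, BallK.hasDerivAt_invPhase hq hqp h,
    fun N => BallK.calK_expansion hq hqp h N⟩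
  have hlim : Tendsto (fun n : ℝ => n * ((p : ℝ) / q - 1 / 2)) atTop atTop :=
    tendsto_id.atTop_mul_const (by linarith)
  filter_upwards [hlim.eventually_gt_atTop 1] with n hn
  exact BallK.integrableOn_bracket_rpow h hν hn
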